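/- Let $d\in\{1,2\}$, $2d\le p\le\infty$ and $0<\beta<\frac1{4(d+1)}$, and let $V\in W^{2,p}(\mathbb R^{2d})$ be a real function with $V\ge 0$ and $V(x,y)=V(y,x)$ almost everywhere. For $N\in\mathbb N$ let $$H_N=\sum_{j=1}^N(-\Delta_{x_j})+\frac1{N^2}\sum_{1\le i<j<\ell\le N}N^{2d\beta}\,V\big(N^\beta(x_i-x_j),N^\beta(x_i-x_\ell)\big)$$ be the corresponding self-adjoint operator on $L^2(\mathbb R^{dN})$, and let $L^2_s(\mathbb R^{dN})$ be the space of all $\psi\in L^2(\mathbb R^{dN})$ that are invariant under all permutations of $x_1,\dots,x_N\in\mathbb R^d$. Then there exists a constant $C>0$, and for every integer $k\ge 0$ there exists $N_0(k)\ge k$, such that for all $N\ge N_0(k)$ and all $\psi\in L^2_s(\mathbb R^{dN})$, $$\big\langle\psi,(H_N+N)^k\psi\big\rangle\ \ge\ C^kN^k\,\big\langle\psi,(1-\Delta_{x_1})\cdots(1-\Delta_{x_k})\psi\big\rangle .$$ Both sides are understood as the closed quadratic forms of the respective nonnegative self-adjoint operators, with the value $+\infty$ outside of the form domain. In particular, if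 the left side is finite, then so is the right side. -/

import Mathlib

open MeasureTheory FourierTransform
open scoped ENNReal ContDiff

noncomputable section

namespace ThreeBodyBose

/-! ### The Sobolev spaces `W^{m,p}` -/

/-- `g` is the weak derivative of `f` in the direction `v`. -/
def HasWeakDeriv {X : Type*} [NormedAddCommGroup X] [NormedSpace ℝ X] [MeasureSpace X]
    (f g : X → ℝ) (v : X) : Prop :=
  LocallyIntegrable f volume ∧ LocallyIntegrable g volume ∧
    ∀ φ : X → ℝ, ContDiff ℝ ∞ φ → HasCompactSupport φ →
      ∫ x, f x * fderiv ℝ φ x v = - ∫ x, g x * φ x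

/-- `f ∈ W^{m,p}(X)`: the function and all its weak derivatives up to order `m` are in `L^p`. -/
def MemSobolevW {X : Type*} [NormedAddCommGroup X] [NormedSpace ℝ X] [MeasureSpace X]
    (p : ℝ≥0∞) : ℕ → (X → ℝ) → Prop
  | 0, f => MemLp f p volume
  | m + 1, f => MemLp f p volume ∧ ∀ v : X, ∃ g : X → ℝ, HasWeakDeriv f g v ∧ MemSobolevW p m g

/-! ### Wave functions of `N` particles in `ℝ^d` -/

/-- The one-particle space `ℝ^d`. -/
abbrev Pos (d : ℕ) : Type := EuclideanSpace ℝ (Fin d)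

/-- The configuration space `ℝ^{dN}`; the coordinate `(i, a)` is the `a`-th component of the
position of the particle `i`. -/
abbrev Config (d N : ℕ) : Type := EuclideanSpace ℝ (Fin N × Fin d)

/-- The position `x_i ∈ ℝ^d` of the particle `i`. -/
def particle {d N : ℕ} (x : Config d N) (i : Fin N) : Pos d :=
  WithLp.toLp 2 fun a => x (i, a)

/-- The configuration `(x_{σ 1}, …, x_{σ N})`. -/
def permute {d N : ℕ} (σ : Equiv.Perm (Fin N)) (x : Config d N) : Config d N :=
  WithLp.toLp 2 fun ia => x (σ ia.1, ia.2)

/-- The space `L²(ℝ^{dN})` of complex wave functions. -/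
abbrev Wave (d N : ℕ) : Type := Lp ℂ 2 (volume : Measure (Config d N))

/-- Membership in `L²_s(ℝ^{dN})`: invariance under all permutations of the particles. -/
def IsSymmetric {d N : ℕ} (ψ : Wave d N) : Prop :=
  ∀ σ : Equiv.Perm (Fin N), (fun x => ψ (permute σ x)) =ᵐ[volume] ψ

/-! ### The Hamiltonian -/

/-- The maximal domain of the multiplication by the real function `m` on `L²`. -/
def mulDomain {X : Type*} [MeasureSpace X] (m : X → ℝ) :
    Submodule ℂ (Lp ℂ 2 (volume : Measure X)) where
  carrier := {f | MemLp (fun x => (m x : ℂ) * f x) 2 volume}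
  zero_mem' := by
    refine (MemLp.zero (ε := ℂ)).ae_eq ?_
    filter_upwards [Lp.coeFn_zero ℂ 2 (volume : Measure X)] with x hx
    rw [hx, Pi.zero_apply, mul_zero]
  add_mem' := by
    intro f g hf hg
    refine (MemLp.add hf hg).ae_eq ?_
    filter_upwards [Lp.coeFn_add f g] with x hx
    rw [hx, Pi.add_apply, Pi.add_apply, mul_add]
  smul_mem' := by
    intro c f hf
    refine (MemLp.const_smul hf c).ae_eq ?_
    filter_upwards [Lp.coeFn_smul c f] with x hx
    rw [hx, Pi.smul_apply, Pi.smul_apply, smul_eq_mul, smul_eq_mul, mul_left_comm]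

theorem mulDomain_memLp {X : Type*} [MeasureSpace X] (m : X → ℝ) (f : mulDomain m) :
    MemLp (fun x => (m x : ℂ) * f.1 x) 2 volume := f.2

/-- Multiplication by the real function `m` on `L²`, with its maximal domain. -/
def mulOp {X : Type*} [MeasureSpace X] (m : X → ℝ) :
    Lp ℂ 2 (volume : Measure X) →ₗ.[ℂ] Lp ℂ 2 (volume : Measure X) where
  domain := mulDomain m
  toFun :=
    { toFun := fun f => MemLp.toLp (fun x => (m x : ℂ) * f.1 x) (mulDomain_memLp m f)
      map_add' := by
        intro f g
        rw [← MemLp.toLp_add]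
        refine MemLp.toLp_congr _ _ ?_
        filter_upwards [Lp.coeFn_add f.1 g.1] with x hx
        rw [Pi.add_apply, ← mul_add]
        exact congrArg _ hx
      map_smul' := by
        intro c f
        rw [RingHom.id_apply, ← MemLp.toLp_const_smul]
        refine MemLp.toLp_congr _ _ ?_
        filter_upwards [Lp.coeFn_smul c f.1] with x hx
        rw [Pi.smul_apply, smul_eq_mul, mul_left_comm]
        exact congrArg _ hx }

/-- The operator `U⁻¹ A U`, with domain `U⁻¹ (D(A))`. -/
def conjOp {E : Type*} [AddCommGroup E] [Module ℂ E] (U : E ≃ₗ[ℂ] E) (A : E →ₗ.[ℂ] E) :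
    E →ₗ.[ℂ] E where
  domain := A.domain.comap U.toLinearMap
  toFun := U.symm.toLinearMap ∘ₗ A.toFun ∘ₗ U.toLinearMap.restrict (fun _ h => h)

/-- The Fourier symbol of `-Δ_{x_j}`. As `𝓕 f ξ = ∫ exp (-2πi ⟨x, ξ⟩) f x dx`, this is
`(2π)² |ξ_j|²`. -/
def lapSymbol {d N : ℕ} (j : Fin N) (ξ : Config d N) : ℝ :=
  (2 * Real.pi) ^ 2 * ‖particle ξ j‖ ^ 2

/-- The self-adjoint operator `∑_j (-Δ_{x_j}) = 𝓕⁻¹ (∑_j (2π)² |ξ_j|²) 𝓕` on `L²(ℝ^{dN})`, with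
domain `H²(ℝ^{dN})`. -/
def kinetic (d N : ℕ) : Wave d N →ₗ.[ℂ] Wave d N :=
  conjOp (Lp.fourierTransformₗᵢ (Config d N) ℂ).toLinearEquiv
    (mulOp fun ξ : Config d N => ∑ j, lapSymbol j ξ)

/-- The scaled three-body interaction
`N^{-2} ∑_{i < j < l} N^{2dβ} V(N^β (x_i - x_j), N^β (x_i - x_l))`. -/
def interaction {d : ℕ} (N : ℕ) (β : ℝ) (V : Pos d × Pos d → ℝ) (x : Config d N) : ℝ :=
  1 / (N : ℝ) ^ 2 * ∑ i : Fin N, ∑ j ∈ Finset.Ioi i, ∑ l ∈ Finset.Ioi j,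
    (N : ℝ) ^ (2 * d * β) *
      V ((N : ℝ) ^ β • (particle x i - particle x j), (N : ℝ) ^ β • (particle x i - particle x l))

/-- The Hamiltonian `H_N = ∑_j (-Δ_{x_j}) + interaction` on `L²(ℝ^{dN})`; its domain is the
intersection of the domains of the two terms. -/
def hamiltonian {d : ℕ} (N : ℕ) (β : ℝ) (V : Pos d × Pos d → ℝ) : Wave d N →ₗ.[ℂ] Wave d N :=
  kinetic d N + mulOp (interaction N β V)

/-- The operator `H_N + N`. -/
def shiftedHamiltonian {d : ℕ} (N : ℕ) (β : ℝ) (V : Pos d × Pos d → ℝ) :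
    Wave d N →ₗ.[ℂ] Wave d N :=
  ((N : ℂ) • (LinearMap.id : Wave d N →ₗ[ℂ] Wave d N)) +ᵥ hamiltonian N β V

/-! ### Quadratic forms

The quadratic form of a nonnegative self-adjoint operator is defined on all of `L²`, with the value
`∞` outside of its form domain. -/

/-- `⟨ψ, (H_N + N) ψ⟩ = ∑_j ‖∇_{x_j} ψ‖² + ∫ interaction · |ψ|² + N ‖ψ‖²`, for a nonnegative
interaction. -/
def energyForm {d : ℕ} (N : ℕ) (β : ℝ) (V : Pos d × Pos d → ℝ) (ψ : Wave d N) : ℝ≥0∞ :=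
  (∫⁻ ξ, ENNReal.ofReal (∑ j, lapSymbol j ξ) * ‖(𝓕 ψ : Wave d N) ξ‖ₑ ^ 2) +
    (∫⁻ x, ENNReal.ofReal (interaction N β V x) * ‖ψ x‖ₑ ^ 2) + N * ‖ψ‖ₑ ^ 2

open Classical in
/-- `⟨ψ, (H_N + N)^k ψ⟩`, the closed quadratic form of the `k`-th power of `A = H_N + N`, with value
`∞` outside of the form domain `D(A^{k/2})`: it is `‖A^m ψ‖²` for `k = 2 m`, and the form of `A` at
`A^m ψ` for `k = 2 m + 1`. -/
def energyPowForm {d : ℕ} (N : ℕ) (β : ℝ) (V : Pos d × Pos d → ℝ) : ℕ → Wave d N → ℝ≥0∞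
  | 0, ψ => ‖ψ‖ₑ ^ 2
  | 1, ψ => energyForm N β V ψ
  | k + 2, ψ =>
    if h : ψ ∈ (shiftedHamiltonian N β V).domain then
      energyPowForm N β V k (shiftedHamiltonian N β V ⟨ψ, h⟩)
    else ∞

/-- `⟨ψ, (1 - Δ_{x_1}) ⋯ (1 - Δ_{x_k}) ψ⟩` (for `k ≤ N`), with value `∞` outside of the form
domain. -/
def sobolevForm {d N : ℕ} (k : ℕ) (ψ : Wave d N) : ℝ≥0∞ :=
  ∫⁻ ξ, ENNReal.ofReal (∏ j : Fin N with j.val < k, (1 + lapSymbol j ξ)) *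
    ‖(𝓕 ψ : Wave d N) ξ‖ₑ ^ 2

end ThreeBodyBose

end

/-! In the Fourier representation let s_j ≥ 1 be the symbol of 1 - Δ_{x_j}, T = ∑ s_j, W the
interaction, so that A = H_N + N = T + W. Let e_k be the elementary symmetric polynomial of the s_j
(`symWeight`). On symmetric functions the form of e_k is binom(N, k) times the form of s_1 ⋯ s_k
(`IsSymmetric.lintegral_symSymbol`). It is therefore enough to bound A^k below by c_k e_k with c_k =
k!/2^⌊k/2⌋ (`powConst`): for N ≥ 2k the product c_k binom(N, k) is at least (N/4)^k. Symmetry of the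
wave function plays no other role.

The induction raises k by two, through A^(k+2) = A A^k A ≥ c_k A e_k A. In the summand of e_k with
index set J only the part of T outside of J is kept (`symWeight_mul_normSq_ge`). Summing over J
gives (k+1)(k+2) e_(k+2) + q_(k+1) + 2(k+1) Re(e_(k+1) W), where q is `symWeightSq`. All that is
needed is Re(e_(k+1) W) ≥ -δ (e_(k+2) + q_(k+1)) with small δ (`SmallInteraction`).

For this estimate each product ∏_{j ∈ J} s_j is expanded into partial derivatives, which are moved
past the potential of one triple t. If all derivatives land on the wave functions, the term is
nonnegative because V ≥ 0. In the other terms the potential is differentiated at most twice, after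
one integration by parts, and each derivative costs N^β. Multiplication by such a derivative is
bounded by two one-particle factors (1 - Δ_{x_a})^(1/2) (1 - Δ_{x_b})^(1/2), by a local Sobolev
inequality in the two positions (`exists_pairBounded`). Triples disjoint from J give no error, so
the errors of all triples add up to order N (e_(k+2) + q_(k+1)) (`sum_prod_mul_tripleWeight_le`).
With the prefactor N^(-2) N^(2dβ) this leaves δ of order N^((2d+2)β - 1), which tends to zero.

The rest is approximation. The embedding W^{2,p} ⊂ L^∞ makes W a bounded operator. The commutator
estimate is proved for mollified V with a constant independent of the mollifier and passes to the
limit by dominated convergence. To avoid the domains of powers of A, the induction is run for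
bounded operators obtained by compressing A to a ball in Fourier space (`truncOp`). These are
bounded below by 1, so equations can be solved with them and the solutions converge
(`exists_tendsto_powForm`); Fatou's lemma then returns to A. -/

open MeasureTheory FourierTransform
open scoped ENNReal ContDiff

noncomputable section

set_option linter.unusedSectionVars false
namespace ThreeBodyBose

/-! ### Elementary symmetric weights -/

section Combinatorics

variable {ι : Type*} [Fintype ι] [DecidableEq ι]

/-- Double counting of the pairs `(J, j)` with `j ∉ J`, `|J| = k`. -/
theorem sum_powersetCard_compl_insert {M : Type*} [AddCommMonoid M] (k : ℕ)
    (F : Finset ι → ι → M) :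
    ∑ J ∈ Finset.powersetCard k Finset.univ, ∑ j ∈ Jᶜ, F (insert j J) j =
      ∑ J ∈ Finset.powersetCard (k + 1) Finset.univ, ∑ j ∈ J, F J j := by
  rw [Finset.sum_sigma', Finset.sum_sigma']
  refine Finset.sum_bij' (fun x _ => ⟨insert x.2 x.1, x.2⟩) (fun x _ => ⟨x.1.erase x.2, x.2⟩)
    ?_ ?_ ?_ ?_ ?_
  · rintro ⟨J, j⟩ h
    simp only [Finset.mem_sigma, Finset.mem_powersetCard_univ, Finset.mem_compl] at h ⊢
    exact ⟨by rw [Finset.card_insert_of_notMem h.2, h.1], Finset.mem_insert_self _ _⟩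
  · rintro ⟨J, j⟩ h
    simp only [Finset.mem_sigma, Finset.mem_powersetCard_univ, Finset.mem_compl] at h ⊢
    exact ⟨by rw [Finset.card_erase_of_mem h.2, h.1]; rfl, Finset.notMem_erase _ _⟩
  · rintro ⟨J, j⟩ h
    simp only [Finset.mem_sigma, Finset.mem_powersetCard_univ, Finset.mem_compl] at h
    simp [Finset.erase_insert h.2]
  · rintro ⟨J, j⟩ h
    simp only [Finset.mem_sigma, Finset.mem_powersetCard_univ] at h
    simp [Finset.insert_erase h.2]
  · rintro ⟨J, j⟩ _
    rfl

/-- The elementary symmetric polynomial `∑_{|J| = k} ∏_{j ∈ J} s_j`. -/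
def symWeight (k : ℕ) (s : ι → ℝ) : ℝ :=
  ∑ J ∈ Finset.powersetCard k Finset.univ, ∏ j ∈ J, s j

/-- The polynomial `∑_{|J| = k} ∏_{j ∈ J} s_j ∑_{j ∈ J} s_j`. -/
def symWeightSq (k : ℕ) (s : ι → ℝ) : ℝ :=
  ∑ J ∈ Finset.powersetCard k Finset.univ, (∏ j ∈ J, s j) * ∑ j ∈ J, s j

theorem symWeight_zero (s : ι → ℝ) : symWeight 0 s = 1 := by
  simp [symWeight]

theorem symWeight_one (s : ι → ℝ) : symWeight 1 s = ∑ j, s j := by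
  simp [symWeight, Finset.powersetCard_one]

theorem symWeight_nonneg {s : ι → ℝ} (hs : ∀ j, 0 ≤ s j) (k : ℕ) : 0 ≤ symWeight k s :=
  Finset.sum_nonneg fun _ _ => Finset.prod_nonneg fun j _ => hs j

theorem symWeightSq_nonneg {s : ι → ℝ} (hs : ∀ j, 0 ≤ s j) (k : ℕ) : 0 ≤ symWeightSq k s :=
  Finset.sum_nonneg fun _ _ => mul_nonneg (Finset.prod_nonneg fun j _ => hs j)
    (Finset.sum_nonneg fun j _ => hs j)

/-- Each set of size k+1 arises as `insert j J` from exactly k+1 pairs. -/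
theorem sum_prod_mul_sum_compl (k : ℕ) (s : ι → ℝ) :
    ∑ J ∈ Finset.powersetCard k Finset.univ, (∏ j ∈ J, s j) * ∑ j ∈ Jᶜ, s j =
      (k + 1) * symWeight (k + 1) s := by
  have h := sum_powersetCard_compl_insert k (fun (J : Finset ι) _ => ∏ j ∈ J, s j)
  rw [symWeight, Finset.mul_sum]
  calc _ = ∑ J ∈ Finset.powersetCard k Finset.univ, ∑ j ∈ Jᶜ, ∏ i ∈ insert j J, s i := by
        refine Finset.sum_congr rfl fun J _ => ?_
        rw [Finset.mul_sum]
        refine Finset.sum_congr rfl fun j hj => ?_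
        rw [Finset.prod_insert (Finset.mem_compl.1 hj), mul_comm]
    _ = _ := h
    _ = _ := by
        refine Finset.sum_congr rfl fun J hJ => ?_
        rw [Finset.sum_const, (Finset.mem_powersetCard_univ.1 hJ), nsmul_eq_mul]
        push_cast
        ring

/-- One factor of the square picks j and enlarges J. The other factor splits into s_j, which
produces `symWeightSq`, and the sum outside of the enlarged set, to which the linear identity
applies at k+1. -/
theorem sum_prod_mul_sum_compl_sq (k : ℕ) (s : ι → ℝ) :
    ∑ J ∈ Finset.powersetCard k Finset.univ, (∏ j ∈ J, s j) * (∑ j ∈ Jᶜ, s j) ^ 2 =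
      (k + 1) * (k + 2) * symWeight (k + 2) s + symWeightSq (k + 1) s := by
  have h := sum_powersetCard_compl_insert k
    (fun (J : Finset ι) j => (∏ i ∈ J, s i) * (s j + ∑ i ∈ Jᶜ, s i))
  calc _ = ∑ J ∈ Finset.powersetCard k Finset.univ, ∑ j ∈ Jᶜ,
          (∏ i ∈ insert j J, s i) * (s j + ∑ i ∈ (insert j J)ᶜ, s i) := by
        refine Finset.sum_congr rfl fun J _ => ?_
        rw [sq, ← mul_assoc, Finset.mul_sum]
        refine Finset.sum_congr rfl fun j hj => ?_
        rw [Finset.prod_insert (Finset.mem_compl.1 hj), Finset.compl_insert,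
          Finset.add_sum_erase _ _ hj]
        ring
    _ = _ := h
    _ = symWeightSq (k + 1) s + (k + 1) * ∑ J ∈ Finset.powersetCard (k + 1) Finset.univ,
          (∏ j ∈ J, s j) * ∑ j ∈ Jᶜ, s j := by
        rw [symWeightSq, Finset.mul_sum, ← Finset.sum_add_distrib]
        refine Finset.sum_congr rfl fun J hJ => ?_
        rw [← Finset.mul_sum, Finset.sum_add_distrib, Finset.sum_const,
          (Finset.mem_powersetCard_univ.1 hJ), nsmul_eq_mul]
        push_cast
        ring
    _ = _ := by
        rw [sum_prod_mul_sum_compl]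
        push_cast
        ring

/-- The pointwise lower bound behind the induction step: only the part of `T = ∑_j s_j` outside of
`J` is used in each summand. -/
theorem symWeight_mul_normSq_ge {s : ι → ℝ} (hs : ∀ j, 0 ≤ s j) (k : ℕ) (u v : ℂ) :
    ((k + 1) * (k + 2) * symWeight (k + 2) s + symWeightSq (k + 1) s) * ‖u‖ ^ 2 +
        2 * (k + 1) * symWeight (k + 1) s * (starRingEnd ℂ u * v).re ≤
      symWeight k s * ‖((∑ j, s j : ℝ) : ℂ) * u + v‖ ^ 2 := by
  rw [← sum_prod_mul_sum_compl_sq, mul_assoc (2 : ℝ), ← sum_prod_mul_sum_compl, symWeight,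
    Finset.sum_mul, Finset.sum_mul, Finset.mul_sum, Finset.sum_mul, ← Finset.sum_add_distrib]
  refine Finset.sum_le_sum fun J _ => ?_
  have hP : 0 ≤ ∏ j ∈ J, s j := Finset.prod_nonneg fun j _ => hs j
  have hb : 0 ≤ ∑ j ∈ Jᶜ, s j := Finset.sum_nonneg fun j _ => hs j
  have hc : 0 ≤ ∑ j ∈ J, s j := Finset.sum_nonneg fun j _ => hs j
  rw [← Finset.sum_add_sum_compl J s]
  generalize ∑ j ∈ Jᶜ, s j = b at *
  generalize ∑ j ∈ J, s j = c at *
  generalize ∏ j ∈ J, s j = P at *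
  have key : b ^ 2 * ‖u‖ ^ 2 + 2 * b * (starRingEnd ℂ u * v).re ≤
      ‖((c + b : ℝ) : ℂ) * u + v‖ ^ 2 := by
    rw [← Complex.normSq_eq_norm_sq, ← Complex.normSq_eq_norm_sq]
    simp only [Complex.normSq_apply, Complex.add_re, Complex.add_im, Complex.mul_re,
      Complex.mul_im, Complex.ofReal_re, Complex.ofReal_im, Complex.conj_re, Complex.conj_im]
    -- The difference of the two sides is |c u + v|² + 2 b c |u|².
    have h1 : 0 ≤ b * c * (u.re ^ 2 + u.im ^ 2) := by positivity
    nlinarith [sq_nonneg (c * u.re + v.re), sq_nonneg (c * u.im + v.im)]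
  nlinarith [mul_le_mul_of_nonneg_left key hP]

/-- The weight that controls the commutator with an interaction of the particles in `t`. -/
def tripleWeight (s : ι → ℝ) (J t : Finset ι) : ℝ :=
  if Disjoint t J then 0 else if t ⊆ J then ∑ j ∈ t, s j else ∑ j ∈ t \ J, s j

theorem tripleWeight_nonneg {s : ι → ℝ} (hs : ∀ j, 0 ≤ s j) (J t : Finset ι) :
    0 ≤ tripleWeight s J t := by
  unfold tripleWeight
  split_ifs
  · exact le_rfl
  all_goals exact Finset.sum_nonneg fun j _ => hs j

/-- The bound is a sum of products of functions of single indices, so that sums over triples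
factorize. Each φ a b pairs one particle inside J with one outside; the last term covers triples
contained in J. -/
theorem tripleWeight_le {s : ι → ℝ} (hs : ∀ j, 0 ≤ s j) (J : Finset ι) {i j l : ι}
    (hij : i ≠ j) (hil : i ≠ l) (hjl : j ≠ l) :
    tripleWeight s J {i, j, l} ≤
      (let φ : ι → ι → ℝ := fun a b => (if a ∈ J then 1 else 0) * (if b ∈ J then 0 else s b)
       φ i j + φ i l + φ j i + φ j l + φ l i + φ l j) +
      (if i ∈ J then 1 else 0) * (if j ∈ J then 1 else 0) * (if l ∈ J then 1 else 0) *
        (s i + s j + s l) := by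
  have hi := hs i
  have hj := hs j
  have hl := hs l
  unfold tripleWeight
  by_cases h1 : i ∈ J <;> by_cases h2 : j ∈ J <;> by_cases h3 : l ∈ J <;>
    simp [Finset.disjoint_insert_left, Finset.insert_subset_iff, h1, h2, h3,
      Finset.sdiff_eq_filter, Finset.sum_filter, Finset.sum_insert, hij, hil, hjl] <;>
    linarith

/-- A triple contributes only if it meets J. If it also leaves J, one index lies in J, one carries s
outside of J and the third is free: hence |J| N instead of N². If it lies inside J, no index is
free. -/
theorem sum_tripleWeight_le {N : ℕ} {s : Fin N → ℝ} (hs : ∀ j, 0 ≤ s j) (J : Finset (Fin N)) :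
    ∑ i : Fin N, ∑ j ∈ Finset.Ioi i, ∑ l ∈ Finset.Ioi j, tripleWeight s J {i, j, l} ≤
      6 * (J.card * N * ∑ j ∈ Jᶜ, s j) + 3 * (J.card ^ 2 * ∑ j ∈ J, s j) := by
  set ψ : Fin N → ℝ := fun a => if a ∈ J then 1 else 0 with hψ
  set θ : Fin N → ℝ := fun b => if b ∈ J then 0 else s b with hθ
  have hψ0 : ∀ a, 0 ≤ ψ a := fun a => by simp only [hψ]; split_ifs <;> norm_num
  have hθ0 : ∀ a, 0 ≤ θ a := fun a => by simp only [hθ]; split_ifs; exacts [le_rfl, hs a]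
  have hψs : ∑ a, ψ a = J.card := by simp [hψ]
  have hθs : ∑ a, θ a = ∑ j ∈ Jᶜ, s j := by
    rw [← Finset.sum_add_sum_compl J θ]
    rw [Finset.sum_eq_zero (s := J) (fun x hx => by simp [hθ, hx]), zero_add]
    exact Finset.sum_congr rfl fun x hx => by simp [hθ, Finset.mem_compl.1 hx]
  have hψθ : ∑ a, ψ a * s a = ∑ j ∈ J, s j := by simp [hψ, Finset.sum_ite_mem]
  set B : Fin N → Fin N → Fin N → ℝ := fun i j l =>
    (ψ i * θ j + ψ i * θ l + ψ j * θ i + ψ j * θ l + ψ l * θ i + ψ l * θ j) +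
      ψ i * ψ j * ψ l * (s i + s j + s l) with hB
  have hB0 : ∀ i j l, 0 ≤ B i j l := fun i j l => by
    have := hψ0 i; have := hψ0 j; have := hψ0 l
    have := hθ0 i; have := hθ0 j; have := hθ0 l
    have := hs i; have := hs j; have := hs l
    simp only [hB]; positivity
  calc _ ≤ ∑ i, ∑ j ∈ Finset.Ioi i, ∑ l ∈ Finset.Ioi j, B i j l := by
        refine Finset.sum_le_sum fun i _ => Finset.sum_le_sum fun j hj =>
          Finset.sum_le_sum fun l hl => ?_
        rw [Finset.mem_Ioi] at hj hl
        exact tripleWeight_le hs J hj.ne (hj.trans hl).ne hl.ne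
    -- Dropping the ordering of the indices loses only a constant factor and makes the sums
    -- independent.
    _ ≤ ∑ i, ∑ j, ∑ l, B i j l := by
        refine Finset.sum_le_sum fun i _ => ?_
        refine (Finset.sum_le_sum fun j _ => ?_).trans
          (Finset.sum_le_univ_sum_of_nonneg fun j => Finset.sum_nonneg fun l _ => hB0 i j l)
        exact Finset.sum_le_univ_sum_of_nonneg fun l => hB0 i j l
    _ = _ := by
        have e : ∀ i j l, ψ i * ψ j * ψ l * (s i + s j + s l) =
            (ψ i * s i) * ψ j * ψ l + ψ i * (ψ j * s j) * ψ l + ψ i * ψ j * (ψ l * s l) := by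
          intros; ring
        simp only [hB, e, Finset.sum_add_distrib, ← Finset.mul_sum, ← Finset.sum_mul, hψs, hθs,
          hψθ, Finset.sum_const, Finset.card_univ, Fintype.card_fin, nsmul_eq_mul]
        ring

/-- The sum of the commutator weights over all triples is smaller than the main term by a
factor `N`. -/
theorem sum_prod_mul_tripleWeight_le {N : ℕ} {s : Fin N → ℝ} (hs : ∀ j, 0 ≤ s j) (k : ℕ)
    (hN : 1 ≤ N) :
    ∑ J ∈ Finset.powersetCard (k + 1) Finset.univ, ∑ i : Fin N, ∑ j ∈ Finset.Ioi i,
        ∑ l ∈ Finset.Ioi j, (∏ a ∈ J, s a) * tripleWeight s J {i, j, l} ≤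
      6 * (k + 2) ^ 2 * N * (symWeight (k + 2) s + symWeightSq (k + 1) s) := by
  have hN' : (1 : ℝ) ≤ N := by exact_mod_cast hN
  calc _ ≤ ∑ J ∈ Finset.powersetCard (k + 1) Finset.univ,
        (6 * (k + 1) * N * ((∏ a ∈ J, s a) * ∑ j ∈ Jᶜ, s j) +
          3 * (k + 1) ^ 2 * ((∏ a ∈ J, s a) * ∑ j ∈ J, s j)) := by
        refine Finset.sum_le_sum fun J hJ => ?_
        have hP : 0 ≤ ∏ a ∈ J, s a := Finset.prod_nonneg fun j _ => hs j
        have h := mul_le_mul_of_nonneg_left (sum_tripleWeight_le hs J) hP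
        rw [Finset.mem_powersetCard_univ.1 hJ] at h
        simp only [← Finset.mul_sum]
        refine h.trans (le_of_eq ?_)
        push_cast
        ring
    _ = 6 * (k + 1) * N * ((k + 2) * symWeight (k + 2) s) +
          3 * (k + 1) ^ 2 * symWeightSq (k + 1) s := by
        rw [Finset.sum_add_distrib, ← Finset.mul_sum, ← Finset.mul_sum, sum_prod_mul_sum_compl,
          symWeightSq]
        push_cast
        ring
    _ ≤ _ := by
        have h1 := symWeight_nonneg hs (k + 2)
        have h2 := symWeightSq_nonneg hs (k + 1)
        have h3 : (6 * (k + 1) * N * (k + 2) : ℝ) ≤ 6 * (k + 2) ^ 2 * N := by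
          have : (0 : ℝ) ≤ 6 * N * (k + 2) := by positivity
          nlinarith
        have h4 : (3 * (k + 1) ^ 2 : ℝ) ≤ 6 * (k + 2) ^ 2 * N := by
          have : (0 : ℝ) ≤ (k + 2 : ℝ) ^ 2 := by positivity
          nlinarith [(Nat.cast_nonneg k : (0 : ℝ) ≤ k)]
        nlinarith [mul_le_mul_of_nonneg_right h3 h1, mul_le_mul_of_nonneg_right h4 h2]

end Combinatorics

end ThreeBodyBose

end

noncomputable section

namespace ThreeBodyBose

/-! ### Temperate weights and weighted inner products of Schwartz functions -/

open SchwartzMap LineDeriv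

variable {d N : ℕ}

/-- The Fourier symbol of `1 - Δ_{x_j}`. -/
def sobSymbol (j : Fin N) (ξ : Config d N) : ℝ := 1 + lapSymbol j ξ

theorem lapSymbol_eq (j : Fin N) (ξ : Config d N) :
    lapSymbol j ξ = ∑ c, (2 * Real.pi * ξ (j, c)) ^ 2 := by
  rw [lapSymbol, EuclideanSpace.norm_sq_eq, Finset.mul_sum]
  refine Finset.sum_congr rfl fun c _ => ?_
  rw [Real.norm_eq_abs, sq_abs, mul_pow (2 * Real.pi) (ξ (j, c)) 2]
  rfl

theorem lapSymbol_nonneg (j : Fin N) (ξ : Config d N) : 0 ≤ lapSymbol j ξ := by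
  unfold lapSymbol; positivity

theorem one_le_sobSymbol (j : Fin N) (ξ : Config d N) : 1 ≤ sobSymbol j ξ :=
  le_add_of_nonneg_right (lapSymbol_nonneg j ξ)

theorem sobSymbol_pos (j : Fin N) (ξ : Config d N) : 0 < sobSymbol j ξ :=
  zero_lt_one.trans_le (one_le_sobSymbol j ξ)

theorem hasTemperateGrowth_sobSymbol (j : Fin N) :
    Function.HasTemperateGrowth (sobSymbol j : Config d N → ℝ) := by
  have h : ∀ c : Fin d, Function.HasTemperateGrowth fun ξ : Config d N => ξ (j, c) := fun c =>
    (EuclideanSpace.proj (𝕜 := ℝ) (j, c) : Config d N →L[ℝ] ℝ).hasTemperateGrowth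
  have e : (sobSymbol j : Config d N → ℝ) =
      fun ξ => 1 + ∑ c, (2 * Real.pi * ξ (j, c)) ^ 2 := by
    funext ξ; rw [sobSymbol, lapSymbol_eq]
  rw [e]
  refine (Function.HasTemperateGrowth.const 1).add
    (Function.HasTemperateGrowth.sum fun c _ => ?_)
  exact ((Function.HasTemperateGrowth.const _).mul (h c)).pow 2

theorem hasTemperateGrowth_prod {ι E : Type*} [NormedAddCommGroup E] [NormedSpace ℝ E]
    {s : Finset ι} {f : ι → E → ℝ} (hf : ∀ i ∈ s, Function.HasTemperateGrowth (f i)) :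
    Function.HasTemperateGrowth fun x => ∏ i ∈ s, f i x := by
  classical
  induction s using Finset.induction_on with
  | empty => simp [Function.HasTemperateGrowth.const]
  | insert a s ha ih =>
    simp only [Finset.prod_insert ha]
    exact (hf _ (Finset.mem_insert_self _ _)).mul
      (ih fun i hi => hf i (Finset.mem_insert_of_mem hi))

theorem hasTemperateGrowth_fderiv_apply {E F : Type*} [NormedAddCommGroup E] [NormedSpace ℝ E]
    [NormedAddCommGroup F] [NormedSpace ℝ F] {f : E → F} (hf : Function.HasTemperateGrowth f)
    (m : E) : Function.HasTemperateGrowth fun x => fderiv ℝ f x m := by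
  have h : Function.HasTemperateGrowth (fderiv ℝ f) := by
    refine ⟨hf.1.fderiv_right (by simp), fun n => ?_⟩
    obtain ⟨k, C, h⟩ := hf.2 (n + 1)
    exact ⟨k, C, fun x => by rw [norm_iteratedFDeriv_fderiv]; exact h x⟩
  exact (ContinuousLinearMap.apply ℝ F m).hasTemperateGrowth.comp h

/-- The `L²` inner product of Schwartz functions. -/
def schwartzInner (f g : 𝓢(Config d N, ℂ)) : ℂ :=
  inner ℂ (f.toLp 2 volume) (g.toLp 2 volume)

/-- Multiplication of a Schwartz function by a real function of temperate growth. -/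
abbrev mulSchwartz (v : Config d N → ℝ) (f : 𝓢(Config d N, ℂ)) : 𝓢(Config d N, ℂ) :=
  smulLeftCLM ℂ v f

theorem mulSchwartz_apply {v : Config d N → ℝ} (hv : Function.HasTemperateGrowth v)
    (f : 𝓢(Config d N, ℂ)) (x : Config d N) : mulSchwartz v f x = (v x : ℂ) * f x := by
  rw [mulSchwartz, smulLeftCLM_apply_apply hv, Complex.real_smul]

theorem schwartzInner_eq_integral (f g : 𝓢(Config d N, ℂ)) :
    schwartzInner f g = ∫ x, starRingEnd ℂ (f x) * g x := by
  rw [schwartzInner, inner_toL2_toL2_eq f g volume]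
  simp only [RCLike.inner_apply, mul_comm]

theorem integrable_conj_mul (f g : 𝓢(Config d N, ℂ)) :
    Integrable (fun x => starRingEnd ℂ (f x) * g x) :=
  MemLp.integrable_mul (p := 2) (q := 2) (show MemLp (fun x => starRingEnd ℂ (f x)) 2 volume from (f.memLp 2 volume).star) (g.memLp 2)

theorem schwartzInner_add_right (f g h : 𝓢(Config d N, ℂ)) :
    schwartzInner f (g + h) = schwartzInner f g + schwartzInner f h := by
  simp only [schwartzInner, ← inner_add_right, ← toLpCLM_apply (𝕜 := ℂ), map_add]

theorem schwartzInner_fourier (f g : 𝓢(Config d N, ℂ)) :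
    schwartzInner (𝓕 f) (𝓕 g) = schwartzInner f g :=
  inner_fourier_toL2_eq f g

/-- The form `∫ w conj(𝓕 f) 𝓕 g`. -/
def weightInner (w : Config d N → ℝ) (f g : 𝓢(Config d N, ℂ)) : ℂ :=
  schwartzInner (𝓕 f) (mulSchwartz w (𝓕 g))

/-- The quadratic form `∫ w |𝓕 f|²`. -/
def weightSq (w : Config d N → ℝ) (f : 𝓢(Config d N, ℂ)) : ℝ :=
  ∫ ξ, w ξ * ‖𝓕 f ξ‖ ^ 2

theorem weightInner_eq_integral {w : Config d N → ℝ} (hw : Function.HasTemperateGrowth w)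
    (f g : 𝓢(Config d N, ℂ)) :
    weightInner w f g = ∫ ξ, (w ξ : ℂ) * (starRingEnd ℂ (𝓕 f ξ) * 𝓕 g ξ) := by
  rw [weightInner, schwartzInner_eq_integral]
  refine integral_congr_ae (ae_of_all _ fun ξ => ?_)
  simp only [mulSchwartz_apply hw]
  ring

theorem integrable_weightInner {w : Config d N → ℝ} (hw : Function.HasTemperateGrowth w)
    (f g : 𝓢(Config d N, ℂ)) :
    Integrable fun ξ => (w ξ : ℂ) * (starRingEnd ℂ (𝓕 f ξ) * 𝓕 g ξ) := by
  refine (integrable_conj_mul (𝓕 f) (mulSchwartz w (𝓕 g))).congr (ae_of_all _ fun ξ => ?_)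
  simp only [mulSchwartz_apply hw]
  ring

theorem integrable_weightSq {w : Config d N → ℝ} (hw : Function.HasTemperateGrowth w)
    (f : 𝓢(Config d N, ℂ)) : Integrable fun ξ => w ξ * ‖𝓕 f ξ‖ ^ 2 := by
  refine (integrable_weightInner hw f f).re.congr (ae_of_all _ fun ξ => ?_)
  beta_reduce
  rw [← Complex.normSq_eq_conj_mul_self, ← Complex.ofReal_mul, Complex.normSq_eq_norm_sq]
  exact Complex.ofReal_re _

theorem weightSq_mono {w w' : Config d N → ℝ} (hw : Function.HasTemperateGrowth w)
    (hw' : Function.HasTemperateGrowth w') (h : ∀ ξ, w ξ ≤ w' ξ) (f : 𝓢(Config d N, ℂ)) :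
    weightSq w f ≤ weightSq w' f :=
  integral_mono (integrable_weightSq hw f) (integrable_weightSq hw' f)
    fun ξ => mul_le_mul_of_nonneg_right (h ξ) (sq_nonneg _)

theorem weightSq_nonneg {w : Config d N → ℝ} (h : ∀ ξ, 0 ≤ w ξ) (f : 𝓢(Config d N, ℂ)) :
    0 ≤ weightSq w f :=
  integral_nonneg fun ξ => mul_nonneg (h ξ) (sq_nonneg _)

theorem norm_toLp_sq_eq_weightSq (f : 𝓢(Config d N, ℂ)) :
    ‖f.toLp 2 volume‖ ^ 2 = weightSq (fun _ => 1) f := by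
  rw [weightSq, ← norm_fourier_toL2_eq]
  have h := schwartzInner_eq_integral (𝓕 f) (𝓕 f)
  rw [schwartzInner, inner_self_eq_norm_sq_to_K] at h
  simp only [← Complex.normSq_eq_conj_mul_self, Complex.normSq_eq_norm_sq] at h
  rw [integral_complex_ofReal] at h
  simp only [one_mul]
  exact Complex.ofReal_injective (by simpa using h)

theorem weightInner_one (f g : 𝓢(Config d N, ℂ)) :
    weightInner (fun _ => 1) f g = schwartzInner f g := by
  rw [weightInner_eq_integral (Function.HasTemperateGrowth.const 1), ← schwartzInner_fourier,
    schwartzInner_eq_integral]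
  simp

/-- Cauchy–Schwarz, in the form used for every error term: f is one of the differentiated wave
functions and g carries a derivative of the potential. -/
theorem neg_le_re_schwartzInner {f g : 𝓢(Config d N, ℂ)} {W lam : ℝ} (hlam : 0 ≤ lam)
    (hf : ‖f.toLp 2 volume‖ ^ 2 ≤ W) (hg : ‖g.toLp 2 volume‖ ^ 2 ≤ lam ^ 2 * W) :
    -(lam * W) ≤ (schwartzInner f g).re := by
  have hW : 0 ≤ W := (sq_nonneg _).trans hf
  have h1 : ‖schwartzInner f g‖ ≤ ‖f.toLp 2 volume‖ * ‖g.toLp 2 volume‖ := norm_inner_le_norm _ _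
  have h2 : ‖f.toLp 2 volume‖ * ‖g.toLp 2 volume‖ ≤ lam * W := by
    refine abs_le_of_sq_le_sq' ?_ (by positivity) |>.2
    calc _ = ‖f.toLp 2 volume‖ ^ 2 * ‖g.toLp 2 volume‖ ^ 2 := by ring
      _ ≤ W * (lam ^ 2 * W) := by gcongr
      _ = _ := by ring
  have h3 := abs_le.1 ((Complex.abs_re_le_norm _).trans (h1.trans h2))
  exact h3.1

theorem re_schwartzInner_le {f g : 𝓢(Config d N, ℂ)} {W lam : ℝ} (hlam : 0 ≤ lam)
    (hf : ‖f.toLp 2 volume‖ ^ 2 ≤ W) (hg : ‖g.toLp 2 volume‖ ^ 2 ≤ lam ^ 2 * W) :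
    (schwartzInner f g).re ≤ lam * W := by
  have h := neg_le_re_schwartzInner (f := f) (g := -g) hlam hf
    (by rw [← toLpCLM_apply (𝕜 := ℂ), map_neg, norm_neg]; exact hg)
  have e : schwartzInner f (-g) = - schwartzInner f g := by
    simp only [schwartzInner, ← toLpCLM_apply (𝕜 := ℂ), map_neg, inner_neg_right]
  rw [e, Complex.neg_re] at h
  linarith

/-! ### Partial derivatives -/

/-- The coordinate direction `c` of the particle `j`. -/
def coordVec (j : Fin N) (c : Fin d) : Config d N := EuclideanSpace.single (j, c) 1

/-- The partial derivatives with respect to the particle `j`, together with the identity. -/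
def partialOp (j : Fin N) : Option (Fin d) → 𝓢(Config d N, ℂ) → 𝓢(Config d N, ℂ)
  | none, f => f
  | some c, f => ∂_{coordVec j c} f

/-- The Fourier symbol of `partialOp`. -/
def partialSym (j : Fin N) : Option (Fin d) → Config d N → ℂ
  | none, _ => 1
  | some c, ξ => 2 * Real.pi * Complex.I * (ξ (j, c) : ℂ)

/-- The partial derivative of a real function; zero instead of the identity. -/
def partialFun (j : Fin N) : Option (Fin d) → (Config d N → ℝ) → Config d N → ℝ
  | none, _ => fun _ => 0
  | some c, v => fun x => fderiv ℝ v x (coordVec j c)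

theorem hasTemperateGrowth_partialFun (j : Fin N) (o : Option (Fin d)) {v : Config d N → ℝ}
    (hv : Function.HasTemperateGrowth v) : Function.HasTemperateGrowth (partialFun j o v) := by
  cases o with
  | none => exact Function.HasTemperateGrowth.const 0
  | some c => exact hasTemperateGrowth_fderiv_apply hv _

theorem fourier_partialOp (j : Fin N) (o : Option (Fin d)) (f : 𝓢(Config d N, ℂ))
    (ξ : Config d N) : 𝓕 (partialOp j o f) ξ = partialSym j o ξ * 𝓕 f ξ := by
  cases o with
  | none => simp [partialOp, partialSym]
  | some c =>
    have h : (inner ℝ · (coordVec j c) : Config d N → ℝ).HasTemperateGrowth :=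
      ((innerSL ℝ).flip (coordVec j c)).hasTemperateGrowth
    simp [partialOp, partialSym, fourier_lineDerivOp_eq, coordVec,
      EuclideanSpace.inner_single_right, mul_assoc] at h ⊢
    simp [smulLeftCLM_apply_apply h]

theorem sum_normSq_partialSym (j : Fin N) (ξ : Config d N) :
    ∑ o, ‖partialSym j o ξ‖ ^ 2 = sobSymbol j ξ := by
  rw [Fintype.sum_option, sobSymbol, lapSymbol_eq]
  congr 1
  · simp [partialSym]
  · refine Finset.sum_congr rfl fun c _ => ?_
    simp [partialSym, mul_pow]

/-- The Leibniz rule, uniform in `o`: for the identity `none` there is no error term, which is why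
`partialFun` is zero there. -/
theorem partialOp_mulSchwartz (j : Fin N) (o : Option (Fin d)) {v : Config d N → ℝ}
    (hv : Function.HasTemperateGrowth v) (f : 𝓢(Config d N, ℂ)) :
    partialOp j o (mulSchwartz v f) =
      mulSchwartz v (partialOp j o f) + mulSchwartz (partialFun j o v) f := by
  have hp := hasTemperateGrowth_partialFun j o hv
  ext x
  rw [_root_.add_apply, mulSchwartz_apply hv, mulSchwartz_apply hp]
  cases o with
  | none => simp [partialOp, partialFun, mulSchwartz_apply hv]
  | some c =>
    simp only [partialOp, partialFun, lineDerivOp_apply_eq_fderiv]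
    have e : (mulSchwartz v f : Config d N → ℂ) = fun x => v x • f x := by
      funext y; rw [mulSchwartz_apply hv, Complex.real_smul]
    have hv' : DifferentiableAt ℝ v x := hv.1.differentiable (by simp) x
    rw [e, fderiv_fun_smul hv' f.differentiableAt]
    simp [Complex.real_smul]

theorem partialOp_add (j : Fin N) (o : Option (Fin d)) (f g : 𝓢(Config d N, ℂ)) :
    partialOp j o (f + g) = partialOp j o f + partialOp j o g := by
  cases o with
  | none => rfl
  | some c => exact lineDerivOp_add _ f g

/-- Integration by parts, read off from the purely imaginary Fourier symbol. -/
theorem schwartzInner_partialOp (j : Fin N) (c : Fin d) (f g : 𝓢(Config d N, ℂ)) :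
    schwartzInner f (partialOp j (some c) g) = -schwartzInner (partialOp j (some c) f) g := by
  rw [← schwartzInner_fourier f, ← schwartzInner_fourier _ g, schwartzInner_eq_integral,
    schwartzInner_eq_integral, ← integral_neg]
  refine integral_congr_ae (ae_of_all _ fun ξ => ?_)
  simp only [fourier_partialOp, partialSym, map_mul, Complex.conj_I, Complex.conj_ofReal,
    map_ofNat]
  ring

/-- Expansion of one factor `1 - Δ_{x_j}` into partial derivatives. -/
theorem weightInner_sobSymbol_mul (j : Fin N) {w : Config d N → ℝ}
    (hw : Function.HasTemperateGrowth w) (f g : 𝓢(Config d N, ℂ)) :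
    weightInner (fun ξ => sobSymbol j ξ * w ξ) f g =
      ∑ o, weightInner w (partialOp j o f) (partialOp j o g) := by
  rw [weightInner_eq_integral (w := fun ξ => sobSymbol j ξ * w ξ)
    ((hasTemperateGrowth_sobSymbol j).mul hw)]
  simp only [weightInner_eq_integral hw]
  rw [← integral_finsetSum _ fun o _ => integrable_weightInner hw _ _]
  refine integral_congr_ae (ae_of_all _ fun ξ => ?_)
  simp only [fourier_partialOp, map_mul, ← sum_normSq_partialSym, Complex.ofReal_mul,
    Complex.ofReal_sum, Finset.sum_mul]
  refine Finset.sum_congr rfl fun o _ => ?_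
  rw [← Complex.normSq_eq_norm_sq, Complex.normSq_eq_conj_mul_self]
  ring

theorem weightSq_sobSymbol_mul (j : Fin N) {w : Config d N → ℝ}
    (hw : Function.HasTemperateGrowth w) (f : 𝓢(Config d N, ℂ)) :
    weightSq (fun ξ => sobSymbol j ξ * w ξ) f = ∑ o, weightSq w (partialOp j o f) := by
  simp only [weightSq]
  rw [← integral_finsetSum _ fun o _ => integrable_weightSq hw _]
  refine integral_congr_ae (ae_of_all _ fun ξ => ?_)
  simp only [fourier_partialOp, norm_mul, mul_pow, ← sum_normSq_partialSym, Finset.sum_mul]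
  exact Finset.sum_congr rfl fun o _ => by ring

theorem weightSq_partialOp_le (j : Fin N) (o : Option (Fin d)) {w : Config d N → ℝ}
    (hw : Function.HasTemperateGrowth w) (hw0 : ∀ ξ, 0 ≤ w ξ) (f : 𝓢(Config d N, ℂ)) :
    weightSq w (partialOp j o f) ≤ weightSq (fun ξ => sobSymbol j ξ * w ξ) f := by
  rw [weightSq_sobSymbol_mul j hw]
  exact Finset.single_le_sum (f := fun o => weightSq w (partialOp j o f))
    (fun _ _ => weightSq_nonneg hw0 _) (Finset.mem_univ o)

end ThreeBodyBose

end

noncomputable section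

namespace ThreeBodyBose
open SchwartzMap LineDeriv
variable {d N : ℕ}

/-! ### Commutators of the derivatives with a smooth three-body interaction -/

/-- Multiplication by `w` is bounded by `lam (1 - Δ_{x_a})^{1/2} (1 - Δ_{x_b})^{1/2}`. -/
def PairBounded (lam : ℝ) (w : Config d N → ℝ) (a b : Fin N) : Prop :=
  ∀ f : 𝓢(Config d N, ℂ), ‖(mulSchwartz w f).toLp 2 volume‖ ^ 2 ≤
    lam ^ 2 * weightSq (fun ξ => sobSymbol a ξ * sobSymbol b ξ) f

theorem PairBounded.zero (lam : ℝ) (a b : Fin N) :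
    PairBounded lam (fun _ : Config d N => 0) a b := by
  intro f
  have h : mulSchwartz (fun _ : Config d N => 0) f = 0 := by
    ext x
    rw [mulSchwartz_apply (Function.HasTemperateGrowth.const 0)]
    simp
  rw [h, ← toLpCLM_apply (𝕜 := ℂ), map_zero, norm_zero]
  refine le_trans (by simp) (mul_nonneg (sq_nonneg lam)
    (weightSq_nonneg (fun ξ => mul_nonneg (sobSymbol_pos _ _).le (sobSymbol_pos _ _).le) f))

theorem re_schwartzInner_mulSchwartz_nonneg {v : Config d N → ℝ}
    (hv : Function.HasTemperateGrowth v) (hv0 : ∀ x, 0 ≤ v x) (f : 𝓢(Config d N, ℂ)) :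
    0 ≤ (schwartzInner f (mulSchwartz v f)).re := by
  rw [schwartzInner_eq_integral]
  have h := integral_re (𝕜 := ℂ) (integrable_conj_mul f (mulSchwartz v f))
  rw [← RCLike.re_eq_complex_re, ← h]
  refine integral_nonneg fun x => ?_
  rw [mulSchwartz_apply hv, mul_left_comm, ← Complex.normSq_eq_conj_mul_self,
    ← Complex.ofReal_mul]
  exact mul_nonneg (hv0 x) (Complex.normSq_nonneg _)

section Commutators

variable {v : Config d N → ℝ} {lam : ℝ}

local notation "S" => sobSymbol

/-- Leibniz gives v times the derivative of f, which contributes a nonnegative amount, and one error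
per direction. There are d+1 directions, counting the identity. The particle b serves only to absorb
the singularity of ∂v. -/
theorem re_weightInner_mulSchwartz_one (hv : Function.HasTemperateGrowth v) (hv0 : ∀ x, 0 ≤ v x)
    (hlam : 0 ≤ lam) (a b : Fin N) (ha : ∀ o, PairBounded lam (partialFun a o v) a b)
    (f : 𝓢(Config d N, ℂ)) :
    -((d + 1) * lam * weightSq (fun ξ => S a ξ * S b ξ) f) ≤
      (weightInner (fun ξ => S a ξ * 1) f (mulSchwartz v f)).re := by
  have hS := hasTemperateGrowth_sobSymbol (d := d) (N := N)
  rw [weightInner_sobSymbol_mul a (Function.HasTemperateGrowth.const 1), Complex.re_sum]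
  set W := weightSq (fun ξ => S a ξ * S b ξ) f with hW
  have key : ∀ o, -(lam * W) ≤
      (weightInner (fun _ => 1) (partialOp a o f) (partialOp a o (mulSchwartz v f))).re := by
    intro o
    rw [weightInner_one, partialOp_mulSchwartz a o hv, schwartzInner_add_right, Complex.add_re]
    have h0 := re_schwartzInner_mulSchwartz_nonneg hv hv0 (partialOp a o f)
    have h1 : ‖(partialOp a o f).toLp 2 volume‖ ^ 2 ≤ W := by
      rw [norm_toLp_sq_eq_weightSq]
      refine (weightSq_partialOp_le a o (Function.HasTemperateGrowth.const 1) (by simp) f).trans ?_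
      refine weightSq_mono ((hS a).mul (Function.HasTemperateGrowth.const 1))
        ((hS a).mul (hS b)) (fun ξ => ?_) f
      exact mul_le_mul_of_nonneg_left (one_le_sobSymbol b ξ) (sobSymbol_pos a ξ).le
    have h2 := neg_le_re_schwartzInner hlam h1 (ha o f)
    linarith
  calc _ = ∑ _o : Option (Fin d), -(lam * W) := by
        simp only [Finset.sum_const, Finset.card_univ, Fintype.card_option, Fintype.card_fin,
          nsmul_eq_mul]
        push_cast; ring
    _ ≤ _ := Finset.sum_le_sum fun o _ => key o

/-- Of the four Leibniz terms the one without derivatives on v is nonnegative. The factor 3 counts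
the others. One derivative on v is absorbed together with the free particle c; both derivatives on v
are absorbed by a and b themselves. -/
theorem re_weightInner_mulSchwartz_two (hv : Function.HasTemperateGrowth v) (hv0 : ∀ x, 0 ≤ v x)
    (hlam : 0 ≤ lam) (a b c : Fin N) (ha : ∀ o, PairBounded lam (partialFun a o v) a c)
    (hb : ∀ o, PairBounded lam (partialFun b o v) b c)
    (hab : ∀ o o', PairBounded lam (partialFun b o' (partialFun a o v)) a b)
    (f : 𝓢(Config d N, ℂ)) :
    -(3 * (d + 1) ^ 2 * lam * weightSq (fun ξ => S a ξ * (S b ξ * S c ξ)) f) ≤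
      (weightInner (fun ξ => S a ξ * (S b ξ * 1)) f (mulSchwartz v f)).re := by
  have hS := hasTemperateGrowth_sobSymbol (d := d) (N := N)
  have h1g := Function.HasTemperateGrowth.const (E := Config d N) (1 : ℝ)
  have hp : ∀ j (ξ : Config d N), 0 ≤ S j ξ := fun j ξ => (sobSymbol_pos j ξ).le
  have hp1 : ∀ j (ξ : Config d N), 1 ≤ S j ξ := fun j ξ => one_le_sobSymbol j ξ
  rw [weightInner_sobSymbol_mul a (w := fun ξ => S b ξ * 1) ((hS b).mul h1g), Complex.re_sum]
  simp only [weightInner_sobSymbol_mul b h1g, Complex.re_sum]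
  set W := weightSq (fun ξ => S a ξ * (S b ξ * S c ξ)) f with hW
  have key : ∀ o o', -(3 * lam * W) ≤ (weightInner (fun _ => 1) (partialOp b o' (partialOp a o f))
      (partialOp b o' (partialOp a o (mulSchwartz v f)))).re := by
    intro o o'
    have ga := hasTemperateGrowth_partialFun a o hv
    rw [weightInner_one, partialOp_mulSchwartz a o hv, partialOp_add,
      partialOp_mulSchwartz b o' hv, partialOp_mulSchwartz b o' ga]
    simp only [schwartzInner_add_right, Complex.add_re]
    have h0 := re_schwartzInner_mulSchwartz_nonneg hv hv0 (partialOp b o' (partialOp a o f))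
    have h1 : ‖(partialOp b o' (partialOp a o f)).toLp 2 volume‖ ^ 2 ≤ W := by
      rw [norm_toLp_sq_eq_weightSq]
      refine (weightSq_partialOp_le b o' h1g (by simp) _).trans ?_
      refine (weightSq_partialOp_le a o ((hS b).mul h1g) (fun ξ => by simp [hp]) _).trans ?_
      refine weightSq_mono ((hS a).mul ((hS b).mul h1g)) ((hS a).mul ((hS b).mul (hS c)))
        (fun ξ => ?_) f
      simp only [Pi.mul_apply]
      exact mul_le_mul_of_nonneg_left (mul_le_mul_of_nonneg_left (hp1 c ξ) (hp b ξ)) (hp a ξ)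
    have e1 : ‖(mulSchwartz (partialFun b o' v) (partialOp a o f)).toLp 2 volume‖ ^ 2 ≤
        lam ^ 2 * W := by
      refine (hb o' _).trans (mul_le_mul_of_nonneg_left ?_ (sq_nonneg _))
      exact weightSq_partialOp_le a o ((hS b).mul (hS c))
        (fun ξ => mul_nonneg (hp _ _) (hp _ _)) _
    have e2 : ‖(mulSchwartz (partialFun a o v) (partialOp b o' f)).toLp 2 volume‖ ^ 2 ≤
        lam ^ 2 * W := by
      refine (ha o _).trans (mul_le_mul_of_nonneg_left ?_ (sq_nonneg _))
      refine (weightSq_partialOp_le b o' ((hS a).mul (hS c))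
        (fun ξ => mul_nonneg (hp _ _) (hp _ _)) _).trans (le_of_eq ?_)
      exact congrArg (weightSq · f) (funext fun ξ => by simp only [Pi.mul_apply]; ring)
    have e3 : ‖(mulSchwartz (partialFun b o' (partialFun a o v)) f).toLp 2 volume‖ ^ 2 ≤
        lam ^ 2 * W := by
      refine (hab o o' _).trans (mul_le_mul_of_nonneg_left ?_ (sq_nonneg _))
      refine weightSq_mono ((hS a).mul (hS b)) ((hS a).mul ((hS b).mul (hS c))) (fun ξ => ?_) f
      exact mul_le_mul_of_nonneg_left (le_mul_of_one_le_right (hp b ξ) (hp1 c ξ)) (hp a ξ)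
    have i1 := neg_le_re_schwartzInner hlam h1 e1
    have i2 := neg_le_re_schwartzInner hlam h1 e2
    have i3 := neg_le_re_schwartzInner hlam h1 e3
    linarith
  calc _ = ∑ _o : Option (Fin d), ∑ _o' : Option (Fin d), -(3 * lam * W) := by
        simp only [Finset.sum_const, Finset.card_univ, Fintype.card_option, Fintype.card_fin,
          nsmul_eq_mul]
        push_cast; ring
    _ ≤ _ := Finset.sum_le_sum fun o _ => Finset.sum_le_sum fun o' _ => key o o'

/-- Here no particle of the triple is free, so a term with one derivative on v has to use one of the
three symbols twice; this is the origin of the factor S a + S b + S c. Three terms have one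
derivative on v, three have two, and the term with three counts twice after integration by parts: 8
in total. -/
theorem re_weightInner_mulSchwartz_three (hv : Function.HasTemperateGrowth v) (hv0 : ∀ x, 0 ≤ v x)
    (hlam : 0 ≤ lam) (a b c : Fin N) (ha : ∀ o, PairBounded lam (partialFun a o v) a b)
    (hb : ∀ o, PairBounded lam (partialFun b o v) b c)
    (hc : ∀ o, PairBounded lam (partialFun c o v) c a)
    (hab : ∀ o o', PairBounded lam (partialFun b o' (partialFun a o v)) a b)
    (hac : ∀ o o', PairBounded lam (partialFun c o' (partialFun a o v)) a c)
    (hbc : ∀ o o', PairBounded lam (partialFun c o' (partialFun b o v)) b c)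
    (f : 𝓢(Config d N, ℂ)) :
    -(8 * (d + 1) ^ 3 * lam *
        weightSq (fun ξ => S a ξ * (S b ξ * S c ξ) * (S a ξ + S b ξ + S c ξ)) f) ≤
      (weightInner (fun ξ => S a ξ * (S b ξ * (S c ξ * 1))) f (mulSchwartz v f)).re := by
  have hS := hasTemperateGrowth_sobSymbol (d := d) (N := N)
  have h1g := Function.HasTemperateGrowth.const (E := Config d N) (1 : ℝ)
  have hp : ∀ j (ξ : Config d N), 0 ≤ S j ξ := fun j ξ => (sobSymbol_pos j ξ).le
  have hp1 : ∀ j (ξ : Config d N), 1 ≤ S j ξ := fun j ξ => one_le_sobSymbol j ξ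
  rw [weightInner_sobSymbol_mul a (w := fun ξ => S b ξ * (S c ξ * 1))
    ((hS b).mul ((hS c).mul h1g)), Complex.re_sum]
  simp only [weightInner_sobSymbol_mul b (w := fun ξ => S c ξ * 1) ((hS c).mul h1g),
    weightInner_sobSymbol_mul c h1g, Complex.re_sum]
  set W := weightSq (fun ξ => S a ξ * (S b ξ * S c ξ) * (S a ξ + S b ξ + S c ξ)) f with hW
  have hWg : Function.HasTemperateGrowth
      (fun ξ : Config d N => S a ξ * (S b ξ * S c ξ) * (S a ξ + S b ξ + S c ξ)) :=
    ((hS a).mul ((hS b).mul (hS c))).mul (((hS a).add (hS b)).add (hS c))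
  have hWle : ∀ {w : Config d N → ℝ}, Function.HasTemperateGrowth w →
      (∀ ξ, w ξ ≤ S a ξ * (S b ξ * S c ξ) * (S a ξ + S b ξ + S c ξ)) → weightSq w f ≤ W :=
    fun hw h => weightSq_mono hw hWg h f
  have key : ∀ o o' o'', -(8 * lam * W) ≤
      (weightInner (fun _ => 1) (partialOp c o'' (partialOp b o' (partialOp a o f)))
        (partialOp c o'' (partialOp b o' (partialOp a o (mulSchwartz v f))))).re := by
    intro o o' o''
    have ga := hasTemperateGrowth_partialFun a o hv
    have gb := hasTemperateGrowth_partialFun b o' hv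
    have gab := hasTemperateGrowth_partialFun b o' ga
    rw [weightInner_one, partialOp_mulSchwartz a o hv, partialOp_add,
      partialOp_mulSchwartz b o' hv, partialOp_mulSchwartz b o' ga]
    simp only [partialOp_add]
    rw [partialOp_mulSchwartz c o'' hv, partialOp_mulSchwartz c o'' gb,
      partialOp_mulSchwartz c o'' ga, partialOp_mulSchwartz c o'' gab]
    set F := partialOp c o'' (partialOp b o' (partialOp a o f)) with hF
    simp only [schwartzInner_add_right, Complex.add_re]
    have h0 := re_schwartzInner_mulSchwartz_nonneg hv hv0 F
    have hFle : ∀ {w : Config d N → ℝ}, Function.HasTemperateGrowth w → (∀ ξ, 0 ≤ w ξ) →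
        (∀ ξ, S a ξ * (S b ξ * (S c ξ * w ξ)) ≤
          S a ξ * (S b ξ * S c ξ) * (S a ξ + S b ξ + S c ξ)) → weightSq w F ≤ W := by
      intro w hw hw0 h
      refine (weightSq_partialOp_le c o'' hw hw0 _).trans ?_
      refine (weightSq_partialOp_le b o' ((hS c).mul hw)
        (fun ξ => mul_nonneg (hp _ _) (hw0 _)) _).trans ?_
      refine (weightSq_partialOp_le a o ((hS b).mul ((hS c).mul hw))
        (fun ξ => mul_nonneg (hp _ _) (mul_nonneg (hp _ _) (hw0 _))) _).trans ?_
      exact hWle ((hS a).mul ((hS b).mul ((hS c).mul hw))) h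
    have h1 : ‖F.toLp 2 volume‖ ^ 2 ≤ W := by
      rw [norm_toLp_sq_eq_weightSq]
      refine hFle h1g (by simp) fun ξ => ?_
      have ha := hp1 a ξ; have hb := hp1 b ξ; have hc := hp1 c ξ
      rw [mul_one]
      exact le_mul_of_one_le_right (by positivity) (by linarith)
    have pos3 : ∀ ξ : Config d N, 0 ≤ S a ξ * (S b ξ * S c ξ) := fun ξ =>
      mul_nonneg (hp _ _) (mul_nonneg (hp _ _) (hp _ _))
    -- the terms with one derivative on the interaction
    have e1 : ‖(mulSchwartz (partialFun c o'' v)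
        (partialOp b o' (partialOp a o f))).toLp 2 volume‖ ^ 2 ≤ lam ^ 2 * W := by
      refine (hc o'' _).trans (mul_le_mul_of_nonneg_left ?_ (sq_nonneg _))
      refine (weightSq_partialOp_le b o' ((hS c).mul (hS a))
        (fun ξ => mul_nonneg (hp _ _) (hp _ _)) _).trans ?_
      refine (weightSq_partialOp_le a o ((hS b).mul ((hS c).mul (hS a)))
        (fun ξ => mul_nonneg (hp _ _) (mul_nonneg (hp _ _) (hp _ _))) _).trans ?_
      refine hWle ((hS a).mul ((hS b).mul ((hS c).mul (hS a)))) fun ξ => ?_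
      have := mul_nonneg (pos3 ξ) (add_nonneg (hp b ξ) (hp c ξ))
      simp only [Pi.mul_apply]
      linarith
    have e2 : ‖(mulSchwartz (partialFun b o' v)
        (partialOp c o'' (partialOp a o f))).toLp 2 volume‖ ^ 2 ≤ lam ^ 2 * W := by
      refine (hb o' _).trans (mul_le_mul_of_nonneg_left ?_ (sq_nonneg _))
      refine (weightSq_partialOp_le c o'' ((hS b).mul (hS c))
        (fun ξ => mul_nonneg (hp _ _) (hp _ _)) _).trans ?_
      refine (weightSq_partialOp_le a o ((hS c).mul ((hS b).mul (hS c)))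
        (fun ξ => mul_nonneg (hp _ _) (mul_nonneg (hp _ _) (hp _ _))) _).trans ?_
      refine hWle ((hS a).mul ((hS c).mul ((hS b).mul (hS c)))) fun ξ => ?_
      have := mul_nonneg (pos3 ξ) (add_nonneg (hp a ξ) (hp b ξ))
      simp only [Pi.mul_apply]
      linarith
    have e3 : ‖(mulSchwartz (partialFun a o v)
        (partialOp c o'' (partialOp b o' f))).toLp 2 volume‖ ^ 2 ≤ lam ^ 2 * W := by
      refine (ha o _).trans (mul_le_mul_of_nonneg_left ?_ (sq_nonneg _))
      refine (weightSq_partialOp_le c o'' ((hS a).mul (hS b))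
        (fun ξ => mul_nonneg (hp _ _) (hp _ _)) _).trans ?_
      refine (weightSq_partialOp_le b o' ((hS c).mul ((hS a).mul (hS b)))
        (fun ξ => mul_nonneg (hp _ _) (mul_nonneg (hp _ _) (hp _ _))) _).trans ?_
      refine hWle ((hS b).mul ((hS c).mul ((hS a).mul (hS b)))) fun ξ => ?_
      have := mul_nonneg (pos3 ξ) (add_nonneg (hp a ξ) (hp c ξ))
      simp only [Pi.mul_apply]
      linarith
    -- the terms with two derivatives on the interaction
    have le3 : ∀ ξ : Config d N, S a ξ * (S b ξ * S c ξ) ≤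
        S a ξ * (S b ξ * S c ξ) * (S a ξ + S b ξ + S c ξ) := fun ξ =>
      le_mul_of_one_le_right (pos3 ξ) (by linarith [hp1 a ξ, hp b ξ, hp c ξ])
    have e4 : ‖(mulSchwartz (partialFun c o'' (partialFun b o' v))
        (partialOp a o f)).toLp 2 volume‖ ^ 2 ≤ lam ^ 2 * W := by
      refine (hbc o' o'' _).trans (mul_le_mul_of_nonneg_left ?_ (sq_nonneg _))
      refine (weightSq_partialOp_le a o ((hS b).mul (hS c))
        (fun ξ => mul_nonneg (hp _ _) (hp _ _)) _).trans ?_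
      exact hWle ((hS a).mul ((hS b).mul (hS c))) le3
    have e5 : ‖(mulSchwartz (partialFun c o'' (partialFun a o v))
        (partialOp b o' f)).toLp 2 volume‖ ^ 2 ≤ lam ^ 2 * W := by
      refine (hac o o'' _).trans (mul_le_mul_of_nonneg_left ?_ (sq_nonneg _))
      refine (weightSq_partialOp_le b o' ((hS a).mul (hS c))
        (fun ξ => mul_nonneg (hp _ _) (hp _ _)) _).trans ?_
      refine hWle ((hS b).mul ((hS a).mul (hS c))) fun ξ => (le_of_eq ?_).trans (le3 ξ)
      simp only [Pi.mul_apply]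
      ring
    have e6 : ‖(mulSchwartz (partialFun b o' (partialFun a o v))
        (partialOp c o'' f)).toLp 2 volume‖ ^ 2 ≤ lam ^ 2 * W := by
      refine (hab o o' _).trans (mul_le_mul_of_nonneg_left ?_ (sq_nonneg _))
      refine (weightSq_partialOp_le c o'' ((hS a).mul (hS b))
        (fun ξ => mul_nonneg (hp _ _) (hp _ _)) _).trans ?_
      refine hWle ((hS c).mul ((hS a).mul (hS b))) fun ξ => (le_of_eq ?_).trans (le3 ξ)
      simp only [Pi.mul_apply]
      ring
    -- the term with three derivatives on the interaction
    have hW0 : 0 ≤ W := (sq_nonneg _).trans h1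
    have e7 : -(2 * lam * W) ≤ (schwartzInner F
        (mulSchwartz (partialFun c o'' (partialFun b o' (partialFun a o v))) f)).re := by
      have hlW := mul_nonneg hlam hW0
      cases o'' with
      | none =>
        have hz : mulSchwartz (partialFun c none (partialFun b o' (partialFun a o v))) f = 0 := by
          ext x
          rw [mulSchwartz_apply (hasTemperateGrowth_partialFun c none gab)]
          simp [partialFun]
        rw [hz, schwartzInner, ← toLpCLM_apply (𝕜 := ℂ), ← toLpCLM_apply (𝕜 := ℂ), map_zero,
          inner_zero_right, Complex.zero_re]
        linarith
      | some k =>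
        -- Only two derivatives of v are under control. By Leibniz, the third one is traded for a
        -- derivative on F, by integration by parts, and one on f.
        have h := congrArg (fun g => (schwartzInner F g).re)
          (partialOp_mulSchwartz c (some k) gab f)
        simp only [schwartzInner_add_right, schwartzInner_partialOp, Complex.add_re,
          Complex.neg_re] at h
        -- The additional derivative on F costs a second factor S c, which the weight of W allows.
        have j1 : ‖(partialOp c (some k) F).toLp 2 volume‖ ^ 2 ≤ W := by
          rw [norm_toLp_sq_eq_weightSq]
          refine (weightSq_partialOp_le c _ h1g (by simp) _).trans ?_
          refine hFle ((hS c).mul h1g) (fun ξ => by simp [hp]) fun ξ => ?_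
          have := mul_nonneg (pos3 ξ) (add_nonneg (hp a ξ) (hp b ξ))
          nlinarith
        have j2 : ‖(mulSchwartz (partialFun b o' (partialFun a o v)) f).toLp 2 volume‖ ^ 2 ≤
            lam ^ 2 * W := by
          refine (hab o o' _).trans (mul_le_mul_of_nonneg_left ?_ (sq_nonneg _))
          refine hWle ((hS a).mul (hS b)) fun ξ => le_trans ?_ (le3 ξ)
          exact mul_le_mul_of_nonneg_left (le_mul_of_one_le_right (hp b ξ) (hp1 c ξ)) (hp a ξ)
        have k1 := re_schwartzInner_le hlam j1 j2
        have k2 := re_schwartzInner_le hlam h1 e6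
        linarith
    have i1 := neg_le_re_schwartzInner hlam h1 e1
    have i2 := neg_le_re_schwartzInner hlam h1 e2
    have i3 := neg_le_re_schwartzInner hlam h1 e3
    have i4 := neg_le_re_schwartzInner hlam h1 e4
    have i5 := neg_le_re_schwartzInner hlam h1 e5
    have i6 := neg_le_re_schwartzInner hlam h1 e6
    linarith
  calc _ = ∑ _o : Option (Fin d), ∑ _o' : Option (Fin d), ∑ _o'' : Option (Fin d),
          -(8 * lam * W) := by
        simp only [Finset.sum_const, Finset.card_univ, Fintype.card_option, Fintype.card_fin,
          nsmul_eq_mul]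
        push_cast; ring
    _ ≤ _ := Finset.sum_le_sum fun o _ => Finset.sum_le_sum fun o' _ =>
        Finset.sum_le_sum fun o'' _ => key o o' o''

end Commutators

end ThreeBodyBose

end

/-! ### Regular three-body interactions against products over arbitrary index sets -/

noncomputable section

namespace ThreeBodyBose
open SchwartzMap LineDeriv
variable {d N : ℕ}

/-- A smooth nonnegative interaction of the particles in `t` whose first and mixed second
derivatives are bounded by two derivatives. -/
structure RegularInteraction (lam : ℝ) (v : Config d N → ℝ) (t : Finset (Fin N)) : Prop where
  growth : Function.HasTemperateGrowth v
  nonneg : ∀ x, 0 ≤ v x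
  lam_nonneg : 0 ≤ lam
  indep : ∀ m, m ∉ t → ∀ o, partialFun m o v = fun _ => 0
  first : ∀ a ∈ t, ∀ b ∈ t, a ≠ b → ∀ o, PairBounded lam (partialFun a o v) a b
  second : ∀ a ∈ t, ∀ b ∈ t, a ≠ b → ∀ o o',
    PairBounded lam (partialFun b o' (partialFun a o v)) a b

theorem hasTemperateGrowth_prod_sobSymbol (J : Finset (Fin N)) :
    Function.HasTemperateGrowth fun ξ : Config d N => ∏ j ∈ J, sobSymbol j ξ :=
  hasTemperateGrowth_prod fun j _ => hasTemperateGrowth_sobSymbol j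

theorem hasTemperateGrowth_tripleWeight (J t : Finset (Fin N)) :
    Function.HasTemperateGrowth fun ξ : Config d N =>
      tripleWeight (fun j => sobSymbol j ξ) J t := by
  unfold tripleWeight
  split_ifs
  · exact Function.HasTemperateGrowth.const 0
  all_goals exact Function.HasTemperateGrowth.sum fun j _ => hasTemperateGrowth_sobSymbol j

/-- The particles of J outside of t are spectators and can be split off. -/
theorem tripleWeight_inter {ι : Type*} [Fintype ι] [DecidableEq ι] (s : ι → ℝ) (J t : Finset ι) :
    tripleWeight s (J ∩ t) t = tripleWeight s J t := by
  have h1 : Disjoint t (J ∩ t) ↔ Disjoint t J := by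
    rw [disjoint_comm, Finset.disjoint_iff_inter_eq_empty, Finset.inter_assoc, Finset.inter_self,
      ← Finset.disjoint_iff_inter_eq_empty, disjoint_comm]
  have h2 : t ⊆ J ∩ t ↔ t ⊆ J := by simp [Finset.subset_inter_iff]
  have h3 : t \ (J ∩ t) = t \ J := by ext; simp +contextual
  simp only [tripleWeight, h1, h2, h3]

theorem le_tripleWeight {ι : Type*} [Fintype ι] [DecidableEq ι] {s : ι → ℝ} (hs : ∀ j, 0 ≤ s j)
    {K t : Finset ι} {a c : ι} (ha : a ∈ K) (hat : a ∈ t) (hct : c ∈ t) (hcK : c ∉ K) :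
    s c ≤ tripleWeight s K t := by
  rw [tripleWeight, if_neg (Finset.not_disjoint_iff.2 ⟨a, hat, ha⟩), if_neg fun h => hcK (h hct)]
  exact Finset.single_le_sum (fun j _ => hs j) (Finset.mem_sdiff.2 ⟨hct, hcK⟩)

/-- One commutator estimate for each size of K. With one or two particles in K, any particle of t
outside of K absorbs the derivative of v, and its symbol is one summand of `tripleWeight`. With no
particle the form is nonnegative. -/
theorem RegularInteraction.re_weightInner_ge_of_subset {lam : ℝ} {v : Config d N → ℝ}
    {t : Finset (Fin N)} (hv : RegularInteraction lam v t) (ht : t.card = 3) {K : Finset (Fin N)}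
    (hK : K ⊆ t) (f : 𝓢(Config d N, ℂ)) :
    -(8 * (d + 1) ^ 3 * lam * weightSq (fun ξ => (∏ j ∈ K, sobSymbol j ξ) *
        tripleWeight (fun j => sobSymbol j ξ) K t) f) ≤
      (weightInner (fun ξ => ∏ j ∈ K, sobSymbol j ξ) f (mulSchwartz v f)).re := by
  have hS := hasTemperateGrowth_sobSymbol (d := d) (N := N)
  have hp : ∀ (ξ : Config d N) j, 0 ≤ sobSymbol j ξ := fun ξ j => (sobSymbol_pos j ξ).le
  have hlam := hv.lam_nonneg
  set W := weightSq (fun ξ => (∏ j ∈ K, sobSymbol j ξ) *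
        tripleWeight (fun j => sobSymbol j ξ) K t) f with hW
  have hg := (hasTemperateGrowth_prod_sobSymbol (d := d) K).mul
    (hasTemperateGrowth_tripleWeight (d := d) K t)
  have hW0 : 0 ≤ W := weightSq_nonneg (fun ξ => mul_nonneg
    (Finset.prod_nonneg fun j _ => hp ξ j) (tripleWeight_nonneg (hp ξ) K t)) f
  have hd : (0 : ℝ) ≤ d := Nat.cast_nonneg d
  have hcard : K.card ≤ 3 := ht ▸ Finset.card_le_card hK
  -- The constants d+1 and 3(d+1)² of the smaller cases are dominated by 8(d+1)³.
  have conclude : ∀ {n : ℝ} {w : Config d N → ℝ}, Function.HasTemperateGrowth w →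
      (∀ ξ, w ξ ≤ (∏ j ∈ K, sobSymbol j ξ) * tripleWeight (fun j => sobSymbol j ξ) K t) →
      n ≤ 8 * (d + 1) ^ 3 → 0 ≤ n →
      -(8 * (d + 1) ^ 3 * lam * W) ≤ -(n * lam * weightSq w f) := by
    intro n w hw hle hn hn0
    have h := weightSq_mono hw hg hle f
    rw [neg_le_neg_iff]
    calc n * lam * weightSq w f ≤ n * lam * W :=
          mul_le_mul_of_nonneg_left h (mul_nonneg hn0 hlam)
      _ ≤ _ := by gcongr
  obtain h0 | h1 | h2 | h3 : K.card = 0 ∨ K.card = 1 ∨ K.card = 2 ∨ K.card = 3 := by omega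
  · have h := re_schwartzInner_mulSchwartz_nonneg hv.growth hv.nonneg f
    rw [Finset.card_eq_zero.1 h0]
    simp only [Finset.prod_empty, weightInner_one]
    exact le_trans (neg_nonpos.2 (by positivity)) h
  · obtain ⟨a, rfl⟩ := Finset.card_eq_one.1 h1
    have hat : a ∈ t := hK (Finset.mem_singleton_self a)
    obtain ⟨b, hbt, hba⟩ : ∃ b ∈ t, b ∉ ({a} : Finset (Fin N)) :=
      Finset.exists_mem_notMem_of_card_lt_card (by rw [h1, ht]; norm_num)
    have hab : a ≠ b := fun h => hba (by simp [h])
    have h := re_weightInner_mulSchwartz_one hv.growth hv.nonneg hlam a b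
      (hv.first a hat b hbt hab) f
    simp only [Finset.prod_singleton, mul_one] at h conclude ⊢
    refine le_trans ?_ h
    refine conclude (w := fun ξ => sobSymbol a ξ * sobSymbol b ξ) ((hS a).mul (hS b)) (fun ξ => ?_) ?_ (by positivity)
    · exact mul_le_mul_of_nonneg_left
        (le_tripleWeight (hp ξ) (Finset.mem_singleton_self a) hat hbt hba) (hp ξ a)
    · nlinarith [sq_nonneg (d + 1 : ℝ), pow_nonneg (by linarith : (0 : ℝ) ≤ d) 3, sq_nonneg (d : ℝ)]
  · obtain ⟨a, b, hab, rfl⟩ := Finset.card_eq_two.1 h2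
    have hat : a ∈ t := hK (by simp)
    have hbt : b ∈ t := hK (by simp)
    obtain ⟨c, hct, hc⟩ : ∃ c ∈ t, c ∉ ({a, b} : Finset (Fin N)) :=
      Finset.exists_mem_notMem_of_card_lt_card (by rw [h2, ht]; norm_num)
    have hac : a ≠ c := fun h => hc (by simp [h])
    have hbc : b ≠ c := fun h => hc (by simp [h])
    have h := re_weightInner_mulSchwartz_two hv.growth hv.nonneg hlam a b c
      (hv.first a hat c hct hac) (hv.first b hbt c hct hbc) (hv.second a hat b hbt hab) f
    simp only [Finset.prod_pair hab, mul_one] at h conclude ⊢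
    refine le_trans ?_ h
    refine conclude (w := fun ξ => sobSymbol a ξ * (sobSymbol b ξ * sobSymbol c ξ))
      ((hS a).mul ((hS b).mul (hS c))) (fun ξ => ?_) ?_ (by positivity)
    · rw [← mul_assoc]
      exact mul_le_mul_of_nonneg_left
        (le_tripleWeight (hp ξ) (Finset.mem_insert_self a _) hat hct hc)
        (mul_nonneg (hp ξ a) (hp ξ b))
    · nlinarith [sq_nonneg (d + 1 : ℝ), pow_nonneg (by linarith : (0 : ℝ) ≤ d) 3, sq_nonneg (d : ℝ)]
  · obtain rfl : K = t := Finset.eq_of_subset_of_card_le hK (by omega)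
    obtain ⟨a, b, c, hab, hac, hbc, rfl⟩ := Finset.card_eq_three.1 h3
    have hat : a ∈ ({a, b, c} : Finset (Fin N)) := by simp
    have hbt : b ∈ ({a, b, c} : Finset (Fin N)) := by simp
    have hct : c ∈ ({a, b, c} : Finset (Fin N)) := by simp
    have h := re_weightInner_mulSchwartz_three hv.growth hv.nonneg hlam a b c
      (hv.first a hat b hbt hab) (hv.first b hbt c hct hbc) (hv.first c hct a hat hac.symm)
      (hv.second a hat b hbt hab) (hv.second a hat c hct hac) (hv.second b hbt c hct hbc) f
    have e : ∀ ξ : Config d N, ∏ j ∈ ({a, b, c} : Finset (Fin N)), sobSymbol j ξ =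
        sobSymbol a ξ * (sobSymbol b ξ * sobSymbol c ξ) := fun ξ => by
      rw [Finset.prod_insert (by simp [hab, hac]), Finset.prod_pair hbc]
    have e' : ∀ ξ : Config d N, tripleWeight (fun j => sobSymbol j ξ) {a, b, c} {a, b, c} =
        sobSymbol a ξ + sobSymbol b ξ + sobSymbol c ξ := fun ξ => by
      rw [tripleWeight, if_neg (Finset.not_disjoint_iff.2 ⟨a, hat, hat⟩),
        if_pos (Finset.Subset.refl _), Finset.sum_insert (by simp [hab, hac]),
        Finset.sum_pair hbc, add_assoc]
    simp only [e, e', mul_one] at h hW ⊢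
    rwa [hW]

/-- Derivatives in the spectators J \ t commute with v. Removing them one at a time reduces to J ∩
t, applied to the differentiated functions. -/
theorem RegularInteraction.re_weightInner_ge {lam : ℝ} {v : Config d N → ℝ}
    {t : Finset (Fin N)} (hv : RegularInteraction lam v t) (ht : t.card = 3) (J : Finset (Fin N))
    (f : 𝓢(Config d N, ℂ)) :
    -(8 * (d + 1) ^ 3 * lam * weightSq (fun ξ => (∏ j ∈ J, sobSymbol j ξ) *
        tripleWeight (fun j => sobSymbol j ξ) J t) f) ≤
      (weightInner (fun ξ => ∏ j ∈ J, sobSymbol j ξ) f (mulSchwartz v f)).re := by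
  have hS := hasTemperateGrowth_sobSymbol (d := d) (N := N)
  have key : ∀ R : Finset (Fin N), Disjoint R t → ∀ f : 𝓢(Config d N, ℂ),
      -(8 * (d + 1) ^ 3 * lam * weightSq (fun ξ => (∏ j ∈ R, sobSymbol j ξ) *
        ((∏ j ∈ J ∩ t, sobSymbol j ξ) * tripleWeight (fun j => sobSymbol j ξ) (J ∩ t) t)) f) ≤
      (weightInner (fun ξ => (∏ j ∈ R, sobSymbol j ξ) * ∏ j ∈ J ∩ t, sobSymbol j ξ) f
        (mulSchwartz v f)).re := by
    intro R
    induction R using Finset.induction_on with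
    | empty =>
      intro _ f
      simp only [Finset.prod_empty, one_mul]
      exact hv.re_weightInner_ge_of_subset ht Finset.inter_subset_right f
    | insert m R hm ih =>
      intro hR f
      rw [Finset.disjoint_insert_left] at hR
      simp only [Finset.prod_insert hm, mul_assoc (sobSymbol m _)]
      have hg := hasTemperateGrowth_prod_sobSymbol (d := d) R
      have hg' := hasTemperateGrowth_prod_sobSymbol (d := d) (J ∩ t)
      have hg'' := hasTemperateGrowth_tripleWeight (d := d) (J ∩ t) t
      rw [weightInner_sobSymbol_mul m
          (w := fun ξ => (∏ j ∈ R, sobSymbol j ξ) * ∏ j ∈ J ∩ t, sobSymbol j ξ) (hg.mul hg'),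
        weightSq_sobSymbol_mul m (w := fun ξ => (∏ j ∈ R, sobSymbol j ξ) *
          ((∏ j ∈ J ∩ t, sobSymbol j ξ) * tripleWeight (fun j => sobSymbol j ξ) (J ∩ t) t))
          (hg.mul (hg'.mul hg'')), Complex.re_sum, Finset.mul_sum,
        ← Finset.sum_neg_distrib]
      refine Finset.sum_le_sum fun o _ => ?_
      have e : partialOp m o (mulSchwartz v f) = mulSchwartz v (partialOp m o f) := by
        rw [partialOp_mulSchwartz m o hv.growth, hv.indep m hR.1 o, add_eq_left]
        ext x
        rw [mulSchwartz_apply (Function.HasTemperateGrowth.const 0)]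
        simp
      rw [e]
      exact ih hR.2 _
  have h := key (J \ t) Finset.sdiff_disjoint f
  have e : ∀ ξ : Config d N, (∏ j ∈ J \ t, sobSymbol j ξ) * ∏ j ∈ J ∩ t, sobSymbol j ξ =
      ∏ j ∈ J, sobSymbol j ξ := fun ξ => by
    rw [mul_comm, Finset.prod_inter_mul_prod_sdiff]
  simpa only [← mul_assoc, e, tripleWeight_inter] using h

end ThreeBodyBose

end

noncomputable section

set_option linter.unusedSectionVars false
namespace ThreeBodyBose

/-! ### Mollification -/

section Mollification

open scoped Convolution
open ContinuousLinearMap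

variable {Y : Type} [NormedAddCommGroup Y] [NormedSpace ℝ Y] [FiniteDimensional ℝ Y]
  [MeasureSpace Y] [BorelSpace Y] [(volume : Measure Y).IsAddHaarMeasure]

/-- A smooth compactly supported probability density. -/
structure IsMollifier (ρ : Y → ℝ) : Prop where
  smooth : ContDiff ℝ ∞ ρ
  compact : HasCompactSupport ρ
  nonneg : ∀ x, 0 ≤ ρ x
  integral_eq : ∫ x, ρ x = 1

/-- The convolution `ρ ∗ f`. -/
def mollify (ρ f : Y → ℝ) (x : Y) : ℝ := ∫ t, ρ t * f (x - t)

variable {ρ : Y → ℝ}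

theorem IsMollifier.integrable (hρ : IsMollifier ρ) : Integrable ρ :=
  hρ.smooth.continuous.integrable_of_hasCompactSupport hρ.compact

theorem mollify_eq_convolution (ρ f : Y → ℝ) :
    mollify ρ f = (ρ ⋆[lsmul ℝ ℝ, volume] f) := rfl

theorem sub_left_quasiMeasurePreserving (x : Y) :
    Measure.QuasiMeasurePreserving (fun t : Y => x - t) volume volume :=
  quasiMeasurePreserving_sub_left volume x

theorem mollify_congr {f g : Y → ℝ} (h : f =ᵐ[volume] g) (x : Y) :
    mollify ρ f x = mollify ρ g x := by
  refine integral_congr_ae ?_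
  filter_upwards [(sub_left_quasiMeasurePreserving x).ae h] with t ht
  rw [ht]

theorem IsMollifier.contDiff_mollify (hρ : IsMollifier ρ) {f : Y → ℝ}
    (hf : LocallyIntegrable f volume) : ContDiff ℝ ∞ (mollify ρ f) := by
  rw [mollify_eq_convolution]
  exact hρ.compact.contDiff_convolution_left (n := ⊤) _ hρ.smooth hf

/-- The classical derivative of the convolution falls on ρ; the weak derivative is then tested with
y ↦ ρ (x - y). -/
theorem IsMollifier.fderiv_mollify (hρ : IsMollifier ρ) {f g : Y → ℝ} {v : Y}
    (h : HasWeakDeriv f g v) (x : Y) : fderiv ℝ (mollify ρ f) x v = mollify ρ g x := by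
  obtain ⟨hf, hg, hfg⟩ := h
  have hρ1 : ContDiff ℝ 1 ρ := hρ.smooth.of_le (by simp)
  rw [mollify_eq_convolution,
    (hρ.compact.hasFDerivAt_convolution_left (lsmul ℝ ℝ) hρ1 hf x).fderiv]
  have hc : ConvolutionExistsAt (fderiv ℝ ρ) f x ((lsmul ℝ ℝ).precompL Y) volume :=
    (hρ.compact.fderiv ℝ).convolutionExists_left _ (hρ1.continuous_fderiv (by simp)) hf x
  rw [convolution_def, ContinuousLinearMap.integral_apply hc]
  have h1 := hfg (fun y => ρ (x - y)) (hρ.smooth.comp (contDiff_const.sub contDiff_id))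
    (hρ.compact.comp_homeomorph (Homeomorph.subLeft x))
  have h2 : ∀ y, fderiv ℝ (fun y => ρ (x - y)) y v = - fderiv ℝ ρ (x - y) v := fun y => by
    have := (hρ1.differentiable (by simp) (x - y)).hasFDerivAt.comp y
      ((hasFDerivAt_id y).const_sub x)
    have e : fderiv ℝ (fun y => ρ (x - y)) y = _ := this.fderiv
    rw [e]
    simp
  simp only [h2, mul_neg, integral_neg, neg_inj] at h1
  calc _ = ∫ t, fderiv ℝ ρ t v * f (x - t) := by
        refine integral_congr_ae (ae_of_all _ fun t => ?_)
        simp [precompL_apply]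
    _ = ∫ y, f y * fderiv ℝ ρ (x - y) v := by
        rw [← integral_sub_left_eq_self (fun t => fderiv ℝ ρ t v * f (x - t)) volume x]
        refine integral_congr_ae (ae_of_all _ fun t => ?_)
        simp [mul_comm]
    _ = ∫ y, g y * ρ (x - y) := h1
    _ = _ := by
        rw [mollify, ← integral_sub_left_eq_self (fun t => ρ t * g (x - t)) volume x]
        refine integral_congr_ae (ae_of_all _ fun t => ?_)
        simp [mul_comm]

theorem IsMollifier.mollify_nonneg (hρ : IsMollifier ρ) {f : Y → ℝ} (hf : ∀ᵐ x, 0 ≤ f x)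
    (x : Y) : 0 ≤ mollify ρ f x := by
  refine integral_nonneg_of_ae ?_
  filter_upwards [(sub_left_quasiMeasurePreserving x).ae hf] with t ht
  exact mul_nonneg (hρ.nonneg t) ht

theorem IsMollifier.abs_mollify_le (hρ : IsMollifier ρ) {f : Y → ℝ} {M : ℝ}
    (hf : ∀ᵐ x, |f x| ≤ M) (x : Y) : |mollify ρ f x| ≤ M := by
  have h : ‖mollify ρ f x‖ ≤ ∫ t, ρ t * M := by
    refine norm_integral_le_of_norm_le (hρ.integrable.mul_const M) ?_
    filter_upwards [(sub_left_quasiMeasurePreserving x).ae hf] with t ht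
    rw [norm_mul, Real.norm_of_nonneg (hρ.nonneg t)]
    exact mul_le_mul_of_nonneg_left ht (hρ.nonneg t)
  rwa [integral_mul_const, hρ.integral_eq, one_mul] at h

/-- For finite p, `mollify ρ f x` is an average over the probability measure ρ dt. Its p-th power is
at most the average of |f|^p, and Tonelli with translation invariance concludes. -/
theorem IsMollifier.eLpNorm_mollify_le (hρ : IsMollifier ρ) {f : Y → ℝ} {p : ℝ≥0∞}
    (hp : 1 ≤ p) (hf : AEStronglyMeasurable f volume) :
    eLpNorm (mollify ρ f) p volume ≤ eLpNorm f p volume := by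
  rcases eq_or_ne p (⊤ : ℝ≥0∞) with rfl | hptop
  · by_cases hfin : eLpNorm f ⊤ volume = ⊤
    · rw [hfin]; exact le_top
    have h : ∀ᵐ x, |f x| ≤ (eLpNorm f ⊤ volume).toReal := by
      rw [eLpNorm_exponent_top] at hfin ⊢
      filter_upwards [ae_le_eLpNormEssSup (f := f) (μ := volume)] with x hx
      rw [← Real.norm_eq_abs, ← toReal_enorm]
      exact ENNReal.toReal_mono hfin hx
    rw [eLpNorm_exponent_top]
    rw [eLpNorm_exponent_top] at hfin h
    refine eLpNormEssSup_le_of_ae_enorm_bound (ae_of_all _ fun x => ?_)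
    rw [eLpNorm_exponent_top, ← ENNReal.ofReal_toReal hfin, ← ofReal_norm]
    exact ENNReal.ofReal_le_ofReal (hρ.abs_mollify_le h x)
  obtain ⟨g, hg, hfg⟩ := hf
  rw [funext (mollify_congr hfg), eLpNorm_congr_ae hfg]
  have hp0 : p ≠ 0 := (zero_lt_one.trans_le hp).ne'
  have hpr : 0 < p.toReal := ENNReal.toReal_pos hp0 hptop
  set ν : Measure Y := volume.withDensity fun t => ENNReal.ofReal (ρ t) with hν
  have hρm : Measurable fun t => ENNReal.ofReal (ρ t) :=
    hρ.smooth.continuous.measurable.ennreal_ofReal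
  have : IsProbabilityMeasure ν := ⟨by
    rw [hν, withDensity_apply _ MeasurableSet.univ, Measure.restrict_univ,
      ← ofReal_integral_eq_lintegral_ofReal hρ.integrable (ae_of_all _ hρ.nonneg),
      hρ.integral_eq, ENNReal.ofReal_one]⟩
  have hmeas : ∀ x, Measurable fun t => g (x - t) := fun x =>
    hg.measurable.comp (measurable_const.sub measurable_id)
  have key : ∀ x, ‖mollify ρ g x‖ₑ ^ p.toReal ≤ ∫⁻ t, ‖g (x - t)‖ₑ ^ p.toReal ∂ν := by
    intro x
    have h1 : ‖mollify ρ g x‖ₑ ≤ eLpNorm (fun t => g (x - t)) 1 ν := by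
      refine (enorm_integral_le_lintegral_enorm _).trans (le_of_eq ?_)
      rw [eLpNorm_one_eq_lintegral_enorm, hν, lintegral_withDensity_eq_lintegral_mul _ hρm
        (hmeas x).enorm]
      refine lintegral_congr fun t => ?_
      rw [enorm_mul, Real.enorm_of_nonneg (hρ.nonneg t)]
      rfl
    have h2 := h1.trans (eLpNorm_le_eLpNorm_of_exponent_le hp
      (hmeas x).aestronglyMeasurable)
    rw [eLpNorm_eq_lintegral_rpow_enorm_toReal hp0 hptop, one_div] at h2
    calc _ ≤ ((∫⁻ t, ‖g (x - t)‖ₑ ^ p.toReal ∂ν) ^ p.toReal⁻¹) ^ p.toReal :=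
          ENNReal.rpow_le_rpow h2 hpr.le
      _ = _ := ENNReal.rpow_inv_rpow hpr.ne' _
  rw [eLpNorm_eq_lintegral_rpow_enorm_toReal hp0 hptop,
    eLpNorm_eq_lintegral_rpow_enorm_toReal hp0 hptop]
  refine ENNReal.rpow_le_rpow ?_ (by positivity)
  calc _ ≤ ∫⁻ x, ∫⁻ t, ‖g (x - t)‖ₑ ^ p.toReal ∂ν := lintegral_mono key
    _ = ∫⁻ t, (∫⁻ x, ‖g (x - t)‖ₑ ^ p.toReal) ∂ν := by
        refine lintegral_lintegral_swap (Measurable.aemeasurable ?_)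
        exact (hg.measurable.comp (measurable_fst.sub measurable_snd)).enorm.pow_const _
    _ = ∫⁻ _t, (∫⁻ x, ‖g x‖ₑ ^ p.toReal) ∂ν := by
        refine lintegral_congr fun t => ?_
        exact lintegral_sub_right_eq_self (fun x => ‖g x‖ₑ ^ p.toReal) t
    _ = _ := by rw [lintegral_const, measure_univ, mul_one]

/-- All derivatives can be put on the kernel, which stays smooth with compact support. The target
space E is general because the derivative of the kernel is vector-valued in the induction. -/
theorem exists_norm_iteratedFDeriv_convolution_le {f : Y → ℝ} {M : ℝ}
    (hfl : LocallyIntegrable f volume) (hf : ∀ᵐ x, |f x| ≤ M) (n : ℕ) :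
    ∀ {E : Type} [NormedAddCommGroup E] [NormedSpace ℝ E] [CompleteSpace E] (φ : Y → E),
      ContDiff ℝ ∞ φ → HasCompactSupport φ →
      ∃ C, ∀ x, ‖iteratedFDeriv ℝ n (φ ⋆[(lsmul ℝ ℝ : ℝ →L[ℝ] E →L[ℝ] E).flip, volume] f) x‖ ≤ C := by
  induction n with
  | zero =>
    intro E _ _ _ φ hφ hc
    refine ⟨∫ t, ‖φ t‖ * M, fun x => ?_⟩
    rw [norm_iteratedFDeriv_zero, convolution_def]
    refine norm_integral_le_of_norm_le
      ((hφ.continuous.integrable_of_hasCompactSupport hc).norm.mul_const M) ?_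
    filter_upwards [(sub_left_quasiMeasurePreserving x).ae hf] with t ht
    rw [flip_apply, lsmul_apply, norm_smul, mul_comm]
    exact mul_le_mul_of_nonneg_left ht (norm_nonneg _)
  | succ n ih =>
    intro E _ _ _ φ hφ hc
    obtain ⟨C, hC⟩ := ih (fderiv ℝ φ) (hφ.fderiv_right (by simp)) (hc.fderiv ℝ)
    refine ⟨C, fun x => ?_⟩
    rw [← norm_iteratedFDeriv_fderiv]
    convert hC x using 3
    funext y
    have h := (hc.hasFDerivAt_convolution_left ((lsmul ℝ ℝ : ℝ →L[ℝ] E →L[ℝ] E).flip)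
      (hφ.of_le (by simp)) hfl y).fderiv
    rw [h]
    rfl

theorem IsMollifier.hasTemperateGrowth_mollify (hρ : IsMollifier ρ) {f : Y → ℝ} {M : ℝ}
    (hfl : LocallyIntegrable f volume) (hf : ∀ᵐ x, |f x| ≤ M) :
    Function.HasTemperateGrowth (mollify ρ f) := by
  refine ⟨hρ.contDiff_mollify hfl, fun n => ?_⟩
  obtain ⟨C, hC⟩ := exists_norm_iteratedFDeriv_convolution_le hfl hf n ρ hρ.smooth hρ.compact
  -- All derivatives are bounded, so the growth exponent is 0.
  refine ⟨0, C, fun x => ?_⟩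
  rw [pow_zero, mul_one]
  convert hC x using 3
  funext y
  rw [mollify, convolution_def]
  exact integral_congr_ae (ae_of_all _ fun t => by simp [mul_comm])

variable (Y) in
/-- A sequence of mollifiers that is an approximate identity almost everywhere. -/
theorem exists_isMollifier_seq : ∃ ρ : ℕ → Y → ℝ, (∀ n, IsMollifier (ρ n)) ∧
    ∀ f : Y → ℝ, LocallyIntegrable f volume → ∀ᵐ x,
      Filter.Tendsto (fun n => mollify (ρ n) f x) Filter.atTop (nhds (f x)) := by
  let b : ℕ → ContDiffBump (0 : Y) := fun n =>
    ⟨1 / (n + 1), 2 / (n + 1), by positivity, by gcongr; norm_num⟩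
  refine ⟨fun n => (b n).normed volume, fun n => ⟨(b n).contDiff_normed,
    (b n).hasCompactSupport_normed, (b n).nonneg_normed, (b n).integral_normed⟩, fun f hf => ?_⟩
  have h0 : Filter.Tendsto (fun n => (b n).rOut) Filter.atTop (nhds 0) := by
    have := (tendsto_one_div_add_atTop_nhds_zero_nat (𝕜 := ℝ)).const_mul 2
    simpa [b, div_eq_mul_inv] using this
  have h := ContDiffBump.ae_convolution_tendsto_right_of_locallyIntegrable (μ := volume)
    (K := 2) h0 (Filter.Eventually.of_forall fun n => le_of_eq (by simp [b]; ring)) hf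
  exact h

end Mollification

end ThreeBodyBose

end

noncomputable section

namespace ThreeBodyBose

/-! ### The Sobolev embedding `W^{2,p} ⊂ L^∞` for `p ≥ dim` -/

section Embedding

variable {Y : Type} [NormedAddCommGroup Y] [NormedSpace ℝ Y] [FiniteDimensional ℝ Y]
  [MeasureSpace Y] [BorelSpace Y] [(volume : Measure Y).IsAddHaarMeasure]

/-- The directional derivative of `f` in the direction `v`. -/
def dirDeriv (v : Y) (f : Y → ℝ) (x : Y) : ℝ := fderiv ℝ f x v

omit [FiniteDimensional ℝ Y] [MeasureSpace Y] [BorelSpace Y]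
  [(volume : Measure Y).IsAddHaarMeasure] in
theorem contDiff_dirDeriv {f : Y → ℝ} (hf : ContDiff ℝ ∞ f) (v : Y) :
    ContDiff ℝ ∞ (dirDeriv v f) :=
  (hf.fderiv_right (by simp)).clm_apply contDiff_const

omit [FiniteDimensional ℝ Y] [MeasureSpace Y] [BorelSpace Y]
  [(volume : Measure Y).IsAddHaarMeasure] in
-- The integrand is the derivative of t ↦ t ∂_y f(x + t y) - f(x + t y). Expanding from the far end
-- x + y puts the weight t on the second derivative, where it will compensate the scaling of the L^p
-- norm.
theorem taylor_two_ray {f : Y → ℝ} (hf : ContDiff ℝ ∞ f) (x y : Y) :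
    f x = f (x + y) - dirDeriv y f (x + y) +
      ∫ t in (0 : ℝ)..1, t * dirDeriv y (dirDeriv y f) (x + t • y) := by
  have hline : ∀ t : ℝ, HasDerivAt (fun t : ℝ => x + t • y) y t := fun t => by
    simpa using ((hasDerivAt_id t).smul_const y).const_add x
  have h1 : ∀ {g : Y → ℝ}, ContDiff ℝ ∞ g → ∀ t : ℝ,
      HasDerivAt (fun t : ℝ => g (x + t • y)) (dirDeriv y g (x + t • y)) t := fun hg t =>
    ((hg.differentiable (by simp) _).hasFDerivAt).comp_hasDerivAt t (hline t)
  have h2 := contDiff_dirDeriv hf y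
  have hk : ∀ t : ℝ, HasDerivAt (fun t : ℝ => t * dirDeriv y f (x + t • y) - f (x + t • y))
      (t * dirDeriv y (dirDeriv y f) (x + t • y)) t := fun t => by
    have := ((hasDerivAt_id t).mul (h1 h2 t)).sub (h1 hf t)
    convert! this using 1
    simp
  have hcont : Continuous fun t : ℝ => t * dirDeriv y (dirDeriv y f) (x + t • y) := by
    have := (contDiff_dirDeriv h2 y).continuous
    fun_prop
  rw [intervalIntegral.integral_eq_sub_of_hasDerivAt (fun t _ => hk t)
    (hcont.intervalIntegrable 0 1)]
  simp only [one_smul, one_mul, zero_smul, add_zero, zero_mul, zero_sub]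
  ring

/-- Scaling produces t^(-n/p) with n the dimension; since t ≤ 1 and n ≤ p this is at most t^(-1). -/
theorem eLpNorm_comp_add_smul_le {g : Y → ℝ} (hg : Continuous g) {p : ℝ≥0∞}
    (hp : (Module.finrank ℝ Y : ℝ≥0∞) ≤ p) (hp0 : p ≠ 0) (x : Y) {t : ℝ} (ht0 : 0 < t)
    (ht1 : t ≤ 1) :
    eLpNorm (fun y => g (x + t • y)) p volume ≤
      (ENNReal.ofReal t)⁻¹ * eLpNorm g p volume := by
  have e1 : eLpNorm (fun y => g (x + t • y)) p volume =
      eLpNorm (fun z => g (x + z)) p (Measure.map (fun y : Y => t • y) volume) := by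
    rw [eLpNorm_map_measure (by fun_prop) (by fun_prop)]
    rfl
  have e2 : eLpNorm (fun z => g (x + z)) p volume = eLpNorm g p volume :=
    eLpNorm_comp_measurePreserving (g := g) hg.aestronglyMeasurable
      (measurePreserving_add_left volume x)
  have hpos : (0 : ℝ) < t ^ Module.finrank ℝ Y := by positivity
  rw [e1, Measure.map_addHaar_smul volume ht0.ne', eLpNorm_smul_measure_of_ne_zero
    (ENNReal.ofReal_pos.2 (by positivity)).ne', e2, smul_eq_mul]
  gcongr
  rw [abs_of_pos (by positivity), ENNReal.ofReal_inv_of_pos hpos, ENNReal.ofReal_pow ht0.le,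
    ENNReal.inv_pow, ← ENNReal.rpow_natCast, ← ENNReal.rpow_mul]
  have h1 : 1 ≤ (ENNReal.ofReal t)⁻¹ := by
    rw [ENNReal.one_le_inv]; exact ENNReal.ofReal_le_one.2 ht1
  conv_rhs => rw [← ENNReal.rpow_one (ENNReal.ofReal t)⁻¹]
  refine ENNReal.rpow_le_rpow_of_exponent_le h1 ?_
  rcases eq_or_ne p ⊤ with rfl | hpt
  · simp
  · rw [one_div, ENNReal.toReal_inv, ← div_eq_mul_inv, div_le_one (ENNReal.toReal_pos hp0 hpt)]
    simpa using ENNReal.toReal_mono hpt hp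

/-- Hölder's inequality on the unit ball, followed by the scaling bound. -/
theorem lintegral_closedBall_comp_le {g : Y → ℝ} (hg : Continuous g) {p : ℝ≥0∞}
    (hp : (Module.finrank ℝ Y : ℝ≥0∞) ≤ p) (hp1 : 1 ≤ p) (x : Y) {t : ℝ} (ht0 : 0 < t)
    (ht1 : t ≤ 1) :
    ∫⁻ y in Metric.closedBall (0 : Y) 1, ‖g (x + t • y)‖ₑ ≤
      (volume (Metric.closedBall (0 : Y) 1)) ^ (1 - 1 / p.toReal) *
        ((ENNReal.ofReal t)⁻¹ * eLpNorm g p volume) := by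
  set B := Metric.closedBall (0 : Y) 1
  have h := eLpNorm_le_eLpNorm_mul_rpow_measure_univ (μ := volume.restrict B) hp1
    (f := fun y => g (x + t • y)) (by fun_prop)
  rw [eLpNorm_one_eq_lintegral_enorm, Measure.restrict_apply_univ] at h
  refine h.trans ?_
  rw [mul_comm, ENNReal.toReal_one, div_one]
  gcongr
  exact (eLpNorm_mono_measure _ Measure.restrict_le_self).trans
    (eLpNorm_comp_add_smul_le hg hp (zero_lt_one.trans_le hp1).ne' x ht0 ht1)

/-- The Sobolev embedding `W^{2,p} ⊂ L^∞` for smooth functions. -/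
theorem exists_sup_le_of_eLpNorm_le {ι : Type} [Fintype ι] (b : Module.Basis ι ℝ Y) {p : ℝ≥0∞}
    (hp : (Module.finrank ℝ Y : ℝ≥0∞) ≤ p) (hp1 : 1 ≤ p) {K : ℝ≥0∞} (hK : K ≠ ⊤) :
    ∃ C : ℝ, ∀ f : Y → ℝ, ContDiff ℝ ∞ f → eLpNorm f p volume ≤ K →
      (∀ i, eLpNorm (dirDeriv (b i) f) p volume ≤ K) →
      (∀ i j, eLpNorm (dirDeriv (b j) (dirDeriv (b i) f)) p volume ≤ K) → ∀ x, |f x| ≤ C := by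
  set B := Metric.closedBall (0 : Y) 1 with hB
  have hBm : MeasurableSet B := measurableSet_closedBall
  have hB0 : volume B ≠ 0 := (Metric.measure_closedBall_pos volume 0 one_pos).ne'
  have hBt : volume B ≠ ⊤ := (isCompact_closedBall (0 : Y) 1).measure_lt_top.ne
  obtain ⟨M, hM0, hM⟩ : ∃ M : ℝ, 0 ≤ M ∧ ∀ y ∈ B, ∀ i, |b.repr y i| ≤ M := by
    refine ⟨‖(b.equivFunL : Y →L[ℝ] ι → ℝ)‖, norm_nonneg _, fun y hy i => ?_⟩
    have h1 : ‖b.equivFunL y‖ ≤ ‖(b.equivFunL : Y →L[ℝ] ι → ℝ)‖ * ‖y‖ :=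
      (b.equivFunL : Y →L[ℝ] ι → ℝ).le_opNorm y
    have h2 : ‖y‖ ≤ 1 := by simpa [hB] using hy
    have h3 := norm_le_pi_norm (b.equivFunL y) i
    exact h3.trans (h1.trans (mul_le_of_le_one_right (norm_nonneg _) h2))
  set m : ℝ≥0∞ := ENNReal.ofReal M with hm
  set A : ℝ≥0∞ := (volume B) ^ (1 - 1 / p.toReal) with hA
  set n : ℝ≥0∞ := (Fintype.card ι : ℝ≥0∞) with hn
  -- The contributions of f, of its first and of its second derivatives to the average of the Taylor
  -- formula over the ball; m bounds the coordinates of unit vectors.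
  set D : ℝ≥0∞ := A * K + n * (m * (A * K)) + n * (n * (m * m * (A * K))) with hD
  have hAt : A ≠ ⊤ := ENNReal.rpow_ne_top_of_ne_zero hB0 hBt
  have hDt : D ≠ ⊤ := by
    have hmt : m ≠ ⊤ := ENNReal.ofReal_ne_top
    have hnt : n ≠ ⊤ := ENNReal.natCast_ne_top _
    simp only [hD, ENNReal.add_ne_top]
    have hAK := ENNReal.mul_ne_top hAt hK
    exact ⟨⟨hAK, ENNReal.mul_ne_top hnt (ENNReal.mul_ne_top hmt hAK)⟩, ENNReal.mul_ne_top hnt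
      (ENNReal.mul_ne_top hnt (ENNReal.mul_ne_top (ENNReal.mul_ne_top hmt hmt) hAK))⟩
  refine ⟨(D / volume B).toReal, fun f hf h0 h1 h2 x => ?_⟩
  -- expansion of directional derivatives in the basis
  have hdir : ∀ {g : Y → ℝ} (y z : Y), dirDeriv y g z = ∑ i, b.repr y i * dirDeriv (b i) g z := by
    intro g y z
    have h := congrArg (fderiv ℝ g z) (b.sum_repr y)
    simp only [map_sum, map_smul, smul_eq_mul] at h
    exact h.symm
  have hc : ∀ {g : Y → ℝ}, ContDiff ℝ ∞ g → Continuous g := fun hg => hg.continuous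
  have habs : ∀ y ∈ B, ∀ i, ‖b.repr y i‖ₑ ≤ m := fun y hy i => by
    rw [Real.enorm_eq_ofReal_abs]; exact ENNReal.ofReal_le_ofReal (hM y hy i)
  have d1 : ∀ y ∈ B, ∀ z, ‖dirDeriv y f z‖ₑ ≤ ∑ i, m * ‖dirDeriv (b i) f z‖ₑ := by
    intro y hy z
    rw [hdir]
    refine (enorm_sum_le _ _).trans (Finset.sum_le_sum fun i _ => ?_)
    rw [enorm_mul]
    gcongr
    exact habs y hy i
  have d2 : ∀ y ∈ B, ∀ z, ‖dirDeriv y (dirDeriv y f) z‖ₑ ≤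
      ∑ i, ∑ j, m * m * ‖dirDeriv (b j) (dirDeriv (b i) f) z‖ₑ := by
    intro y hy z
    have e : dirDeriv y (dirDeriv y f) z =
        ∑ i, b.repr y i * ∑ j, b.repr y j * dirDeriv (b j) (dirDeriv (b i) f) z := by
      have e1 : dirDeriv y f = fun w => ∑ i, b.repr y i * dirDeriv (b i) f w :=
        funext fun w => hdir y w
      have hd : ∀ i, DifferentiableAt ℝ (dirDeriv (b i) f) z := fun i =>
        (contDiff_dirDeriv hf (b i)).differentiable (by simp) z
      conv_lhs => rw [e1, dirDeriv]
      rw [fderiv_fun_sum fun i _ => (hd i).const_mul _, _root_.sum_apply]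
      refine Finset.sum_congr rfl fun i _ => ?_
      rw [fderiv_const_mul (hd i), ← hdir]
      rfl
    rw [e]
    refine (enorm_sum_le _ _).trans (Finset.sum_le_sum fun i _ => ?_)
    rw [Finset.mul_sum]
    refine (enorm_sum_le _ _).trans (Finset.sum_le_sum fun j _ => ?_)
    rw [← mul_assoc, enorm_mul, enorm_mul]
    gcongr
    exacts [habs y hy i, habs y hy j]
  set G2 : ι → ι → Y → ℝ := fun i j => dirDeriv (b j) (dirDeriv (b i) f) with hG2
  have hG2c : ∀ i j, Continuous (G2 i j) := fun i j =>
    (contDiff_dirDeriv (contDiff_dirDeriv hf (b i)) (b j)).continuous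
  have hG1c : ∀ i, Continuous (dirDeriv (b i) f) := fun i => (contDiff_dirDeriv hf (b i)).continuous
  have hfc := hf.continuous
  have point : ∀ y ∈ B, ‖f x‖ₑ ≤ ‖f (x + (1 : ℝ) • y)‖ₑ +
      ∑ i, m * ‖dirDeriv (b i) f (x + (1 : ℝ) • y)‖ₑ +
      ∑ i, ∑ j, m * m * ∫⁻ t in Set.Ioc (0 : ℝ) 1, ENNReal.ofReal t * ‖G2 i j (x + t • y)‖ₑ := by
    intro y hy
    rw [taylor_two_ray hf x y, one_smul]
    refine (enorm_add_le _ _).trans (add_le_add ((enorm_sub_le).trans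
      (add_le_add le_rfl (d1 y hy _))) ?_)
    rw [intervalIntegral.integral_of_le zero_le_one]
    refine (enorm_integral_le_lintegral_enorm _).trans ?_
    have hmeas : ∀ i j, Measurable fun t : ℝ => ENNReal.ofReal t * ‖G2 i j (x + t • y)‖ₑ :=
      fun i j => by
        have : Continuous fun t : ℝ => G2 i j (x + t • y) := by have := hG2c i j; fun_prop
        exact ENNReal.measurable_ofReal.mul this.measurable.enorm
    calc _ ≤ ∫⁻ t in Set.Ioc (0 : ℝ) 1, ∑ i, ∑ j, m * m *
            (ENNReal.ofReal t * ‖G2 i j (x + t • y)‖ₑ) := by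
          refine setLIntegral_mono (by
            exact Finset.measurable_sum _ fun i _ => Finset.measurable_sum _ fun j _ =>
              (hmeas i j).const_mul _) fun t ht => ?_
          rw [enorm_mul, Real.enorm_of_nonneg ht.1.le]
          refine (mul_le_mul_right (d2 y hy _) _).trans (le_of_eq ?_)
          simp only [Finset.mul_sum, hG2]
          exact Finset.sum_congr rfl fun i _ => Finset.sum_congr rfl fun j _ => by ring
      _ = _ := by
          rw [lintegral_finsetSum _ fun i _ => Finset.measurable_sum _ fun j _ =>
              (hmeas i j).const_mul _]
          refine Finset.sum_congr rfl fun i _ => ?_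
          rw [lintegral_finsetSum _ fun j _ => (hmeas i j).const_mul _]
          exact Finset.sum_congr rfl fun j _ => lintegral_const_mul _ (hmeas i j)
  -- The Taylor weight t cancels the scaling loss t^(-1). This is where p is required to be at least
  -- the dimension.
  have bound1 : ∀ {g : Y → ℝ}, Continuous g → eLpNorm g p volume ≤ K → ∀ t : ℝ, 0 < t → t ≤ 1 →
      ENNReal.ofReal t * ∫⁻ y in B, ‖g (x + t • y)‖ₑ ≤ A * K := by
    intro g hg hgK t ht0 ht1
    have ht : ENNReal.ofReal t ≠ 0 := by simpa using ht0
    calc _ ≤ ENNReal.ofReal t * (A * ((ENNReal.ofReal t)⁻¹ * K)) := by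
          gcongr
          refine (lintegral_closedBall_comp_le hg hp hp1 x ht0 ht1).trans ?_
          gcongr
      _ = (ENNReal.ofReal t * (ENNReal.ofReal t)⁻¹) * (A * K) := by ring
      _ = _ := by rw [ENNReal.mul_inv_cancel ht ENNReal.ofReal_ne_top, one_mul]
  have bound2 : ∀ i j, ∫⁻ y in B, ∫⁻ t in Set.Ioc (0 : ℝ) 1,
      ENNReal.ofReal t * ‖G2 i j (x + t • y)‖ₑ ≤ A * K := by
    intro i j
    have hcont : Continuous fun q : Y × ℝ => G2 i j (x + q.2 • q.1) := by
      have := hG2c i j; fun_prop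
    rw [lintegral_lintegral_swap]
    · calc _ ≤ ∫⁻ _t in Set.Ioc (0 : ℝ) 1, A * K := by
            refine setLIntegral_mono measurable_const fun t ht => ?_
            rw [lintegral_const_mul _ (by
              have : Continuous fun y : Y => G2 i j (x + t • y) := by have := hG2c i j; fun_prop
              exact this.measurable.enorm)]
            exact bound1 (hG2c i j) (h2 i j) t ht.1 ht.2
        _ = _ := by simp
    · refine Measurable.aemeasurable ?_
      exact (ENNReal.measurable_ofReal.comp measurable_snd).mul hcont.measurable.enorm
  -- The pointwise bound is integrated over the unit ball of increments y.
  have total : ‖f x‖ₑ * volume B ≤ D := by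
    have hm0 : Measurable fun y : Y => ‖f (x + (1 : ℝ) • y)‖ₑ :=
      (by fun_prop : Continuous fun y : Y => f (x + (1 : ℝ) • y)).measurable.enorm
    have hm1 : ∀ i, Measurable fun y : Y => m * ‖dirDeriv (b i) f (x + (1 : ℝ) • y)‖ₑ := fun i =>
      ((by have := hG1c i; fun_prop : Continuous fun y : Y =>
        dirDeriv (b i) f (x + (1 : ℝ) • y)).measurable.enorm).const_mul _
    have hm2 : ∀ i j, Measurable fun y : Y => ∫⁻ t in Set.Ioc (0 : ℝ) 1,
        ENNReal.ofReal t * ‖G2 i j (x + t • y)‖ₑ := fun i j => by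
      have hcont : Continuous fun q : Y × ℝ => G2 i j (x + q.2 • q.1) := by
        have := hG2c i j; fun_prop
      exact Measurable.lintegral_prod_right
        ((ENNReal.measurable_ofReal.comp measurable_snd).mul hcont.measurable.enorm)
    have hm01 : Measurable fun y : Y => ‖f (x + (1 : ℝ) • y)‖ₑ +
        ∑ i, m * ‖dirDeriv (b i) f (x + (1 : ℝ) • y)‖ₑ :=
      hm0.add (Finset.measurable_sum _ fun i _ => hm1 i)
    calc ‖f x‖ₑ * volume B = ∫⁻ _y in B, ‖f x‖ₑ := by rw [setLIntegral_const]
      _ ≤ _ := setLIntegral_mono (by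
          refine hm01.add
            (Finset.measurable_sum _ fun i _ => Finset.measurable_sum _ fun j _ =>
              (hm2 i j).const_mul _)) point
      _ = (∫⁻ y in B, ‖f (x + (1 : ℝ) • y)‖ₑ) +
          (∑ i, m * ∫⁻ y in B, ‖dirDeriv (b i) f (x + (1 : ℝ) • y)‖ₑ) +
          ∑ i, ∑ j, m * m * ∫⁻ y in B, ∫⁻ t in Set.Ioc (0 : ℝ) 1,
            ENNReal.ofReal t * ‖G2 i j (x + t • y)‖ₑ := by
          rw [lintegral_add_left hm01,
            lintegral_add_left hm0, lintegral_finsetSum _ fun i _ => hm1 i,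
            lintegral_finsetSum _ fun i _ => Finset.measurable_sum _ fun j _ =>
              (hm2 i j).const_mul _]
          refine congrArg₂ _ (congrArg₂ _ rfl ?_) ?_
          · refine Finset.sum_congr rfl fun i _ => ?_
            rw [lintegral_const_mul']
            exact ENNReal.ofReal_ne_top
          · refine Finset.sum_congr rfl fun i _ => ?_
            rw [lintegral_finsetSum _ fun j _ => (hm2 i j).const_mul _]
            exact Finset.sum_congr rfl fun j _ => lintegral_const_mul _ (hm2 i j)
      _ ≤ A * K + (∑ _i : ι, m * (A * K)) + ∑ _i : ι, ∑ _j : ι, m * m * (A * K) := by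
          have one : ∀ {g : Y → ℝ}, Continuous g → eLpNorm g p volume ≤ K →
              ∫⁻ y in B, ‖g (x + (1 : ℝ) • y)‖ₑ ≤ A * K := fun hg hgK => by
            simpa using bound1 hg hgK 1 one_pos le_rfl
          refine add_le_add (add_le_add (one hfc h0) ?_) ?_
          · exact Finset.sum_le_sum fun i _ => mul_le_mul_right (one (hG1c i) (h1 i)) _
          · exact Finset.sum_le_sum fun i _ => Finset.sum_le_sum fun j _ =>
              mul_le_mul_right (bound2 i j) _
      _ = D := by simp [hD, hn]
  have hfin : ‖f x‖ₑ ≤ D / volume B := (ENNReal.le_div_iff_mul_le (Or.inl hB0) (Or.inl hBt)).2 total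
  have := ENNReal.toReal_mono (ENNReal.div_ne_top hDt hB0) hfin
  rwa [toReal_enorm, Real.norm_eq_abs] at this

end Embedding

end ThreeBodyBose

end

/-! ### Sobolev bounds through mollification -/

noncomputable section

namespace ThreeBodyBose

theorem MemSobolevW.memLp {X : Type*} [NormedAddCommGroup X] [NormedSpace ℝ X] [MeasureSpace X]
    {p : ℝ≥0∞} {V : X → ℝ} {m : ℕ} (hV : MemSobolevW p m V) :
    MemLp V p volume := by
  cases m with
  | zero => exact hV
  | succ m => exact hV.1

section SobolevFunctions

variable {Y : Type} [NormedAddCommGroup Y] [NormedSpace ℝ Y] [FiniteDimensional ℝ Y]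
  [MeasureSpace Y] [BorelSpace Y] [(volume : Measure Y).IsAddHaarMeasure]

/-- Mollification does not increase the `L^p` norms of the derivatives. -/
theorem MemSobolevW.exists_eLpNorm_mollify_le {p : ℝ≥0∞} (hp : 1 ≤ p) {V : Y → ℝ}
    (hV : MemSobolevW p 2 V) (D : Finset Y) :
    ∃ K : ℝ≥0∞, K ≠ ⊤ ∧ ∀ ρ : Y → ℝ, IsMollifier ρ →
      eLpNorm (mollify ρ V) p volume ≤ K ∧
      (∀ v ∈ D, eLpNorm (dirDeriv v (mollify ρ V)) p volume ≤ K) ∧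
      ∀ v ∈ D, ∀ w ∈ D, eLpNorm (dirDeriv w (dirDeriv v (mollify ρ V))) p volume ≤ K := by
  obtain ⟨hV0, hV1⟩ := hV
  choose g hg hgS using hV1
  choose g2 hg2 hg2S using fun v => (hgS v).2
  refine ⟨eLpNorm V p volume + ∑ v ∈ D, eLpNorm (g v) p volume +
    ∑ v ∈ D, ∑ w ∈ D, eLpNorm (g2 v w) p volume, ?_, fun ρ hρ => ⟨?_, fun v hv => ?_,
      fun v hv w hw => ?_⟩⟩
  · refine ENNReal.add_ne_top.2 ⟨ENNReal.add_ne_top.2 ⟨hV0.eLpNorm_ne_top, ?_⟩, ?_⟩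
    · exact ENNReal.sum_ne_top.2 fun v _ => (hgS v).1.eLpNorm_ne_top
    · exact ENNReal.sum_ne_top.2 fun v _ => ENNReal.sum_ne_top.2 fun w _ =>
        (show MemLp (g2 v w) p volume from hg2S v w).eLpNorm_ne_top
  · exact (hρ.eLpNorm_mollify_le hp hV0.1).trans (le_add_right le_self_add)
  · have e : dirDeriv v (mollify ρ V) = mollify ρ (g v) :=
      funext fun x => hρ.fderiv_mollify (hg v) x
    rw [e]
    refine (hρ.eLpNorm_mollify_le hp (hgS v).1.1).trans (le_add_right (le_add_left ?_))
    exact Finset.single_le_sum (f := fun v => eLpNorm (g v) p volume) (fun _ _ => zero_le) hv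
  · have e : dirDeriv w (dirDeriv v (mollify ρ V)) = mollify ρ (g2 v w) := by
      have : dirDeriv v (mollify ρ V) = mollify ρ (g v) :=
        funext fun x => hρ.fderiv_mollify (hg v) x
      rw [this]
      exact funext fun x => hρ.fderiv_mollify (hg2 v w) x
    rw [e]
    refine (hρ.eLpNorm_mollify_le hp
      (show MemLp (g2 v w) p volume from hg2S v w).1).trans (le_add_left ?_)
    refine le_trans ?_ (Finset.single_le_sum
      (f := fun v => ∑ w ∈ D, eLpNorm (g2 v w) p volume) (fun _ _ => zero_le) hv)
    exact Finset.single_le_sum (f := fun w => eLpNorm (g2 v w) p volume) (fun _ _ => zero_le) hw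

/-- The Sobolev embedding `W^{2,p} ⊂ L^∞`. -/
theorem MemSobolevW.exists_ae_abs_le {p : ℝ≥0∞} (hp1 : 1 ≤ p)
    (hp : (Module.finrank ℝ Y : ℝ≥0∞) ≤ p) {V : Y → ℝ} (hV : MemSobolevW p 2 V) :
    ∃ M : ℝ, ∀ᵐ x, |V x| ≤ M := by
  classical
  let b := Module.finBasis ℝ Y
  obtain ⟨K, hK, h⟩ := hV.exists_eLpNorm_mollify_le hp1 (Finset.univ.image b)
  obtain ⟨C, hC⟩ := exists_sup_le_of_eLpNorm_le b hp hp1 hK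
  have hloc : LocallyIntegrable V volume := hV.memLp.locallyIntegrable hp1
  obtain ⟨ρ, hρ, hlim⟩ := exists_isMollifier_seq Y
  have hb : ∀ i, b i ∈ Finset.univ.image b := fun i =>
    Finset.mem_image_of_mem _ (Finset.mem_univ i)
  refine ⟨C, ?_⟩
  filter_upwards [hlim V hloc] with x hx
  -- The sup bound for the mollified functions depends only on K, hence survives the almost
  -- everywhere limit.
  refine le_of_tendsto hx.abs (Filter.Eventually.of_forall fun n => ?_)
  obtain ⟨h0, h1, h2⟩ := h (ρ n) (hρ n)
  exact hC _ ((hρ n).contDiff_mollify hloc) h0 (fun i => h1 _ (hb i))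
    (fun i j => h2 _ (hb i) _ (hb j)) x

end SobolevFunctions

end ThreeBodyBose

end

noncomputable section

namespace ThreeBodyBose

/-! ### A local Sobolev inequality on the product of two one-particle spaces -/

section OptDeriv

variable {X F : Type*} [NormedAddCommGroup X] [NormedSpace ℝ X] [NormedAddCommGroup F]
  [NormedSpace ℝ F]

/-- The derivative in an optional direction. -/
def optDeriv (v : Option X) (f : X → F) : X → F :=
  match v with
  | none => f
  | some v => fun x => fderiv ℝ f x v

theorem contDiff_optDeriv (v : Option X) {f : X → F} (hf : ContDiff ℝ ∞ f) :
    ContDiff ℝ ∞ (optDeriv v f) := by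
  cases v with
  | none => exact hf
  | some v => exact (hf.fderiv_right (by simp)).clm_apply contDiff_const

theorem tsupport_optDeriv_subset (v : Option X) (f : X → F) :
    tsupport (optDeriv v f) ⊆ tsupport f := by
  cases v with
  | none => exact subset_rfl
  | some v => exact tsupport_fderiv_apply_subset ℝ v

theorem optDeriv_some_smul (v : X) {χ : X → ℝ} {f : X → F} (hχ : ContDiff ℝ ∞ χ)
    (hf : ContDiff ℝ ∞ f) : optDeriv (some v) (fun x => χ x • f x) =
      fun x => χ x • optDeriv (some v) f x + optDeriv (some v) χ x • f x := by
  funext x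
  have h := fderiv_fun_smul (hχ.differentiable (by simp) x) (hf.differentiable (by simp) x)
  simp only [optDeriv, h]
  simp

theorem optDeriv_some_add (v : X) {f g : X → F} (hg : ContDiff ℝ ∞ g)
    (hf : ContDiff ℝ ∞ f) : optDeriv (some v) (fun x => f x + g x) =
      fun x => optDeriv (some v) f x + optDeriv (some v) g x := by
  funext x
  have h := fderiv_fun_add (hf.differentiable (by simp) x) (hg.differentiable (by simp) x)
  simp only [optDeriv, h]
  simp

end OptDeriv

/-- The direction `(e_c, 0)`. -/
def leftDir {d : ℕ} (c : Fin d) : Pos d × Pos d := (EuclideanSpace.single c 1, 0)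

/-- The direction `(0, e_c)`. -/
def rightDir {d : ℕ} (c : Fin d) : Pos d × Pos d := (0, EuclideanSpace.single c 1)

/-- The mixed derivatives of order at most one in each of the two positions. -/
def mixedDeriv {d : ℕ} {F : Type*} [NormedAddCommGroup F] [NormedSpace ℝ F]
    (f : Pos d × Pos d → F) (o : Option (Fin d) × Option (Fin d)) : Pos d × Pos d → F :=
  optDeriv (o.2.map rightDir) (optDeriv (o.1.map leftDir) f)

theorem contDiff_mixedDeriv {d : ℕ} {F : Type*} [NormedAddCommGroup F] [NormedSpace ℝ F]
    {f : Pos d × Pos d → F} (hf : ContDiff ℝ ∞ f) (o : Option (Fin d) × Option (Fin d)) :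
    ContDiff ℝ ∞ (mixedDeriv f o) :=
  contDiff_optDeriv _ (contDiff_optDeriv _ hf)

theorem tsupport_mixedDeriv_subset {d : ℕ} {F : Type*} [NormedAddCommGroup F] [NormedSpace ℝ F]
    (f : Pos d × Pos d → F) (o : Option (Fin d) × Option (Fin d)) :
    tsupport (mixedDeriv f o) ⊆ tsupport f :=
  (tsupport_optDeriv_subset _ _).trans (tsupport_optDeriv_subset _ _)

/-- The sum of the squares of the mixed derivatives. -/
def mixedEnergy {d : ℕ} (f : Pos d × Pos d → ℂ) (z : Pos d × Pos d) : ℝ :=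
  ∑ o, ‖mixedDeriv f o z‖ ^ 2

theorem continuous_mixedEnergy {d : ℕ} {f : Pos d × Pos d → ℂ} (hf : ContDiff ℝ ∞ f) :
    Continuous (mixedEnergy f) :=
  continuous_finsetSum _ fun o _ => ((contDiff_mixedDeriv hf o).continuous.norm.pow 2)

theorem mixedEnergy_eq_zero {d : ℕ} {f : Pos d × Pos d → ℂ} {z : Pos d × Pos d}
    (hz : z ∉ tsupport f) : mixedEnergy f z = 0 :=
  Finset.sum_eq_zero fun o _ => by
    rw [image_eq_zero_of_notMem_tsupport fun h => hz (tsupport_mixedDeriv_subset f o h)]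
    simp

/-- A mixed derivative of order at most (1, 1) of a product has at most four Leibniz terms. -/
theorem norm_mixedDeriv_smul_le {d : ℕ} {χ : Pos d × Pos d → ℝ} {f : Pos d × Pos d → ℂ}
    (hχ : ContDiff ℝ ∞ χ) (hf : ContDiff ℝ ∞ f) {M : ℝ} {z : Pos d × Pos d}
    (hM : ∀ o, ‖mixedDeriv χ o z‖ ≤ M) (o : Option (Fin d) × Option (Fin d)) :
    ‖mixedDeriv (fun x => χ x • f x) o z‖ ≤ 4 * M * ∑ o, ‖mixedDeriv f o z‖ := by
  have hM0 : 0 ≤ M := (norm_nonneg _).trans (hM (none, none))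
  set S := ∑ o, ‖mixedDeriv f o z‖
  have hS : ∀ o, ‖mixedDeriv f o z‖ ≤ S := fun o =>
    Finset.single_le_sum (f := fun o => ‖mixedDeriv f o z‖) (fun _ _ => norm_nonneg _)
      (Finset.mem_univ o)
  have hS0 : 0 ≤ S := (norm_nonneg _).trans (hS (none, none))
  have ht : ∀ o o', ‖mixedDeriv χ o z • mixedDeriv f o' z‖ ≤ M * S := fun o o' => by
    rw [norm_smul]
    exact mul_le_mul (hM o) (hS o') (norm_nonneg _) hM0
  have hMS := mul_nonneg hM0 hS0
  obtain ⟨_ | a, _ | b⟩ := o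
  · refine (ht (none, none) (none, none)).trans (by linarith)
  · have e : mixedDeriv (fun x => χ x • f x) (none, some b) z =
        mixedDeriv χ (none, none) z • mixedDeriv f (none, some b) z +
        mixedDeriv χ (none, some b) z • mixedDeriv f (none, none) z :=
      congrFun (optDeriv_some_smul (rightDir b) hχ hf) z
    rw [e]
    refine (norm_add_le _ _).trans ?_
    linarith [ht (none, none) (none, some b), ht (none, some b) (none, none)]
  · have e : mixedDeriv (fun x => χ x • f x) (some a, none) z =
        mixedDeriv χ (none, none) z • mixedDeriv f (some a, none) z +
        mixedDeriv χ (some a, none) z • mixedDeriv f (none, none) z :=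
      congrFun (optDeriv_some_smul (leftDir a) hχ hf) z
    rw [e]
    refine (norm_add_le _ _).trans ?_
    linarith [ht (none, none) (some a, none), ht (some a, none) (none, none)]
  · have hχa := contDiff_optDeriv (some (leftDir a)) hχ
    have hfa := contDiff_optDeriv (some (leftDir a)) hf
    have e : mixedDeriv (fun x => χ x • f x) (some a, some b) z =
        mixedDeriv χ (none, none) z • mixedDeriv f (some a, some b) z +
        mixedDeriv χ (none, some b) z • mixedDeriv f (some a, none) z +
        (mixedDeriv χ (some a, none) z • mixedDeriv f (none, some b) z +
        mixedDeriv χ (some a, some b) z • mixedDeriv f (none, none) z) := by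
      unfold mixedDeriv
      simp only [Option.map_some]
      rw [optDeriv_some_smul (leftDir a) hχ hf,
        optDeriv_some_add (f := fun x => χ x • optDeriv (some (leftDir a)) f x)
          (g := fun x => optDeriv (some (leftDir a)) χ x • f x) (rightDir b) (hχa.smul hf)
          (hχ.smul hfa),
        optDeriv_some_smul (rightDir b) hχ hfa, optDeriv_some_smul (rightDir b) hχa hf]
      rfl
    rw [e]
    refine (norm_add_le _ _).trans ((add_le_add (norm_add_le _ _) (norm_add_le _ _)).trans ?_)
    linarith [ht (none, none) (some a, some b), ht (none, some b) (some a, none),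
      ht (some a, none) (none, some b), ht (some a, some b) (none, none)]

theorem exists_mixedEnergy_smul_le {d : ℕ} {χ : Pos d × Pos d → ℝ} (hχ : ContDiff ℝ ∞ χ)
    (hc : HasCompactSupport χ) : ∃ C : ℝ, 0 ≤ C ∧ ∀ f : Pos d × Pos d → ℂ, ContDiff ℝ ∞ f →
      ∀ z, mixedEnergy (fun x => χ x • f x) z ≤ C * mixedEnergy f z := by
  have hb : ∀ o, ∃ M, ∀ z, ‖mixedDeriv χ o z‖ ≤ M := fun o =>
    (hc.mono' ((subset_tsupport _).trans
      (tsupport_mixedDeriv_subset χ o))).exists_bound_of_continuous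
        (contDiff_mixedDeriv hχ o).continuous
  choose M hM using hb
  obtain ⟨K, hK⟩ : ∃ K : ℝ, K = Fintype.card (Option (Fin d) × Option (Fin d)) := ⟨_, rfl⟩
  have hK0 : 0 ≤ K := by rw [hK]; positivity
  have hM' : ∀ z o, ‖mixedDeriv χ o z‖ ≤ ∑ o, M o := fun z o => (hM o z).trans
    (Finset.single_le_sum (f := M) (fun o _ => (norm_nonneg _).trans (hM o z)) (Finset.mem_univ o))
  refine ⟨K * ((4 * ∑ o, M o) ^ 2 * K), by positivity, fun f hf z => ?_⟩
  have h1 : (∑ o, ‖mixedDeriv f o z‖) ^ 2 ≤ K * mixedEnergy f z := by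
    have := sq_sum_le_card_mul_sum_sq (s := Finset.univ) (f := fun o => ‖mixedDeriv f o z‖)
    rwa [Finset.card_univ, ← hK] at this
  have h2 : ∀ o, ‖mixedDeriv (fun x => χ x • f x) o z‖ ^ 2 ≤
      (4 * ∑ o, M o) ^ 2 * K * mixedEnergy f z := fun o => by
    refine (pow_le_pow_left₀ (norm_nonneg _) (norm_mixedDeriv_smul_le hχ hf (hM' z) o) 2).trans ?_
    rw [mul_pow, mul_assoc]
    exact mul_le_mul_of_nonneg_left h1 (sq_nonneg _)
  refine (Finset.sum_le_sum fun o _ => h2 o).trans (le_of_eq ?_)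
  rw [Finset.sum_const, Finset.card_univ, nsmul_eq_mul, ← hK]
  ring

/-- The measure-preserving identification of the line with the one-dimensional space. -/
theorem measurePreserving_smul_single :
    MeasurePreserving (fun s : ℝ => (s • EuclideanSpace.single 0 1 : Pos 1)) volume volume := by
  have h := (PiLp.volume_preserving_toLp (Fin 1)).comp
    ((volume_preserving_funUnique (Fin 1) ℝ).symm)
  have e : (fun s : ℝ => (s • EuclideanSpace.single 0 1 : Pos 1)) =
      WithLp.toLp 2 ∘ (MeasurableEquiv.funUnique (Fin 1) ℝ).symm := by
    funext s
    ext i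
    fin_cases i
    simp
  rw [e]
  exact h

/-- The fundamental theorem of calculus along the line, starting outside of the support. -/
theorem enorm_le_lintegral_fderiv {u : Pos 1 → ℂ} (hu : ContDiff ℝ 1 u) (hc : HasCompactSupport u)
    (z : Pos 1) : ‖u z‖ₑ ≤ ∫⁻ s, ‖fderiv ℝ u s (EuclideanSpace.single 0 1)‖ₑ := by
  have hm := measurePreserving_smul_single
  have hcont : Continuous fun s : Pos 1 => ‖fderiv ℝ u s (EuclideanSpace.single 0 1)‖ₑ :=
    ((hu.continuous_fderiv (by simp)).clm_apply continuous_const).enorm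
  rw [← hm.lintegral_comp hcont.measurable]
  set e : Pos 1 := EuclideanSpace.single 0 1
  have hz : z = z 0 • e := by
    ext i; fin_cases i; simp [e]
  have hl : ContDiff ℝ 1 fun s : ℝ => s • e := contDiff_id.smul contDiff_const
  have he : Topology.IsClosedEmbedding fun s : ℝ => s • e :=
    isClosedEmbedding_smul_left (by simp [e])
  have h := HasCompactSupport.enorm_le_lintegral_Ici_deriv (hu.comp hl)
    (hc.comp_isClosedEmbedding he) (z 0)
  rw [Function.comp_apply, ← hz] at h
  refine h.trans ((lintegral_mono' Measure.restrict_le_self le_rfl).trans (le_of_eq ?_))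
  refine lintegral_congr fun s => ?_
  congr 1
  have h1 : HasDerivAt (fun s : ℝ => s • e) e s := by
    simpa using (hasDerivAt_id s).smul_const e
  exact ((hu.differentiable (by simp) _).hasFDerivAt.comp_hasDerivAt s h1).deriv

end ThreeBodyBose

end

/-! ### The local Sobolev inequality in one and two dimensions per particle -/

noncomputable section

namespace ThreeBodyBose

instance isAddHaarMeasure_pairs (d : ℕ) :
    (volume : Measure (Pos d × Pos d)).IsAddHaarMeasure :=
  inferInstanceAs ((volume : Measure (Pos d)).prod volume).IsAddHaarMeasure

theorem eLpNorm_two_sq {α F : Type*} [MeasurableSpace α] [NormedAddCommGroup F] (f : α → F)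
    (μ : Measure α) : eLpNorm f 2 μ ^ 2 = ∫⁻ x, ‖f x‖ₑ ^ 2 ∂μ := by
  have h := eLpNorm_nnreal_pow_eq_lintegral (μ := μ) (f := f) (p := 2) (by norm_num)
  norm_num at h
  exact_mod_cast h

theorem mixedEnergy_nonneg {d : ℕ} (f : Pos d × Pos d → ℂ) (z : Pos d × Pos d) :
    0 ≤ mixedEnergy f z :=
  Finset.sum_nonneg fun _ _ => sq_nonneg _

theorem enorm_mixedDeriv_sq_le {d : ℕ} (f : Pos d × Pos d → ℂ)
    (o : Option (Fin d) × Option (Fin d)) (z : Pos d × Pos d) :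
    ‖mixedDeriv f o z‖ₑ ^ 2 ≤ ENNReal.ofReal (mixedEnergy f z) := by
  rw [← ofReal_norm, ← ENNReal.ofReal_pow (norm_nonneg _)]
  exact ENNReal.ofReal_le_ofReal (Finset.single_le_sum (f := fun o => ‖mixedDeriv f o z‖ ^ 2)
    (fun _ _ => sq_nonneg _) (Finset.mem_univ o))

/-- Integrating first along one position and then along the other bounds |u| by the L¹ norm of the
mixed derivative ∂₁∂₂u, and the compact support turns this into its L² norm. A second-order
derivative is used, but only one in each position. -/
theorem exists_sobolev_one : ∃ C : ℝ≥0∞, C ≠ ⊤ ∧ ∀ u : Pos 1 × Pos 1 → ℂ, ContDiff ℝ ∞ u →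
    tsupport u ⊆ Metric.closedBall 0 2 →
      eLpNorm u ⊤ volume ^ 2 ≤ C * ∫⁻ z, ENNReal.ofReal (mixedEnergy u z) := by
  set Q : Set (Pos 1 × Pos 1) := Metric.closedBall 0 2
  refine ⟨(volume Q ^ (1 / (1 : ℝ≥0∞).toReal - 1 / (2 : ℝ≥0∞).toReal)) ^ 2, ?_, fun u hu hs => ?_⟩
  · refine ENNReal.pow_ne_top (ENNReal.rpow_ne_top_of_nonneg (by norm_num) ?_)
    exact (isCompact_closedBall _ _).measure_lt_top.ne
  have hc : HasCompactSupport u := (isCompact_closedBall _ _).of_isClosed_subset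
    (isClosed_tsupport u) hs
  set g := mixedDeriv u (some 0, some 0) with hg
  have hgc : ContDiff ℝ ∞ g := contDiff_mixedDeriv hu _
  have hsup : ∀ z, ‖u z‖ₑ ≤ ∫⁻ z, ‖g z‖ₑ := by
    intro z
    set u1 := optDeriv (some (leftDir 0)) u with hu1
    have hu1c : ContDiff ℝ ∞ u1 := contDiff_optDeriv _ hu
    have hc1 : HasCompactSupport u1 := hc.mono' ((subset_tsupport _).trans
      (tsupport_optDeriv_subset _ _))
    have h1 : ∀ z2 : Pos 1, ‖u (z.1, z2)‖ₑ ≤ ∫⁻ s, ‖u1 (s, z2)‖ₑ := by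
      intro z2
      have hemb : Topology.IsClosedEmbedding fun s : Pos 1 => (s, z2) :=
        ⟨isEmbedding_prodMkLeft z2, by
          convert isClosed_singleton.preimage (continuous_snd (X := Pos 1)) (t := {z2}) using 1
          ext; simp [Prod.ext_iff, eq_comm]⟩
      have hl : ContDiff ℝ ∞ fun s : Pos 1 => (s, z2) := contDiff_prodMk_left z2
      refine (enorm_le_lintegral_fderiv ((hu.comp hl).of_le (by simp))
        (hc.comp_isClosedEmbedding hemb) z.1).trans (le_of_eq (lintegral_congr fun s => ?_))
      congr 1
      have := HasFDerivAt.fderiv (HasFDerivAt.comp (f := fun s => (s, z2)) s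
        (hu.differentiable (by simp) (s, z2)).hasFDerivAt (hasFDerivAt_prodMk_left s z2))
      rw [this]
      simp [hu1, optDeriv, leftDir]
    have h2 : ∀ s : Pos 1, ‖u1 (s, z.2)‖ₑ ≤ ∫⁻ t, ‖g (s, t)‖ₑ := by
      intro s
      have hemb : Topology.IsClosedEmbedding fun t : Pos 1 => (s, t) :=
        ⟨isEmbedding_prodMkRight s, by
          convert isClosed_singleton.preimage (continuous_fst (Y := Pos 1)) (t := {s}) using 1
          ext; simp [Prod.ext_iff, eq_comm]⟩
      have hl : ContDiff ℝ ∞ fun t : Pos 1 => (s, t) := contDiff_prodMk_right s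
      refine (enorm_le_lintegral_fderiv ((hu1c.comp hl).of_le (by simp))
        (hc1.comp_isClosedEmbedding hemb) z.2).trans (le_of_eq (lintegral_congr fun t => ?_))
      congr 1
      have := HasFDerivAt.fderiv (HasFDerivAt.comp (f := fun t => (s, t)) t
        (hu1c.differentiable (by simp) (s, t)).hasFDerivAt (hasFDerivAt_prodMk_right s t))
      rw [this]
      simp [hg, hu1, mixedDeriv, optDeriv, rightDir]
    refine (h1 z.2).trans ((lintegral_mono h2).trans (le_of_eq ?_))
    exact (lintegral_prod _ hgc.continuous.enorm.aemeasurable).symm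
  have h3 : eLpNorm u ⊤ volume ≤ ∫⁻ z, ‖g z‖ₑ := by
    rw [eLpNorm_exponent_top]
    exact eLpNormEssSup_le_of_ae_enorm_bound (ae_of_all _ hsup)
  have h4 : ∫⁻ z, ‖g z‖ₑ = ∫⁻ z in Q, ‖g z‖ₑ := by
    refine (setLIntegral_eq_of_support_subset fun z hz => hs (tsupport_mixedDeriv_subset u
      (some 0, some 0) (subset_tsupport g ?_))).symm
    exact enorm_ne_zero.mp hz
  have h5 : ∫⁻ z in Q, ‖g z‖ₑ ≤ eLpNorm g 2 volume *
      volume Q ^ (1 / (1 : ℝ≥0∞).toReal - 1 / (2 : ℝ≥0∞).toReal) := by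
    rw [← eLpNorm_one_eq_lintegral_enorm]
    refine (eLpNorm_le_eLpNorm_mul_rpow_measure_univ (by norm_num : (1 : ℝ≥0∞) ≤ 2)
      hgc.continuous.aestronglyMeasurable).trans ?_
    rw [Measure.restrict_apply_univ]
    gcongr
    exact Measure.restrict_le_self
  refine (pow_le_pow_left' (h3.trans (h4.le.trans h5)) 2).trans ?_
  rw [mul_pow, mul_comm]
  gcongr
  rw [eLpNorm_two_sq]
  exact lintegral_mono fun z => enorm_mixedDeriv_sq_le u _ z

/-- The Gagliardo–Nirenberg–Sobolev inequality in dimension 4 with exponents 2 and 4. It needs only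
the first-order part of `mixedEnergy`. -/
theorem exists_sobolev_two : ∃ C : ℝ≥0∞, C ≠ ⊤ ∧ ∀ u : Pos 2 × Pos 2 → ℂ, ContDiff ℝ ∞ u →
    tsupport u ⊆ Metric.closedBall 0 2 →
      eLpNorm u 4 volume ^ 2 ≤ C * ∫⁻ z, ENNReal.ofReal (mixedEnergy u z) := by
  let b : Module.Basis (Fin 2 ⊕ Fin 2) ℝ (Pos 2 × Pos 2) :=
    (EuclideanSpace.basisFun (Fin 2) ℝ).toBasis.prod (EuclideanSpace.basisFun (Fin 2) ℝ).toBasis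
  -- K compares the operator norm of a derivative with its values on the coordinate directions.
  obtain ⟨K, hK0, hK⟩ : ∃ K : ℝ, 0 ≤ K ∧ ∀ (T : Pos 2 × Pos 2 →L[ℝ] ℂ) (M : ℝ), 0 ≤ M →
      (∀ i, ‖T (b i)‖ ≤ M) → ‖T‖ ≤ K * M :=
    ⟨Fintype.card (Fin 2 ⊕ Fin 2) • ‖b.equivFunL.toContinuousLinearMap‖, by positivity,
      fun T M hM h => b.opNorm_le hM h⟩
  have hpt : ∀ u : Pos 2 × Pos 2 → ℂ, ∀ z, ‖fderiv ℝ u z‖ₑ ^ 2 ≤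
      ENNReal.ofReal (K ^ 2) * ENNReal.ofReal (mixedEnergy u z) := by
    intro u z
    have h1 : ‖fderiv ℝ u z‖ ≤ K * √(mixedEnergy u z) := by
      refine hK _ _ (Real.sqrt_nonneg _) fun i => ?_
      refine Real.le_sqrt_of_sq_le ?_
      obtain i | i := i
      · have h := Finset.single_le_sum (f := fun o => ‖mixedDeriv u o z‖ ^ 2)
          (fun _ _ => sq_nonneg _) (Finset.mem_univ (some i, none))
        refine le_trans (le_of_eq ?_) h
        simp [b, mixedDeriv, optDeriv, leftDir]
      · have h := Finset.single_le_sum (f := fun o => ‖mixedDeriv u o z‖ ^ 2)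
          (fun _ _ => sq_nonneg _) (Finset.mem_univ (none, some i))
        refine le_trans (le_of_eq ?_) h
        simp [b, mixedDeriv, optDeriv, rightDir]
    have h2 : ‖fderiv ℝ u z‖ ^ 2 ≤ K ^ 2 * mixedEnergy u z := by
      have := pow_le_pow_left₀ (norm_nonneg _) h1 2
      rwa [mul_pow, Real.sq_sqrt (mixedEnergy_nonneg u z)] at this
    rw [← ENNReal.ofReal_mul (sq_nonneg K), ← ofReal_norm, ← ENNReal.ofReal_pow (norm_nonneg _)]
    exact ENNReal.ofReal_le_ofReal h2
  refine ⟨(SNormLESNormFDerivOfEqConst ℂ (volume : Measure (Pos 2 × Pos 2)) 2 : ℝ≥0∞) ^ 2 *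
    ENNReal.ofReal (K ^ 2), ENNReal.mul_ne_top (ENNReal.pow_ne_top ENNReal.coe_ne_top)
      ENNReal.ofReal_ne_top, fun u hu hs => ?_⟩
  have hc : HasCompactSupport u := (isCompact_closedBall _ _).of_isClosed_subset
    (isClosed_tsupport u) hs
  have hr : Module.finrank ℝ (Pos 2 × Pos 2) = 4 := by simp
  have h := eLpNorm_le_eLpNorm_fderiv_of_eq (volume : Measure (Pos 2 × Pos 2))
    (hu.of_le (by simp)) hc (p := 2) (p' := 4) (by norm_num) (by rw [hr]; norm_num)
    (by rw [hr]; norm_num)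
  refine (pow_le_pow_left' h 2).trans ?_
  rw [mul_pow, mul_assoc]
  refine mul_le_mul' le_rfl ?_
  rw [← lintegral_const_mul _ (continuous_mixedEnergy hu).measurable.ennreal_ofReal]
  refine le_trans (le_of_eq ?_) (lintegral_mono (hpt u))
  exact eLpNorm_two_sq _ _

/-- The Hölder exponent complementary to `2 d`. -/
def pairExponent (d : ℕ) : ℝ≥0∞ := if d = 1 then ⊤ else 4

theorem holderTriple_pairExponent {d : ℕ} (hd : d = 1 ∨ d = 2) :
    ENNReal.HolderTriple (2 * (d : ℝ≥0∞)) (pairExponent d) 2 := by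
  constructor
  rcases hd with rfl | rfl
  · simp [pairExponent]
  · rw [pairExponent, if_neg (by norm_num), Nat.cast_ofNat, show (2 * 2 : ℝ≥0∞) = 4 by norm_num,
      ← ENNReal.toReal_eq_toReal_iff' (by finiteness) (by finiteness),
      ENNReal.toReal_add (by finiteness) (by finiteness)]
    simp only [ENNReal.toReal_inv, ENNReal.toReal_ofNat]
    norm_num

/-- A bump function that is 1 on the ball of radius 1 and supported in radius 2 reduces to compact
support; the mixed energy of the product is bounded pointwise by that of f. -/
theorem exists_localSobolev {d : ℕ} (hd : d = 1 ∨ d = 2) : ∃ C : ℝ≥0∞, C ≠ ⊤ ∧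
    ∀ f : Pos d × Pos d → ℂ, ContDiff ℝ ∞ f →
      eLpNorm f (pairExponent d) (volume.restrict (Metric.closedBall 0 1)) ^ 2 ≤
        C * ∫⁻ z in Metric.closedBall 0 2, ENNReal.ofReal (mixedEnergy f z) := by
  have key : ∃ C : ℝ≥0∞, C ≠ ⊤ ∧ ∀ u : Pos d × Pos d → ℂ, ContDiff ℝ ∞ u →
      tsupport u ⊆ Metric.closedBall 0 2 → eLpNorm u (pairExponent d) volume ^ 2 ≤
        C * ∫⁻ z, ENNReal.ofReal (mixedEnergy u z) := by
    rcases hd with rfl | rfl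
    · simpa [pairExponent] using exists_sobolev_one
    · simpa [pairExponent] using exists_sobolev_two
  obtain ⟨C, hC, h⟩ := key
  let χ : ContDiffBump (0 : Pos d × Pos d) := ⟨1, 2, by norm_num, by norm_num⟩
  have hχ : ContDiff ℝ ∞ χ := χ.contDiff
  obtain ⟨M, hM0, hM⟩ := exists_mixedEnergy_smul_le hχ χ.hasCompactSupport
  refine ⟨C * ENNReal.ofReal M, ENNReal.mul_ne_top hC ENNReal.ofReal_ne_top, fun f hf => ?_⟩
  set u := fun x => χ x • f x with hu
  have hts : tsupport u ⊆ Metric.closedBall 0 2 :=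
    (tsupport_smul_subset_left _ _).trans χ.tsupport_eq.subset
  have h1 : eLpNorm f (pairExponent d) (volume.restrict (Metric.closedBall 0 1)) ≤
      eLpNorm u (pairExponent d) volume := by
    refine le_trans (le_of_eq (eLpNorm_congr_ae ?_)) (eLpNorm_mono_measure _ Measure.restrict_le_self)
    filter_upwards [ae_restrict_mem Metric.isClosed_closedBall.measurableSet] with x hx
    rw [hu]
    simp [χ.one_of_mem_closedBall hx]
  refine (pow_le_pow_left' h1 2).trans ((h u (hχ.smul hf) hts).trans ?_)
  rw [mul_assoc]
  refine mul_le_mul' le_rfl ?_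
  rw [← lintegral_const_mul _ (continuous_mixedEnergy hf).measurable.ennreal_ofReal,
    ← setLIntegral_eq_of_support_subset (s := Metric.closedBall 0 2)]
  · refine lintegral_mono fun z => ?_
    rw [← ENNReal.ofReal_mul hM0]
    exact ENNReal.ofReal_le_ofReal (hM f hf z)
  · intro z hz
    by_contra hz'
    exact hz (by simp [mixedEnergy_eq_zero fun h => hz' (hts h)])

end ThreeBodyBose

end

noncomputable section

namespace ThreeBodyBose

/-! ### Multiplication operators bounded by two derivatives -/

open SchwartzMap LineDeriv

variable {d N : ℕ}

/-- The embedding of a pair of positions as the positions of the particles `a` and `b`. -/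
def pairEmbed (a b : Fin N) : Pos d × Pos d →L[ℝ] Config d N :=
  LinearMap.toContinuousLinearMap
    (∑ c, ((LinearMap.toSpanSingleton ℝ _ (coordVec a c)) ∘ₗ
        (EuclideanSpace.proj c : Pos d →L[ℝ] ℝ).toLinearMap ∘ₗ LinearMap.fst ℝ _ _ +
      (LinearMap.toSpanSingleton ℝ _ (coordVec b c)) ∘ₗ
        (EuclideanSpace.proj c : Pos d →L[ℝ] ℝ).toLinearMap ∘ₗ LinearMap.snd ℝ _ _))

theorem pairEmbed_apply (a b : Fin N) (z : Pos d × Pos d) :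
    pairEmbed a b z = ∑ c, (z.1 c • coordVec a c + z.2 c • coordVec b c) := by
  simp [pairEmbed, LinearMap.toSpanSingleton]

theorem pairEmbed_leftDir (a b : Fin N) (c : Fin d) :
    pairEmbed a b (leftDir c) = coordVec a c := by
  rw [pairEmbed_apply]
  simp [leftDir]

theorem pairEmbed_rightDir (a b : Fin N) (c : Fin d) :
    pairEmbed a b (rightDir c) = coordVec b c := by
  rw [pairEmbed_apply]
  simp [rightDir]

/-- The restriction of a Schwartz function to the positions of two particles. -/
def pairSlice (a b : Fin N) (f : 𝓢(Config d N, ℂ)) (x : Config d N) (z : Pos d × Pos d) : ℂ :=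
  f (x + pairEmbed a b z)

theorem contDiff_pairSlice (a b : Fin N) (f : 𝓢(Config d N, ℂ)) (x : Config d N) :
    ContDiff ℝ ∞ (pairSlice a b f x) :=
  f.smooth'.comp (contDiff_const.add (pairEmbed a b).contDiff)

theorem fderiv_pairSlice (a b : Fin N) (f : 𝓢(Config d N, ℂ)) (x : Config d N)
    (z w : Pos d × Pos d) : fderiv ℝ (pairSlice a b f x) z w =
      (∂_{pairEmbed a b w} f : 𝓢(Config d N, ℂ)) (x + pairEmbed a b z) := by
  have h1 : HasFDerivAt (fun z => x + pairEmbed a b z) (pairEmbed a b) z :=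
    (pairEmbed a b).hasFDerivAt.const_add x
  have h2 := HasFDerivAt.comp z (f.hasFDerivAt (x + pairEmbed a b z)) h1
  rw [SchwartzMap.lineDerivOp_apply_eq_fderiv]
  exact congrArg (fun T => T w) h2.fderiv

theorem mixedDeriv_pairSlice (a b : Fin N) (f : 𝓢(Config d N, ℂ)) (x : Config d N)
    (o : Option (Fin d) × Option (Fin d)) :
    mixedDeriv (pairSlice a b f x) o = pairSlice a b (partialOp b o.2 (partialOp a o.1 f)) x := by
  have h1 : ∀ o g, optDeriv (Option.map leftDir o) (pairSlice a b g x) =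
      pairSlice a b (partialOp a o g) x := by
    rintro (_ | c) g
    · rfl
    · funext z
      exact (fderiv_pairSlice a b g x z (leftDir c)).trans (by rw [pairEmbed_leftDir]; rfl)
  have h2 : ∀ o g, optDeriv (Option.map rightDir o) (pairSlice a b g x) =
      pairSlice a b (partialOp b o g) x := by
    rintro (_ | c) g
    · rfl
    · funext z
      exact (fderiv_pairSlice a b g x z (rightDir c)).trans (by rw [pairEmbed_rightDir]; rfl)
  rw [mixedDeriv, h1, h2]

theorem enorm_toLp_sq (f : 𝓢(Config d N, ℂ)) :
    ∫⁻ x, ‖f x‖ₑ ^ 2 = ENNReal.ofReal (‖f.toLp 2 volume‖ ^ 2) := by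
  rw [ENNReal.ofReal_pow (norm_nonneg _), ofReal_norm, Lp.enorm_def,
    eLpNorm_congr_ae (f.coeFn_toLp 2 volume), eLpNorm_two_sq]

theorem sum_partialOp_eq_weightSq (a b : Fin N) (f : 𝓢(Config d N, ℂ)) :
    ∑ o : Option (Fin d) × Option (Fin d),
      ‖(partialOp b o.2 (partialOp a o.1 f)).toLp 2 volume‖ ^ 2 =
        weightSq (fun ξ => sobSymbol a ξ * sobSymbol b ξ) f := by
  have h1 := Function.HasTemperateGrowth.const (E := Config d N) (1 : ℝ)
  simp only [norm_toLp_sq_eq_weightSq]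
  rw [Fintype.sum_prod_type, weightSq_sobSymbol_mul a (hasTemperateGrowth_sobSymbol b)]
  refine Finset.sum_congr rfl fun o _ => ?_
  have h := weightSq_sobSymbol_mul b h1 (partialOp a o f)
  simp only [mul_one] at h
  exact h.symm

/-- Averaging over translations. -/
theorem lintegral_lintegral_add_eq (T : Pos d × Pos d →L[ℝ] Config d N) {F : Config d N → ℝ≥0∞}
    (hF : Measurable F) (Q : Set (Pos d × Pos d)) :
    ∫⁻ x, (∫⁻ z in Q, F (x + T z)) = volume Q * ∫⁻ x, F x := by
  rw [lintegral_lintegral_swap]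
  · simp_rw [lintegral_add_right_eq_self]
    rw [setLIntegral_const, mul_comm]
  · exact (hF.comp (measurable_fst.add (T.measurable.comp measurable_snd))).aemeasurable

/-- Freeze all particles except a and b. On a unit ball of these two positions, Hölder with
exponents 2d and `pairExponent d` together with the local Sobolev inequality bounds w f by the mixed
derivatives of f. Integrating over all base points x makes the estimate global, because averaging
over translations turns ball integrals into full integrals. -/
theorem exists_pairBounded (hd : d = 1 ∨ d = 2) {p : ℝ≥0∞} (hp : 2 * (d : ℝ≥0∞) ≤ p) :
    ∃ C : ℝ, 0 ≤ C ∧ ∀ (N : ℕ) (a b : Fin N) (w : Config d N → ℝ),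
      Function.HasTemperateGrowth w → ∀ K : ℝ, 0 ≤ K →
        (∀ x : Config d N, eLpNorm (fun z => w (x + pairEmbed a b z)) p volume ≤ ENNReal.ofReal K) →
          PairBounded (C * K) w a b := by
  obtain ⟨C, hC, hS⟩ := exists_localSobolev hd
  have hH := holderTriple_pairExponent hd
  set Q : Set (Pos d × Pos d) := Metric.closedBall 0 1
  set Q' : Set (Pos d × Pos d) := Metric.closedBall 0 2
  have hQ0 : volume Q ≠ 0 := (Metric.measure_closedBall_pos _ _ one_pos).ne'
  have hQt : volume Q ≠ ⊤ := (isCompact_closedBall _ _).measure_lt_top.ne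
  have hQt' : volume Q' ≠ ⊤ := (isCompact_closedBall _ _).measure_lt_top.ne
  -- The cost of passing from L^p to L^(2d) on the unit ball, available because 2d ≤ p.
  set H : ℝ≥0∞ := volume Q ^ (1 / (2 * (d : ℝ≥0∞)).toReal - 1 / p.toReal)
  have hHt : H ≠ ⊤ := by
    simp [H, ENNReal.rpow_eq_top_iff, hQ0, hQt]
  -- The ratio of the volumes of the two balls appears because both sides are averaged over x.
  set D : ℝ≥0∞ := (volume Q)⁻¹ * (H ^ 2 * C * volume Q')
  have hD : D ≠ ⊤ := by
    have := ENNReal.inv_ne_top.mpr hQ0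
    finiteness
  refine ⟨√D.toReal, Real.sqrt_nonneg _, fun N a b w hw K hK h f => ?_⟩
  have hwc : Continuous w := hw.1.continuous
  have hpt : ∀ x, ∫⁻ z in Q, ‖mulSchwartz w f (x + pairEmbed a b z)‖ₑ ^ 2 ≤
      H ^ 2 * ENNReal.ofReal K ^ 2 * C * ∫⁻ z in Q', ∑ o : Option (Fin d) × Option (Fin d),
        ‖partialOp b o.2 (partialOp a o.1 f) (x + pairEmbed a b z)‖ₑ ^ 2 := by
    intro x
    have hc : Continuous fun z => x + pairEmbed a b z := by fun_prop
    have e1 : ∫⁻ z in Q, ‖mulSchwartz w f (x + pairEmbed a b z)‖ₑ ^ 2 =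
        eLpNorm ((fun z => w (x + pairEmbed a b z)) • pairSlice a b f x) 2 (volume.restrict Q) ^ 2 := by
      rw [eLpNorm_two_sq]
      refine lintegral_congr fun z => ?_
      rw [mulSchwartz_apply hw, Pi.smul_apply', Complex.real_smul]
      rfl
    have e2 : ∀ z, ENNReal.ofReal (mixedEnergy (pairSlice a b f x) z) =
        ∑ o : Option (Fin d) × Option (Fin d),
          ‖partialOp b o.2 (partialOp a o.1 f) (x + pairEmbed a b z)‖ₑ ^ 2 := by
      intro z
      rw [mixedEnergy, ENNReal.ofReal_sum_of_nonneg fun _ _ => sq_nonneg _]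
      refine Finset.sum_congr rfl fun o _ => ?_
      rw [mixedDeriv_pairSlice, ENNReal.ofReal_pow (norm_nonneg _), ofReal_norm]
      rfl
    have h1 := eLpNorm_smul_le_mul_eLpNorm (p := 2 * (d : ℝ≥0∞)) (q := pairExponent d) (r := 2)
      (μ := volume.restrict Q) (contDiff_pairSlice a b f x).continuous.aestronglyMeasurable
      (hwc.comp hc).aestronglyMeasurable
    have h2 := eLpNorm_le_eLpNorm_mul_rpow_measure_univ hp (μ := volume.restrict Q)
      (hwc.comp hc).aestronglyMeasurable
    rw [Measure.restrict_apply_univ] at h2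
    have h3 := hS _ (contDiff_pairSlice a b f x)
    simp only [e2] at h3
    rw [e1]
    refine (pow_le_pow_left' h1 2).trans ?_
    rw [mul_pow, mul_assoc _ C]
    refine mul_le_mul' ?_ h3
    rw [← mul_pow, mul_comm H]
    refine pow_le_pow_left' (h2.trans (mul_le_mul' ?_ le_rfl)) 2
    exact (eLpNorm_mono_measure _ Measure.restrict_le_self).trans (h x)
  have hint := lintegral_mono (μ := (volume : Measure (Config d N))) hpt
  have hm : ∀ g : 𝓢(Config d N, ℂ), Measurable fun x => ‖g x‖ₑ ^ 2 := fun g =>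
    g.continuous.enorm.measurable.pow_const 2
  rw [lintegral_lintegral_add_eq (pairEmbed a b) (hm _), lintegral_const_mul' _ _ (by finiteness),
    lintegral_lintegral_add_eq (pairEmbed a b)
      (F := fun x => ∑ o : Option (Fin d) × Option (Fin d),
        ‖partialOp b o.2 (partialOp a o.1 f) x‖ₑ ^ 2) (Finset.measurable_sum _ fun o _ => hm _),
    lintegral_finsetSum _ fun o _ => hm _] at hint
  simp only [enorm_toLp_sq] at hint
  rw [← ENNReal.ofReal_sum_of_nonneg fun _ _ => sq_nonneg _, sum_partialOp_eq_weightSq] at hint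
  set W := weightSq (fun ξ => sobSymbol a ξ * sobSymbol b ξ) f
  have hfin : ENNReal.ofReal (‖(mulSchwartz w f).toLp 2 volume‖ ^ 2) ≤
      D * ENNReal.ofReal (K ^ 2 * W) := by
    rw [ENNReal.ofReal_mul (sq_nonneg K), ENNReal.ofReal_pow hK]
    calc _ = (volume Q)⁻¹ * (volume Q *
          ENNReal.ofReal (‖(mulSchwartz w f).toLp 2 volume‖ ^ 2)) := by
          rw [← mul_assoc, ENNReal.inv_mul_cancel hQ0 hQt, one_mul]
      _ ≤ _ := mul_le_mul' le_rfl hint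
      _ = _ := by simp only [D]; ring
  have hW : 0 ≤ W := weightSq_nonneg (fun ξ => (mul_pos (sobSymbol_pos a ξ) (sobSymbol_pos b ξ)).le) f
  rw [← ENNReal.ofReal_toReal hD, ← ENNReal.ofReal_mul ENNReal.toReal_nonneg] at hfin
  have h := (ENNReal.ofReal_le_ofReal_iff (by positivity)).mp hfin
  rw [mul_pow, Real.sq_sqrt ENNReal.toReal_nonneg, mul_assoc]
  exact h

end ThreeBodyBose

end

noncomputable section

set_option linter.unusedSimpArgs false
namespace ThreeBodyBose

/-! ### The regularized scaled interaction -/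

variable {d N : ℕ}

/-- The position of the particle `i` as a continuous linear map. -/
def particleL (i : Fin N) : Config d N →L[ℝ] Pos d :=
  LinearMap.toContinuousLinearMap
    { toFun := fun x => particle x i
      map_add' := fun _ _ => rfl
      map_smul' := fun _ _ => rfl }

theorem particleL_apply (i : Fin N) (x : Config d N) : particleL i x = particle x i := rfl

theorem particle_coordVec (m i : Fin N) (c : Fin d) :
    particle (coordVec m c) i = if i = m then EuclideanSpace.single c 1 else 0 := by
  ext c'
  by_cases h : i = m <;> simp [particle, coordVec, h, Pi.single_apply]

theorem particle_pairEmbed (a b i : Fin N) (z : Pos d × Pos d) :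
    particle (pairEmbed a b z) i = (if i = a then z.1 else 0) + if i = b then z.2 else 0 := by
  rw [pairEmbed_apply, ← particleL_apply, map_sum]
  simp only [map_add, map_smul, particleL_apply, particle_coordVec, Finset.sum_add_distrib]
  have h : ∀ w : Pos d, ∑ c, w c • (EuclideanSpace.single c 1 : Pos d) = w := fun w => by
    ext c
    simp [Finset.sum_apply, Pi.single_apply]
  congr 1 <;> split_ifs <;> simp [h]

/-- The map `x ↦ (η (x_i - x_j), η (x_i - x_l))`. -/
def tripleMap (η : ℝ) (i j l : Fin N) : Config d N →L[ℝ] Pos d × Pos d :=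
  (η • (particleL i - particleL j)).prod (η • (particleL i - particleL l))

theorem tripleMap_apply (η : ℝ) (i j l : Fin N) (x : Config d N) :
    tripleMap η i j l x =
      (η • (particle x i - particle x j), η • (particle x i - particle x l)) := rfl

/-- The directions in which the two relative positions are moved by moving one particle. -/
def tripleDir : Fin 3 → Fin d → Pos d × Pos d
  | 0, c => (EuclideanSpace.single c 1, EuclideanSpace.single c 1)
  | 1, c => (-EuclideanSpace.single c 1, 0)
  | 2, c => (0, -EuclideanSpace.single c 1)

theorem tripleMap_coordVec {i j l : Fin N} (hij : i ≠ j) (hil : i ≠ l) (hjl : j ≠ l) (η : ℝ)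
    {m : Fin N} (hm : m ∈ ({i, j, l} : Finset (Fin N))) :
    ∃ r, ∀ c : Fin d, tripleMap η i j l (coordVec m c) = η • tripleDir r c := by
  simp only [Finset.mem_insert, Finset.mem_singleton] at hm
  rcases hm with rfl | rfl | rfl
  · exact ⟨0, fun c => by
      simp [tripleMap_apply, particle_coordVec, tripleDir, hij.symm, hil.symm]⟩
  · exact ⟨1, fun c => by
      simp [tripleMap_apply, particle_coordVec, tripleDir, hij, hjl.symm]⟩
  · exact ⟨2, fun c => by
      simp [tripleMap_apply, particle_coordVec, tripleDir, hil, hjl]⟩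

theorem tripleMap_coordVec_eq_zero {i j l m : Fin N} (hm : m ∉ ({i, j, l} : Finset (Fin N)))
    (η : ℝ) (c : Fin d) : tripleMap η i j l (coordVec m c) = 0 := by
  simp only [Finset.mem_insert, Finset.mem_singleton, not_or] at hm
  simp [tripleMap_apply, particle_coordVec, Ne.symm hm.1, Ne.symm hm.2.1, Ne.symm hm.2.2]

theorem measurePreserving_fst_sub (d : ℕ) :
    MeasurePreserving (fun z : Pos d × Pos d => (z.1, z.1 - z.2)) volume volume :=
  (MeasurePreserving.id (volume : Measure (Pos d))).skew_product
    (g := fun x y => x - y) (measurable_fst.sub measurable_snd)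
    (ae_of_all _ fun x => (Measure.measurePreserving_sub_left volume x).map_eq)

theorem measurePreserving_swap_pairs (d : ℕ) :
    MeasurePreserving (fun z : Pos d × Pos d => z.swap) volume volume :=
  Measure.measurePreserving_swap

/-- Moving any two particles of the triple moves the two relative positions by a volume-preserving
linear map, up to the scaling η. The six cases are compositions of the shear (y, z) ↦ (y, y - z),
the swap and the reflection. Thus every two-particle slice of the potential has an L^p norm
controlled by that of V. -/
theorem tripleMap_pairEmbed {i j l : Fin N} (hij : i ≠ j) (hil : i ≠ l) (hjl : j ≠ l) (η : ℝ)
    {a b : Fin N} (ha : a ∈ ({i, j, l} : Finset (Fin N))) (hb : b ∈ ({i, j, l} : Finset (Fin N)))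
    (hab : a ≠ b) :
    ∃ A : Pos d × Pos d → Pos d × Pos d, MeasurePreserving A volume volume ∧
      ∀ z, tripleMap η i j l (pairEmbed a b z) = η • A z := by
  have h1 := measurePreserving_fst_sub d
  have h2 := measurePreserving_swap_pairs d
  have h3 : MeasurePreserving (fun z : Pos d × Pos d => -z) volume volume :=
    (Measure.measurePreserving_neg (volume : Measure (Pos d))).prod
      (Measure.measurePreserving_neg (volume : Measure (Pos d)))
  simp only [Finset.mem_insert, Finset.mem_singleton] at ha hb
  rcases ha with rfl | rfl | rfl <;> rcases hb with rfl | rfl | rfl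
  · exact absurd rfl hab
  · exact ⟨_, h2.comp h1, fun z => by
      simp [tripleMap_apply, particle_pairEmbed, hij.symm, hil.symm, hjl.symm, hij, hil, hjl]⟩
  · exact ⟨_, h1, fun z => by
      simp [tripleMap_apply, particle_pairEmbed, hij.symm, hil.symm, hjl.symm, hij, hil, hjl]⟩
  · exact ⟨_, (h2.comp h1).comp h2, fun z => by
      simp [tripleMap_apply, particle_pairEmbed, hij.symm, hil.symm, hjl.symm, hij, hil, hjl]⟩
  · exact absurd rfl hab
  · exact ⟨_, h3, fun z => by
      simp [Prod.ext_iff, tripleMap_apply, particle_pairEmbed, hij.symm, hil.symm, hjl.symm, hij, hil, hjl]⟩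
  · exact ⟨_, h1.comp h2, fun z => by
      simp [tripleMap_apply, particle_pairEmbed, hij.symm, hil.symm, hjl.symm, hij, hil, hjl]⟩
  · exact ⟨_, h2.comp h3, fun z => by
      simp [Prod.ext_iff, tripleMap_apply, particle_pairEmbed, hij.symm, hil.symm, hjl.symm, hij, hil, hjl]⟩
  · exact absurd rfl hab

/-- Shrinking the argument scale by η ≥ 1 only decreases the L^p norm; the gain η^(-2d/p) is not
used. -/
theorem eLpNorm_comp_add_smul_le_self {W : Pos d × Pos d → ℝ} (hW : Continuous W) (p : ℝ≥0∞)
    {η : ℝ} (hη : 1 ≤ η) {A : Pos d × Pos d → Pos d × Pos d}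
    (hA : MeasurePreserving A volume volume) (x : Pos d × Pos d) :
    eLpNorm (fun z => W (x + η • A z)) p volume ≤ eLpNorm W p volume := by
  have e0 : eLpNorm (fun z => W (x + η • A z)) p volume =
      eLpNorm (fun z => W (x + η • z)) p volume :=
    eLpNorm_comp_measurePreserving (g := fun z => W (x + η • z))
      (by fun_prop : Continuous fun z => W (x + η • z)).aestronglyMeasurable hA
  have e1 : eLpNorm (fun y => W (x + η • y)) p volume =
      eLpNorm (fun z => W (x + z)) p
        (Measure.map (fun y : Pos d × Pos d => η • y) volume) := by
    rw [eLpNorm_map_measure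
      (by fun_prop : Continuous fun z => W (x + z)).aestronglyMeasurable (by fun_prop)]
    rfl
  have e2 : eLpNorm (fun z => W (x + z)) p volume = eLpNorm W p volume :=
    eLpNorm_comp_measurePreserving (g := W) hW.aestronglyMeasurable
      (measurePreserving_add_left volume x)
  rw [e0, e1, ← e2, Measure.map_addHaar_smul volume (by linarith)]
  refine eLpNorm_mono_measure _ ?_
  refine Measure.le_iff.mpr fun s _ => ?_
  rw [Measure.smul_apply, smul_eq_mul]
  refine mul_le_of_le_one_left' (ENNReal.ofReal_le_one.2 ?_)
  rw [abs_inv, abs_of_nonneg (by positivity)]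
  exact inv_le_one_of_one_le₀ (one_le_pow₀ hη)

theorem PairBounded.mono {lam lam' : ℝ} (h0 : 0 ≤ lam) (h : lam ≤ lam') {w : Config d N → ℝ}
    {a b : Fin N} (hw : PairBounded lam w a b) : PairBounded lam' w a b := fun f =>
  (hw f).trans (mul_le_mul_of_nonneg_right (pow_le_pow_left₀ h0 h 2)
    (weightSq_nonneg (fun ξ => (mul_pos (sobSymbol_pos a ξ) (sobSymbol_pos b ξ)).le) f))

theorem fderiv_const_mul_comp_tripleMap {U : Pos d × Pos d → ℝ} (hU : ContDiff ℝ ∞ U) (κ η : ℝ)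
    (i j l : Fin N) (x y : Config d N) :
    fderiv ℝ (fun x => κ * U (tripleMap η i j l x)) x y =
      κ * fderiv ℝ U (tripleMap η i j l x) (tripleMap η i j l y) := by
  have h := ((hU.differentiable (by simp) _).hasFDerivAt.comp x
    (tripleMap η i j l).hasFDerivAt).const_mul κ
  exact congrArg (fun T => T y) h.fderiv

/-- A uniform bound for all the regularized three-body potentials. -/
theorem MemSobolevW.exists_regularInteraction (hd : d = 1 ∨ d = 2) {p : ℝ≥0∞}
    (hp : 2 * (d : ℝ≥0∞) ≤ p) {V : Pos d × Pos d → ℝ} (hV0 : ∀ᵐ z, 0 ≤ V z)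
    (hV : MemSobolevW p 2 V) :
    ∃ C : ℝ, 0 ≤ C ∧ ∀ (N : ℕ) (η κ : ℝ), 1 ≤ η → 0 ≤ κ → ∀ i j l : Fin N, i ≠ j → i ≠ l → j ≠ l →
      ∀ ρ : Pos d × Pos d → ℝ, IsMollifier ρ →
        RegularInteraction (C * κ * η ^ 2) (fun x => κ * mollify ρ V (tripleMap η i j l x))
          {i, j, l} := by
  classical
  obtain ⟨C, hC0, hC⟩ := exists_pairBounded hd hp
  have hd1 : 1 ≤ d := by omega
  have h2d : (1 : ℝ≥0∞) ≤ 2 * d := by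
    calc (1 : ℝ≥0∞) ≤ 2 * 1 := by norm_num
      _ ≤ 2 * d := by gcongr; exact_mod_cast hd1
  have hp1 : 1 ≤ p := h2d.trans hp
  have hfin : (Module.finrank ℝ (Pos d × Pos d) : ℝ≥0∞) ≤ p := by
    refine le_trans (le_of_eq ?_) hp
    simp [two_mul]
  obtain ⟨M, hM⟩ := hV.exists_ae_abs_le hp1 hfin
  have hVl : LocallyIntegrable V volume := hV.memLp.locallyIntegrable hp1
  -- Only derivatives in the directions `tripleDir` occur: these are the motions of the relative
  -- positions caused by one particle. K does not depend on the mollifier.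
  obtain ⟨K, hK, hKb⟩ := hV.exists_eLpNorm_mollify_le hp1
    (Finset.univ.image fun rc : Fin 3 × Fin d => tripleDir rc.1 rc.2)
  have hmem : ∀ (r : Fin 3) (c : Fin d), tripleDir r c ∈
      Finset.univ.image fun rc : Fin 3 × Fin d => tripleDir rc.1 rc.2 := fun r c =>
    Finset.mem_image_of_mem (fun rc : Fin 3 × Fin d => tripleDir rc.1 rc.2)
      (Finset.mem_univ (r, c))
  refine ⟨C * K.toReal, by positivity, fun N η κ hη hκ i j l hij hil hjl ρ hρ => ?_⟩
  obtain ⟨-, hK1, hK2⟩ := hKb ρ hρ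
  have hη0 : 0 ≤ η := by linarith
  have hUg : Function.HasTemperateGrowth (mollify ρ V) := hρ.hasTemperateGrowth_mollify hVl hM
  have hgrow : ∀ {W : Pos d × Pos d → ℝ}, Function.HasTemperateGrowth W → ∀ κ : ℝ,
      Function.HasTemperateGrowth fun x : Config d N => κ * W (tripleMap η i j l x) :=
    fun hW κ => (Function.HasTemperateGrowth.const κ).mul
      (hW.comp (tripleMap η i j l).hasTemperateGrowth)
  have hd' : ∀ {W : Pos d × Pos d → ℝ}, Function.HasTemperateGrowth W → ∀ v,
      Function.HasTemperateGrowth (dirDeriv v W) := fun hW v => hasTemperateGrowth_fderiv_apply hW v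
  -- The chain rule: each derivative in a coordinate of a particle of the triple produces one factor
  -- η.
  have hpart : ∀ {W : Pos d × Pos d → ℝ}, Function.HasTemperateGrowth W → ∀ κ : ℝ, ∀ m ∈ ({i, j, l} : Finset (Fin N)),
      ∃ r, ∀ c, partialFun m (some c) (fun x : Config d N => κ * W (tripleMap η i j l x)) =
        fun x => (κ * η) * dirDeriv (tripleDir r c) W (tripleMap η i j l x) := by
    intro W hW κ m hm
    obtain ⟨r, hr⟩ := tripleMap_coordVec (d := d) hij hil hjl η hm
    refine ⟨r, fun c => funext fun x => ?_⟩
    refine (fderiv_const_mul_comp_tripleMap hW.1 κ η i j l x _).trans ?_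
    rw [hr, map_smul, smul_eq_mul, mul_assoc]
    rfl
  have hbound : ∀ {W : Pos d × Pos d → ℝ}, Function.HasTemperateGrowth W →
      eLpNorm W p volume ≤ K → ∀ κ : ℝ, 0 ≤ κ → ∀ a ∈ ({i, j, l} : Finset (Fin N)),
      ∀ b ∈ ({i, j, l} : Finset (Fin N)), a ≠ b →
        PairBounded (C * (κ * K.toReal)) (fun x => κ * W (tripleMap η i j l x)) a b := by
    intro W hW hWK κ hκ a ha b hb hab
    refine hC N a b _ (hgrow hW κ) _ (by positivity) fun x => ?_
    obtain ⟨A, hA, hAe⟩ := tripleMap_pairEmbed (d := d) hij hil hjl η ha hb hab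
    simp only [map_add, hAe]
    rw [ENNReal.ofReal_mul hκ, ENNReal.ofReal_toReal hK]
    refine (eLpNorm_const_smul_le (c := κ)).trans (mul_le_mul' (le_of_eq ?_) ?_)
    · rw [← ofReal_norm, Real.norm_of_nonneg hκ]
    · exact (eLpNorm_comp_add_smul_le_self hW.1.continuous p hη hA _).trans hWK
  have hκη : 0 ≤ κ * η := by positivity
  refine ⟨hgrow hUg κ, fun x => mul_nonneg hκ (hρ.mollify_nonneg hV0 _), by positivity, ?_, ?_, ?_⟩
  · rintro m hm (_ | c)
    · rfl
    · funext x
      refine (fderiv_const_mul_comp_tripleMap hUg.1 κ η i j l x _).trans ?_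
      rw [tripleMap_coordVec_eq_zero hm, map_zero, mul_zero]
  · rintro a ha b hb hab (_ | c)
    · exact PairBounded.zero _ _ _
    · obtain ⟨r, hr⟩ := hpart hUg κ a ha
      rw [hr c]
      refine (hbound (hd' hUg _) (hK1 _ (hmem r c)) (κ * η) hκη a ha b hb hab).mono (by positivity) ?_
      -- First derivatives cost only η, but the same constant has to serve the second derivatives.
      have : η ≤ η ^ 2 := by nlinarith
      calc _ = (C * K.toReal * κ) * η := by ring
        _ ≤ (C * K.toReal * κ) * η ^ 2 := by gcongr
  · rintro a ha b hb hab (_ | c) (_ | c')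
    · exact PairBounded.zero _ _ _
    · have : partialFun b (some c') (partialFun a none
          fun x : Config d N => κ * mollify ρ V (tripleMap η i j l x)) = fun _ => 0 := by
        funext x
        simp [partialFun]
      rw [this]
      exact PairBounded.zero _ _ _
    · exact PairBounded.zero _ _ _
    · obtain ⟨r, hr⟩ := hpart hUg κ a ha
      obtain ⟨r', hr'⟩ := hpart (hd' hUg (tripleDir r c)) (κ * η) b hb
      rw [hr c, hr' c']
      refine (hbound (hd' (hd' hUg _) _) (hK2 _ (hmem r c) _ (hmem r' c')) (κ * η * η)
        (by positivity) a ha b hb hab).mono (by positivity) (le_of_eq (by ring))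

end ThreeBodyBose

end

noncomputable section

namespace ThreeBodyBose

/-! ### The interaction estimate for the regularized interaction -/

open SchwartzMap

variable {d N : ℕ}

theorem weightInner_sum_weight {ι : Type*} (T : Finset ι) {w : ι → Config d N → ℝ}
    (hw : ∀ t ∈ T, Function.HasTemperateGrowth (w t)) (f g : 𝓢(Config d N, ℂ)) :
    weightInner (fun ξ => ∑ t ∈ T, w t ξ) f g = ∑ t ∈ T, weightInner (w t) f g := by
  rw [weightInner_eq_integral (Function.HasTemperateGrowth.sum hw),
    Finset.sum_congr rfl fun t ht => weightInner_eq_integral (hw t ht) f g,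
    ← integral_finsetSum _ fun t ht => integrable_weightInner (hw t ht) f g]
  refine integral_congr_ae (ae_of_all _ fun ξ => ?_)
  simp only [Complex.ofReal_sum, Finset.sum_mul]

theorem weightSq_sum_weight {ι : Type*} (T : Finset ι) {w : ι → Config d N → ℝ}
    (hw : ∀ t ∈ T, Function.HasTemperateGrowth (w t)) (f : 𝓢(Config d N, ℂ)) :
    weightSq (fun ξ => ∑ t ∈ T, w t ξ) f = ∑ t ∈ T, weightSq (w t) f := by
  simp only [weightSq]
  rw [← integral_finsetSum _ fun t ht => integrable_weightSq (hw t ht) f]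
  simp only [Finset.sum_mul]

theorem weightSq_const_mul (c : ℝ) (w : Config d N → ℝ) (f : 𝓢(Config d N, ℂ)) :
    weightSq (fun ξ => c * w ξ) f = c * weightSq w f := by
  simp only [weightSq, mul_assoc, integral_const_mul]

/-- The form `weightInner` as a linear map of its second argument. -/
def weightInnerRight (w : Config d N → ℝ) (f : 𝓢(Config d N, ℂ)) : 𝓢(Config d N, ℂ) →ₗ[ℝ] ℂ :=
  ((innerSL ℂ ((𝓕 f).toLp 2 volume)).toLinearMap ∘ₗ
      (toLpCLM ℂ ℂ 2 volume).toLinearMap).restrictScalars ℝ ∘ₗ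
    (smulLeftCLM ℂ w).toLinearMap ∘ₗ
      (fourierCLM ℂ 𝓢(Config d N, ℂ)).toLinearMap.restrictScalars ℝ

theorem weightInnerRight_apply (w : Config d N → ℝ) (f g : 𝓢(Config d N, ℂ)) :
    weightInnerRight w f g = weightInner w f g := rfl

theorem mulSchwartz_const_mul_sum {ι : Type*} (T : Finset ι) (c : ℝ) {v : ι → Config d N → ℝ}
    (hv : ∀ t ∈ T, Function.HasTemperateGrowth (v t)) (f : 𝓢(Config d N, ℂ)) :
    mulSchwartz (fun x => c * ∑ t ∈ T, v t x) f = c • ∑ t ∈ T, mulSchwartz (v t) f := by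
  ext x
  have hg : Function.HasTemperateGrowth fun x => c * ∑ t ∈ T, v t x :=
    (Function.HasTemperateGrowth.const c).mul (Function.HasTemperateGrowth.sum hv)
  rw [mulSchwartz_apply hg, smul_apply, sum_apply,
    Finset.sum_congr rfl fun t ht => mulSchwartz_apply (hv t ht) f x, ← Finset.sum_mul,
    Complex.real_smul]
  push_cast
  ring

/-- The increasing triples. -/
def triples (N : ℕ) : Finset (Fin N × Fin N × Fin N) :=
  Finset.univ.filter fun t => t.1 < t.2.1 ∧ t.2.1 < t.2.2

theorem sum_triples {M : Type*} [AddCommMonoid M] (F : Fin N → Fin N → Fin N → M) :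
    ∑ t ∈ triples N, F t.1 t.2.1 t.2.2 =
      ∑ i : Fin N, ∑ j ∈ Finset.Ioi i, ∑ l ∈ Finset.Ioi j, F i j l := by
  rw [triples, Finset.sum_filter, Fintype.sum_prod_type]
  refine Finset.sum_congr rfl fun i _ => ?_
  rw [Fintype.sum_prod_type, ← Finset.sum_subset (Finset.subset_univ (Finset.Ioi i))]
  · refine Finset.sum_congr rfl fun j hj => ?_
    rw [← Finset.sum_subset (Finset.subset_univ (Finset.Ioi j))]
    · refine Finset.sum_congr rfl fun l hl => ?_
      rw [if_pos ⟨Finset.mem_Ioi.1 hj, Finset.mem_Ioi.1 hl⟩]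
    · intro l _ hl
      rw [if_neg fun h => hl (Finset.mem_Ioi.2 h.2)]
  · intro j _ hj
    refine Finset.sum_eq_zero fun l _ => ?_
    rw [if_neg fun h => hj (Finset.mem_Ioi.2 h.1)]

theorem ne_of_mem_triples {t : Fin N × Fin N × Fin N} (ht : t ∈ triples N) :
    t.1 ≠ t.2.1 ∧ t.1 ≠ t.2.2 ∧ t.2.1 ≠ t.2.2 := by
  obtain ⟨h1, h2⟩ := (Finset.mem_filter.1 ht).2
  exact ⟨h1.ne, (h1.trans h2).ne, h2.ne⟩

theorem interaction_eq_sum_triples (β : ℝ) (V : Pos d × Pos d → ℝ) :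
    interaction N β V = fun x => 1 / (N : ℝ) ^ 2 * ∑ t ∈ triples N,
      (N : ℝ) ^ (2 * d * β) * V (tripleMap ((N : ℝ) ^ β) t.1 t.2.1 t.2.2 x) := by
  funext x
  rw [sum_triples fun i j l => (N : ℝ) ^ (2 * d * β) * V (tripleMap ((N : ℝ) ^ β) i j l x)]
  rfl

theorem hasTemperateGrowth_symWeight (k : ℕ) :
    Function.HasTemperateGrowth fun ξ : Config d N => symWeight k fun j => sobSymbol j ξ :=
  Function.HasTemperateGrowth.sum fun J _ => hasTemperateGrowth_prod_sobSymbol J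

theorem hasTemperateGrowth_symWeightSq (k : ℕ) :
    Function.HasTemperateGrowth fun ξ : Config d N => symWeightSq k fun j => sobSymbol j ξ :=
  Function.HasTemperateGrowth.sum fun J _ => (hasTemperateGrowth_prod_sobSymbol J).mul
    (Function.HasTemperateGrowth.sum fun j _ => hasTemperateGrowth_sobSymbol j)

/-- The estimate for a single J and a single triple is summed over both, and the combinatorial bound
collects the weights; 48 = 8 · 6. -/
theorem re_weightInner_symWeight_ge {lam : ℝ} (hlam : 0 ≤ lam)
    {v : Fin N × Fin N × Fin N → Config d N → ℝ}
    (hv : ∀ t ∈ triples N, RegularInteraction lam (v t) {t.1, t.2.1, t.2.2}) (hN : 1 ≤ N) {c : ℝ}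
    (hc : 0 ≤ c) (k : ℕ) (f : 𝓢(Config d N, ℂ)) :
    -(c * (48 * (d + 1) ^ 3 * (k + 2) ^ 2 * lam * N) *
        weightSq (fun ξ => symWeight (k + 2) (fun j => sobSymbol j ξ) +
          symWeightSq (k + 1) fun j => sobSymbol j ξ) f) ≤
      (weightInner (fun ξ => symWeight (k + 1) fun j => sobSymbol j ξ) f
        (mulSchwartz (fun x => c * ∑ t ∈ triples N, v t x) f)).re := by
  set P := Finset.powersetCard (k + 1) (Finset.univ : Finset (Fin N))
  have hg : ∀ J (t : Fin N × Fin N × Fin N), Function.HasTemperateGrowth fun ξ : Config d N =>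
      (∏ j ∈ J, sobSymbol j ξ) * tripleWeight (fun j => sobSymbol j ξ) J {t.1, t.2.1, t.2.2} :=
    fun J t => (hasTemperateGrowth_prod_sobSymbol J).mul (hasTemperateGrowth_tripleWeight J _)
  have e1 : weightInner (fun ξ => symWeight (k + 1) fun j => sobSymbol j ξ) f
      (mulSchwartz (fun x => c * ∑ t ∈ triples N, v t x) f) =
      c * ∑ J ∈ P, ∑ t ∈ triples N,
        weightInner (fun ξ => ∏ j ∈ J, sobSymbol j ξ) f (mulSchwartz (v t) f) := by
    simp only [symWeight]
    rw [weightInner_sum_weight P fun J _ => hasTemperateGrowth_prod_sobSymbol J, Finset.mul_sum]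
    refine Finset.sum_congr rfl fun J _ => ?_
    rw [mulSchwartz_const_mul_sum _ c fun t ht => (hv t ht).growth, ← weightInnerRight_apply,
      map_smul, map_sum, Complex.real_smul]
    rfl
  have h1 : ∀ J ∈ P, ∀ t ∈ triples N,
      -(8 * (d + 1) ^ 3 * lam * weightSq (fun ξ => (∏ j ∈ J, sobSymbol j ξ) *
        tripleWeight (fun j => sobSymbol j ξ) J {t.1, t.2.1, t.2.2}) f) ≤
      (weightInner (fun ξ => ∏ j ∈ J, sobSymbol j ξ) f (mulSchwartz (v t) f)).re :=
    fun J _ t ht => (hv t ht).re_weightInner_ge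
      (by obtain ⟨h1, h2, h3⟩ := ne_of_mem_triples ht; exact Finset.card_eq_three.2
            ⟨_, _, _, h1, h2, h3, rfl⟩) J f
  have h2 : ∑ J ∈ P, ∑ t ∈ triples N, weightSq (fun ξ => (∏ j ∈ J, sobSymbol j ξ) *
        tripleWeight (fun j => sobSymbol j ξ) J {t.1, t.2.1, t.2.2}) f ≤
      6 * (k + 2) ^ 2 * N * weightSq (fun ξ => symWeight (k + 2) (fun j => sobSymbol j ξ) +
          symWeightSq (k + 1) fun j => sobSymbol j ξ) f := by
    rw [← weightSq_const_mul, Finset.sum_congr rfl fun J _ =>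
      (weightSq_sum_weight (triples N) (fun t _ => hg J t) f).symm, ← weightSq_sum_weight P
        fun J _ => Function.HasTemperateGrowth.sum fun t _ => hg J t]
    refine weightSq_mono (Function.HasTemperateGrowth.sum fun J _ =>
      Function.HasTemperateGrowth.sum fun t _ => hg J t)
      ((Function.HasTemperateGrowth.const _).mul ((hasTemperateGrowth_symWeight _).add
        (hasTemperateGrowth_symWeightSq _))) (fun ξ => ?_) f
    refine le_trans (le_of_eq (Finset.sum_congr rfl fun J _ => ?_))
      (sum_prod_mul_tripleWeight_le (fun j => (sobSymbol_pos j ξ).le) k hN)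
    exact sum_triples fun i j l => (∏ a ∈ J, sobSymbol a ξ) *
      tripleWeight (fun j => sobSymbol j ξ) J {i, j, l}
  have h3 := Finset.sum_le_sum fun J hJ => Finset.sum_le_sum fun t ht => h1 J hJ t ht
  simp only [Finset.sum_neg_distrib, ← Finset.mul_sum] at h3
  rw [e1, Complex.re_ofReal_mul, Complex.re_sum, Finset.sum_congr rfl fun J _ => Complex.re_sum _ _]
  have h4 : 0 ≤ 8 * ((d : ℝ) + 1) ^ 3 * lam := by positivity
  nlinarith [mul_le_mul_of_nonneg_left (mul_le_mul_of_nonneg_left h2 h4) hc,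
    mul_le_mul_of_nonneg_left h3 hc]

end ThreeBodyBose

end

noncomputable section

namespace ThreeBodyBose

/-! ### Bounded multiplication operators -/

section BoundedMul

variable {X : Type*} [MeasureSpace X]

theorem memLp_top_ofReal {b : X → ℝ} (hb : MemLp b ⊤ volume) :
    MemLp (fun x => (b x : ℂ)) ⊤ (volume : Measure X) :=
  memLp_top_of_bound (C := (eLpNorm b ⊤ volume).toReal)
    (Complex.continuous_ofReal.comp_aestronglyMeasurable hb.1) (by
      filter_upwards [ae_le_eLpNormEssSup (f := b) (μ := volume)] with x hx
      rw [Complex.norm_real, ← toReal_enorm]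
      exact ENNReal.toReal_mono hb.2.ne (by rwa [eLpNorm_exponent_top]))

/-- Multiplication by a bounded real function on `L²`. -/
def boundedMul {b : X → ℝ} (hb : MemLp b ⊤ volume) :
    Lp ℂ 2 (volume : Measure X) →L[ℂ] Lp ℂ 2 (volume : Measure X) :=
  (ContinuousLinearMap.mul ℂ ℂ).holderL volume ⊤ 2 2 ((memLp_top_ofReal hb).toLp _)

theorem coeFn_boundedMul {b : X → ℝ} (hb : MemLp b ⊤ volume)
    (f : Lp ℂ 2 (volume : Measure X)) : boundedMul hb f =ᵐ[volume] fun x => (b x : ℂ) * f x := by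
  refine ((ContinuousLinearMap.mul ℂ ℂ).coeFn_holder (r := 2) _ f).trans ?_
  filter_upwards [(memLp_top_ofReal hb).coeFn_toLp] with x hx
  rw [hx]
  rfl

theorem inner_eq_integral (f g : Lp ℂ 2 (volume : Measure X)) :
    inner ℂ f g = ∫ x, starRingEnd ℂ (f x) * g x := by
  rw [L2.inner_def]
  simp only [RCLike.inner_apply, mul_comm]

theorem integrable_inner (f g : Lp ℂ 2 (volume : Measure X)) :
    Integrable fun x => starRingEnd ℂ (f x) * g x := by
  refine (L2.integrable_inner (𝕜 := ℂ) f g).congr (ae_of_all _ fun x => ?_)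
  simp only [RCLike.inner_apply, mul_comm]

end BoundedMul

/-! ### The interaction estimate for the interaction -/

open SchwartzMap

variable {d N : ℕ}

/-- Multiplication by a bounded function of the position, in the Fourier representation. -/
def fourierMul {v : Config d N → ℝ} (hv : MemLp v ⊤ volume) : Wave d N →L[ℂ] Wave d N :=
  ((Lp.fourierTransformₗᵢ (Config d N) ℂ).toContinuousLinearEquiv : Wave d N →L[ℂ] Wave d N) ∘L
    boundedMul hv ∘L
    ((Lp.fourierTransformₗᵢ (Config d N) ℂ).symm.toContinuousLinearEquiv : Wave d N →L[ℂ] Wave d N)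

theorem fourierMul_apply {v : Config d N → ℝ} (hv : MemLp v ⊤ volume) (u : Wave d N) :
    fourierMul hv u = 𝓕 (boundedMul hv (𝓕⁻ u)) := rfl

theorem inner_toLp_fourierMul {v : Config d N → ℝ} (hv : MemLp v ⊤ volume)
    (g f : 𝓢(Config d N, ℂ)) :
    inner ℂ ((𝓕 g).toLp 2 volume : Wave d N) (fourierMul hv ((𝓕 f).toLp 2 volume)) =
      ∫ x, starRingEnd ℂ (g x) * ((v x : ℂ) * f x) := by
  rw [fourierMul_apply, ← toLp_fourier_eq, ← toLp_fourier_eq, fourierInv_fourier_eq,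
    Lp.inner_fourier_eq, inner_eq_integral]
  refine integral_congr_ae ?_
  filter_upwards [coeFn_boundedMul hv (f.toLp 2 volume), f.coeFn_toLp 2 volume,
    g.coeFn_toLp 2 volume] with x h1 h2 h3
  rw [h1, h2, h3]

/-- Convergence of the interaction energies of Schwartz functions. -/
theorem tendsto_integral_conj_mul {v : Config d N → ℝ} {vn : ℕ → Config d N → ℝ}
    (hvn : ∀ n, Continuous (vn n)) {M : ℝ} (hM : ∀ n x, |vn n x| ≤ M)
    (hlim : ∀ᵐ x, Filter.Tendsto (fun n => vn n x) Filter.atTop (nhds (v x)))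
    (g f : 𝓢(Config d N, ℂ)) :
    Filter.Tendsto (fun n => ∫ x, starRingEnd ℂ (g x) * ((vn n x : ℂ) * f x)) Filter.atTop
      (nhds (∫ x, starRingEnd ℂ (g x) * ((v x : ℂ) * f x))) := by
  refine tendsto_integral_of_dominated_convergence
    (fun x => M * ‖starRingEnd ℂ (g x) * f x‖) (fun n => ?_)
    ((integrable_conj_mul g f).norm.const_mul M) (fun n => ae_of_all _ fun x => ?_) ?_
  · have h1 := g.continuous
    have h2 := f.continuous
    have h3 := hvn n
    have h4 := Complex.continuous_conj
    exact (by fun_prop : Continuous fun x =>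
      starRingEnd ℂ (g x) * ((vn n x : ℂ) * f x)).aestronglyMeasurable
  · rw [mul_left_comm, norm_mul, Complex.norm_real]
    exact mul_le_mul_of_nonneg_right (hM n x) (norm_nonneg _)
  · filter_upwards [hlim] with x hx
    exact ((Complex.continuous_ofReal.tendsto _).comp hx |>.mul_const _).const_mul _

/-- The weight is moved to the left factor, so that v enters only as a pointwise factor and limits
in v can be taken. -/
theorem weightInner_eq_integral_fourierInv {w v : Config d N → ℝ}
    (hw : Function.HasTemperateGrowth w) (hv : Function.HasTemperateGrowth v)
    (f : 𝓢(Config d N, ℂ)) :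
    weightInner w f (mulSchwartz v f) =
      ∫ x, starRingEnd ℂ (𝓕⁻ (mulSchwartz w (𝓕 f)) x) * ((v x : ℂ) * f x) := by
  have h1 : weightInner w f (mulSchwartz v f) =
      schwartzInner (mulSchwartz w (𝓕 f)) (𝓕 (mulSchwartz v f)) := by
    rw [weightInner, schwartzInner_eq_integral, schwartzInner_eq_integral]
    refine integral_congr_ae (ae_of_all _ fun ξ => ?_)
    simp only [mulSchwartz_apply hw, map_mul, Complex.conj_ofReal]
    ring
  have h2 : mulSchwartz w (𝓕 f) = 𝓕 (𝓕⁻ (mulSchwartz w (𝓕 f)) : 𝓢(Config d N, ℂ)) :=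
    (fourier_fourierInv_eq _).symm
  rw [h1, h2, schwartzInner_fourier, ← h2, schwartzInner_eq_integral]
  simp only [mulSchwartz_apply hv]

theorem tripleMap_surjective {η : ℝ} (hη : η ≠ 0) {i j l : Fin N} (hij : i ≠ j) (hil : i ≠ l)
    (hjl : j ≠ l) : Function.Surjective (tripleMap η i j l : Config d N →L[ℝ] Pos d × Pos d) := by
  intro z
  refine ⟨pairEmbed j l (-(η⁻¹ • z)), ?_⟩
  rw [map_neg, map_smul, map_neg, map_smul, tripleMap_apply]
  simp [particle_pairEmbed, hij, hil, hjl, hjl.symm, smul_smul, hη]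

/-- A surjective linear map sends Lebesgue measure to a multiple, possibly infinite, of Lebesgue
measure. Hence almost everywhere statements about V become such statements about the interaction. -/
theorem quasiMeasurePreserving_tripleMap {η : ℝ} (hη : η ≠ 0) {i j l : Fin N} (hij : i ≠ j)
    (hil : i ≠ l) (hjl : j ≠ l) : Measure.QuasiMeasurePreserving
      (tripleMap η i j l : Config d N →L[ℝ] Pos d × Pos d) volume volume := by
  refine ⟨(tripleMap η i j l).measurable, ?_⟩
  obtain ⟨c, -, hc⟩ := LinearMap.exists_map_addHaar_eq_smul_addHaar
    (tripleMap η i j l : Config d N →L[ℝ] Pos d × Pos d).toLinearMap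
    (volume : Measure (Config d N)) (volume : Measure (Pos d × Pos d))
    (tripleMap_surjective hη hij hil hjl)
  exact (show Measure.map (tripleMap η i j l) volume = _ from hc) ▸
    Measure.smul_absolutelyContinuous

theorem memLp_top_interaction (hN : 1 ≤ N) (β : ℝ) {V : Pos d × Pos d → ℝ}
    (hVm : AEStronglyMeasurable V volume) {M : ℝ} (hM : ∀ᵐ z, |V z| ≤ M) :
    MemLp (interaction N β V) ⊤ volume := by
  have hη : (N : ℝ) ^ β ≠ 0 := (Real.rpow_pos_of_pos (by exact_mod_cast hN) β).ne'
  have h : ∀ t ∈ triples N,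
      MemLp (fun x : Config d N => V (tripleMap ((N : ℝ) ^ β) t.1 t.2.1 t.2.2 x)) ⊤ volume := by
    intro t ht
    obtain ⟨h1, h2, h3⟩ := ne_of_mem_triples ht
    have hq := quasiMeasurePreserving_tripleMap (d := d) hη h1 h2 h3
    exact memLp_top_of_bound (hVm.comp_quasiMeasurePreserving hq) M (hq.ae hM)
  rw [interaction_eq_sum_triples]
  exact (memLp_finsetSum _ fun t ht => (h t ht).const_mul _).const_mul _

theorem tendsto_interaction (hN : 1 ≤ N) (β : ℝ) {V : Pos d × Pos d → ℝ}
    {Vn : ℕ → Pos d × Pos d → ℝ}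
    (h : ∀ᵐ z, Filter.Tendsto (fun n => Vn n z) Filter.atTop (nhds (V z))) :
    ∀ᵐ x : Config d N, Filter.Tendsto (fun n => interaction N β (Vn n) x) Filter.atTop
      (nhds (interaction N β V x)) := by
  have hη : (N : ℝ) ^ β ≠ 0 := (Real.rpow_pos_of_pos (by exact_mod_cast hN) β).ne'
  simp only [interaction_eq_sum_triples]
  have h' : ∀ t ∈ triples N, ∀ᵐ x : Config d N, Filter.Tendsto
      (fun n => Vn n (tripleMap ((N : ℝ) ^ β) t.1 t.2.1 t.2.2 x)) Filter.atTop
      (nhds (V (tripleMap ((N : ℝ) ^ β) t.1 t.2.1 t.2.2 x))) := fun t ht => by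
    obtain ⟨h1, h2, h3⟩ := ne_of_mem_triples ht
    exact (quasiMeasurePreserving_tripleMap (d := d) hη h1 h2 h3).ae h
  have h'' := (Filter.eventually_all_finset (triples N)).2 h'
  filter_upwards [h''] with x hx
  exact (tendsto_finsetSum _ fun t ht => (hx t ht).const_mul _).const_mul _

end ThreeBodyBose

end

/-! ### From mollified to rough potentials, and from Schwartz to band-limited functions -/

noncomputable section

namespace ThreeBodyBose

open SchwartzMap

variable {d N : ℕ}

/-- The weight of the quadratic form bounding the interaction. -/
def errorWeight (k : ℕ) (ξ : Config d N) : ℝ :=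
  symWeight (k + 2) (fun j => sobSymbol j ξ) + symWeightSq (k + 1) fun j => sobSymbol j ξ

theorem hasTemperateGrowth_errorWeight (k : ℕ) :
    Function.HasTemperateGrowth (errorWeight k : Config d N → ℝ) :=
  (hasTemperateGrowth_symWeight _).add (hasTemperateGrowth_symWeightSq _)

theorem inner_toLp_eq_weightInner {w v : Config d N → ℝ} (hv : MemLp v ⊤ volume) (f : 𝓢(Config d N, ℂ)) :
    inner ℂ ((mulSchwartz w (𝓕 f)).toLp 2 volume : Wave d N)
        (fourierMul hv ((𝓕 f).toLp 2 volume)) =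
      ∫ x, starRingEnd ℂ (𝓕⁻ (mulSchwartz w (𝓕 f)) x) * ((v x : ℂ) * f x) := by
  have h2 : mulSchwartz w (𝓕 f) = 𝓕 (𝓕⁻ (mulSchwartz w (𝓕 f)) : 𝓢(Config d N, ℂ)) :=
    (fourier_fourierInv_eq _).symm
  rw [h2, inner_toLp_fourierMul, ← h2]

/-- The estimate holds for each mollified potential with the same constant. V is essentially
bounded, so the mollified interactions are uniformly bounded and dominated convergence applies. -/
theorem MemSobolevW.exists_re_inner_fourierMul_schwartz_ge (hd : d = 1 ∨ d = 2) {p : ℝ≥0∞}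
    (hp : 2 * (d : ℝ≥0∞) ≤ p) {β : ℝ} (hβ : 0 ≤ β) {V : Pos d × Pos d → ℝ}
    (hV0 : ∀ᵐ z, 0 ≤ V z) (hV : MemSobolevW p 2 V) :
    ∃ C : ℝ, 0 ≤ C ∧ ∀ N : ℕ, 1 ≤ N → ∃ hv : MemLp (interaction N β V) ⊤ volume,
      ∀ (k : ℕ) (f : 𝓢(Config d N, ℂ)),
      -(C * (k + 2) ^ 2 * ((N : ℝ) ^ (2 * d * β) * ((N : ℝ) ^ β) ^ 2 / N) *
        weightSq (errorWeight k) f) ≤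
      (inner ℂ ((mulSchwartz (fun ξ => symWeight (k + 1) fun j => sobSymbol j ξ)
        (𝓕 f)).toLp 2 volume : Wave d N) (fourierMul hv ((𝓕 f).toLp 2 volume))).re := by
  obtain ⟨C, hC0, hC⟩ := hV.exists_regularInteraction hd hp hV0
  have hd1 : 1 ≤ d := by omega
  have h2d : (1 : ℝ≥0∞) ≤ 2 * d := by
    calc (1 : ℝ≥0∞) ≤ 2 * 1 := by norm_num
      _ ≤ 2 * d := by gcongr; exact_mod_cast hd1
  have hp1 : 1 ≤ p := h2d.trans hp
  have hfin : (Module.finrank ℝ (Pos d × Pos d) : ℝ≥0∞) ≤ p := by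
    refine le_trans (le_of_eq ?_) hp
    simp [two_mul]
  obtain ⟨M, hM⟩ := hV.exists_ae_abs_le hp1 hfin
  have hVl : LocallyIntegrable V volume := hV.memLp.locallyIntegrable hp1
  obtain ⟨ρ, hρ, hρlim⟩ := exists_isMollifier_seq (Y := Pos d × Pos d)
  refine ⟨48 * (d + 1) ^ 3 * C, by positivity, fun N hN => ?_⟩
  have hv := memLp_top_interaction hN β hV.memLp.1 hM
  refine ⟨hv, fun k f => ?_⟩
  have hN' : (1 : ℝ) ≤ N := by exact_mod_cast hN
  have hη : 1 ≤ (N : ℝ) ^ β := Real.one_le_rpow hN' hβ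
  have hκ : 0 ≤ (N : ℝ) ^ (2 * d * β) := by positivity
  have hreg : ∀ n, ∀ t ∈ triples N, RegularInteraction (C * (N : ℝ) ^ (2 * d * β) * ((N : ℝ) ^ β) ^ 2)
      (fun x => (N : ℝ) ^ (2 * d * β) * mollify (ρ n) V (tripleMap ((N : ℝ) ^ β) t.1 t.2.1 t.2.2 x))
      {t.1, t.2.1, t.2.2} := fun n t ht => by
    obtain ⟨h1, h2, h3⟩ := ne_of_mem_triples ht
    exact hC N _ _ hη hκ _ _ _ h1 h2 h3 (ρ n) (hρ n)
  have hgr : ∀ n, Function.HasTemperateGrowth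
      (interaction N β (mollify (ρ n) V) : Config d N → ℝ) := fun n => by
    rw [interaction_eq_sum_triples]
    exact (Function.HasTemperateGrowth.const _).mul
      (Function.HasTemperateGrowth.sum fun t ht => (hreg n t ht).growth)
  have hbd : ∀ n x, |interaction N β (mollify (ρ n) V) (x : Config d N)| ≤
      1 / (N : ℝ) ^ 2 * ∑ t ∈ triples N, (N : ℝ) ^ (2 * d * β) * M := fun n x => by
    rw [interaction_eq_sum_triples, abs_mul, abs_of_nonneg (by positivity)]
    refine mul_le_mul_of_nonneg_left ((Finset.abs_sum_le_sum_abs _ _).trans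
      (Finset.sum_le_sum fun t _ => ?_)) (by positivity)
    rw [abs_mul, abs_of_nonneg hκ]
    exact mul_le_mul_of_nonneg_left ((hρ n).abs_mollify_le hM _) hκ
  have hlim := tendsto_integral_conj_mul (fun n => (hgr n).1.continuous) hbd
    (tendsto_interaction hN β (hρlim V hVl))
    (𝓕⁻ (mulSchwartz (fun ξ => symWeight (k + 1) fun j => sobSymbol j ξ) (𝓕 f))) f
  rw [inner_toLp_eq_weightInner]
  refine ge_of_tendsto' ((Complex.continuous_re.tendsto _).comp hlim) fun n => ?_
  -- The prefactor N^(-2) of the interaction against the factor N from the sum over triples leaves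
  -- 1/N.
  have h := re_weightInner_symWeight_ge (by positivity) (hreg n) hN
    (by positivity : 0 ≤ 1 / (N : ℝ) ^ 2) k f
  have e := interaction_eq_sum_triples (N := N) β (mollify (ρ n) V)
  rw [← e, weightInner_eq_integral_fourierInv (hasTemperateGrowth_symWeight _) (hgr n)] at h
  refine le_trans (le_of_eq ?_) h
  have : (N : ℝ) ≠ 0 := by positivity
  change _ = -(_ * weightSq (errorWeight k) f)
  field_simp

theorem boundedMul_toLp {b : Config d N → ℝ} (hb : MemLp b ⊤ volume)
    (hg : Function.HasTemperateGrowth b) (f : 𝓢(Config d N, ℂ)) :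
    boundedMul hb (f.toLp 2 volume) = (mulSchwartz b f).toLp 2 volume := by
  refine Lp.ext ?_
  filter_upwards [coeFn_boundedMul hb (f.toLp 2 volume), f.coeFn_toLp 2 volume,
    (mulSchwartz b f).coeFn_toLp 2 volume] with x h1 h2 h3
  rw [h1, h2, h3, mulSchwartz_apply hg]

/-- The function vanishes outside of the ball of radius `R`. -/
def IsBandLimited (R : ℝ) (u : Wave d N) : Prop := ∀ᵐ ξ, R < ‖ξ‖ → u ξ = 0

theorem IsBandLimited.integrable {R : ℝ} {u : Wave d N} (hu : IsBandLimited R u)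
    {w : Config d N → ℝ} (hw : Continuous w) (v : Wave d N) :
    Integrable fun ξ => (w ξ : ℂ) * (starRingEnd ℂ (u ξ) * v ξ) := by
  obtain ⟨M, hM⟩ := (isCompact_closedBall (0 : Config d N) R).exists_bound_of_continuousOn
    hw.continuousOn
  refine ((integrable_inner u v).norm.const_mul M).mono'
    ((Complex.continuous_ofReal.comp hw).aestronglyMeasurable.mul
      (integrable_inner u v).aestronglyMeasurable) ?_
  filter_upwards [hu] with ξ hξ
  rcases le_or_gt ‖ξ‖ R with h | h
  · rw [norm_mul, Complex.norm_real]
    exact mul_le_mul_of_nonneg_right (hM ξ (by simpa using h)) (norm_nonneg _)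
  · simp [hξ h]

theorem IsBandLimited.integrable_sq {R : ℝ} {u : Wave d N} (hu : IsBandLimited R u)
    {w : Config d N → ℝ} (hw : Continuous w) : Integrable fun ξ => w ξ * ‖u ξ‖ ^ 2 := by
  refine (hu.integrable hw u).re.congr (ae_of_all _ fun ξ => ?_)
  beta_reduce
  rw [← Complex.normSq_eq_conj_mul_self, ← Complex.ofReal_mul, Complex.normSq_eq_norm_sq]
  rfl

/-- The interaction estimate passes from Schwartz functions to band-limited functions. -/
theorem IsBandLimited.re_integral_ge {T : Wave d N →L[ℂ] Wave d N} {E W : Config d N → ℝ}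
    (hE : Function.HasTemperateGrowth E) (hW : Function.HasTemperateGrowth W)
    (h : ∀ f : 𝓢(Config d N, ℂ), -(∫ ξ, W ξ * ‖f ξ‖ ^ 2) ≤
      (inner ℂ ((mulSchwartz E f).toLp 2 volume : Wave d N) (T (f.toLp 2 volume))).re)
    {R : ℝ} {u : Wave d N} (hu : IsBandLimited R u) :
    -(∫ ξ, W ξ * ‖u ξ‖ ^ 2) ≤ ∫ ξ, E ξ * (starRingEnd ℂ (u ξ) * (T u) ξ).re := by
  -- A cutoff equal to 1 on the ball of radius R, where u lives; it makes the weights bounded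
  -- without changing u.
  let χ : ContDiffBump (0 : Config d N) := ⟨|R| + 1, |R| + 2, by positivity, by linarith⟩
  have hχ : Function.HasTemperateGrowth χ :=
    χ.hasCompactSupport.hasTemperateGrowth χ.contDiff
  have hmem : ∀ {w : Config d N → ℝ}, Function.HasTemperateGrowth w →
      MemLp (fun ξ => w ξ * χ ξ) ⊤ volume := fun {w} hw => by
    obtain ⟨M, hM⟩ := (χ.hasCompactSupport.mul_left (f := w)).exists_bound_of_continuous
      (hw.1.continuous.mul χ.continuous)
    exact memLp_top_of_bound (hw.1.continuous.mul χ.continuous).aestronglyMeasurable M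
      (ae_of_all _ hM)
  have h1 := Function.HasTemperateGrowth.const (E := Config d N) (1 : ℝ)
  -- With the cutoff inserted, both sides are continuous in a for the L² norm, so Schwartz functions
  -- suffice by density.
  have key : ∀ a : Wave d N, -(inner ℂ (boundedMul (hmem hW) a) (boundedMul (hmem h1) a)).re ≤
      (inner ℂ (boundedMul (hmem hE) a) (T (boundedMul (hmem h1) a))).re := by
    intro a
    refine DenseRange.induction_on (denseRange_toLpCLM (F := ℂ) (E := Config d N)
      (μ := volume) (p := 2) ENNReal.ofNat_ne_top) a ?_ fun f => ?_
    · refine isClosed_le (Complex.continuous_re.comp ?_).neg (Complex.continuous_re.comp ?_)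
      · exact (boundedMul (hmem hW)).continuous.inner (boundedMul (hmem h1)).continuous
      · exact (boundedMul (hmem hE)).continuous.inner
          (T.continuous.comp (boundedMul (hmem h1)).continuous)
    · have hmul : ∀ {w : Config d N → ℝ}, Function.HasTemperateGrowth w →
          Function.HasTemperateGrowth fun ξ => w ξ * χ ξ := fun hw => hw.mul hχ
      have hg := hmul h1
      change -(inner ℂ (boundedMul (hmem hW) (f.toLp 2 volume))
        (boundedMul (hmem h1) (f.toLp 2 volume))).re ≤
        (inner ℂ (boundedMul (hmem hE) (f.toLp 2 volume))
          (T (boundedMul (hmem h1) (f.toLp 2 volume)))).re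
      rw [boundedMul_toLp _ (hmul hW), boundedMul_toLp _ (hmul hE), boundedMul_toLp _ hg]
      set g := mulSchwartz (fun ξ => (1 : ℝ) * χ ξ) f with hgdef
      have e1 : ∀ {w : Config d N → ℝ}, Function.HasTemperateGrowth w →
          mulSchwartz (fun ξ => w ξ * χ ξ) f = mulSchwartz w g := fun {w} hw => by
        ext ξ
        rw [mulSchwartz_apply (hmul hw), mulSchwartz_apply hw, hgdef, mulSchwartz_apply hg]
        push_cast
        ring
      rw [e1 hW, e1 hE]
      refine le_trans (le_of_eq ?_) (h g)
      have h4 := schwartzInner_eq_integral (mulSchwartz W g) g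
      have h5 := integrable_conj_mul (mulSchwartz W g) g
      rw [schwartzInner] at h4
      rw [h4, ← RCLike.re_eq_complex_re, ← integral_re h5]
      congr 1
      refine integral_congr_ae (ae_of_all _ fun ξ => ?_)
      beta_reduce
      rw [RCLike.re_eq_complex_re, mulSchwartz_apply hW, map_mul (starRingEnd ℂ),
        Complex.conj_ofReal, mul_assoc, Complex.re_ofReal_mul, ← Complex.normSq_eq_conj_mul_self,
        Complex.normSq_eq_norm_sq, Complex.ofReal_re]
  have e : ∀ {w : Config d N → ℝ} (hw : Function.HasTemperateGrowth w),
      boundedMul (hmem hw) u =ᵐ[volume] fun ξ => (w ξ : ℂ) * u ξ := fun {w} hw => by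
    filter_upwards [coeFn_boundedMul (hmem hw) u, hu] with ξ h2 h3
    rw [h2]
    rcases le_or_gt ‖ξ‖ R with h | h
    · have : χ ξ = 1 := χ.one_of_mem_closedBall (by
        rw [mem_closedBall_zero_iff]
        exact h.trans ((le_abs_self R).trans (by simp [χ])))
      rw [this, mul_one]
    · rw [h3 h, mul_zero, mul_zero]
  have e1 : boundedMul (hmem h1) u = u := Lp.ext (by
    filter_upwards [e h1] with ξ h2
    rw [h2, Complex.ofReal_one, one_mul])
  have e2 : ∀ {w : Config d N → ℝ} (hw : Function.HasTemperateGrowth w) (v : Wave d N),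
      (inner ℂ (boundedMul (hmem hw) u) v).re = ∫ ξ, w ξ * (starRingEnd ℂ (u ξ) * v ξ).re := by
    intro w hw v
    rw [inner_eq_integral, ← RCLike.re_eq_complex_re, ← integral_re (integrable_inner _ _)]
    refine integral_congr_ae ?_
    filter_upwards [e hw] with ξ h2
    rw [h2, RCLike.re_eq_complex_re, map_mul (starRingEnd ℂ), Complex.conj_ofReal, mul_assoc,
      Complex.re_ofReal_mul]
  have h3 := key u
  rw [e1, e2 hW, e2 hE] at h3
  refine le_trans (le_of_eq ?_) h3
  congr 1
  refine integral_congr_ae (ae_of_all _ fun ξ => ?_)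
  beta_reduce
  rw [← Complex.normSq_eq_conj_mul_self, Complex.normSq_eq_norm_sq, Complex.ofReal_re]

end ThreeBodyBose

end

noncomputable section

namespace ThreeBodyBose

/-! ### The truncated Hamiltonians -/

section BoundedMul

variable {X : Type*} [MeasureSpace X]

theorem inner_boundedMul_left {b : X → ℝ} (hb : MemLp b ⊤ volume)
    (f g : Lp ℂ 2 (volume : Measure X)) :
    inner ℂ (boundedMul hb f) g = inner ℂ f (boundedMul hb g) := by
  rw [inner_eq_integral, inner_eq_integral]
  refine integral_congr_ae ?_
  filter_upwards [coeFn_boundedMul hb f, coeFn_boundedMul hb g] with x h1 h2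
  rw [h1, h2, map_mul, Complex.conj_ofReal]
  ring

theorem re_inner_boundedMul {b : X → ℝ} (hb : MemLp b ⊤ volume)
    (f : Lp ℂ 2 (volume : Measure X)) :
    (inner ℂ f (boundedMul hb f)).re = ∫ x, b x * ‖f x‖ ^ 2 := by
  rw [inner_eq_integral, ← RCLike.re_eq_complex_re, ← integral_re (integrable_inner _ _)]
  refine integral_congr_ae ?_
  filter_upwards [coeFn_boundedMul hb f] with x h1
  rw [h1, RCLike.re_eq_complex_re, mul_left_comm, Complex.re_ofReal_mul,
    ← Complex.normSq_eq_conj_mul_self, Complex.normSq_eq_norm_sq, Complex.ofReal_re]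

theorem re_inner_boundedMul_nonneg {b : X → ℝ} (hb : MemLp b ⊤ volume) (hb0 : ∀ᵐ x, 0 ≤ b x)
    (f : Lp ℂ 2 (volume : Measure X)) : 0 ≤ (inner ℂ f (boundedMul hb f)).re := by
  rw [re_inner_boundedMul]
  refine integral_nonneg_of_ae ?_
  filter_upwards [hb0] with x hx
  exact mul_nonneg hx (sq_nonneg _)

end BoundedMul

variable {d N : ℕ}

theorem re_inner_fourierMul_nonneg {v : Config d N → ℝ} (hv : MemLp v ⊤ volume)
    (hv0 : ∀ᵐ x, 0 ≤ v x) (u : Wave d N) : 0 ≤ (inner ℂ u (fourierMul hv u)).re := by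
  have h : u = 𝓕 (𝓕⁻ u : Wave d N) := (fourier_fourierInv_eq u).symm
  rw [fourierMul_apply]
  nth_rw 1 [h]
  rw [Lp.inner_fourier_eq]
  exact re_inner_boundedMul_nonneg hv hv0 _

/-- The symbol of `N - ∑_j Δ_{x_j}`. -/
def totalSymbol (ξ : Config d N) : ℝ := ∑ j, sobSymbol j ξ

theorem continuous_totalSymbol : Continuous (totalSymbol : Config d N → ℝ) :=
  continuous_finsetSum _ fun j _ => (hasTemperateGrowth_sobSymbol j).1.continuous

theorem one_le_totalSymbol (hN : 1 ≤ N) (ξ : Config d N) : 1 ≤ totalSymbol ξ :=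
  (one_le_sobSymbol ⟨0, hN⟩ ξ).trans (Finset.single_le_sum
    (f := fun j => sobSymbol j ξ) (fun j _ => (sobSymbol_pos j ξ).le) (Finset.mem_univ _))

theorem memLp_top_indicator_closedBall (R : ℝ) {w : Config d N → ℝ} (hw : Continuous w) :
    MemLp ((Metric.closedBall 0 R).indicator w) ⊤ volume := by
  obtain ⟨M, hM⟩ := (isCompact_closedBall (0 : Config d N) R).exists_bound_of_continuousOn
    hw.continuousOn
  refine memLp_top_of_bound
    (hw.aestronglyMeasurable.indicator Metric.isClosed_closedBall.measurableSet) |M|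
    (ae_of_all _ fun ξ => ?_)
  by_cases h : ξ ∈ Metric.closedBall 0 R
  · rw [Set.indicator_of_mem h]
    exact (hM ξ h).trans (le_abs_self M)
  · rw [Set.indicator_of_notMem h, norm_zero]
    exact abs_nonneg M

/-- Multiplication by a continuous function on the ball of radius `R`. -/
def cutMul (R : ℝ) {w : Config d N → ℝ} (hw : Continuous w) : Wave d N →L[ℂ] Wave d N :=
  boundedMul (memLp_top_indicator_closedBall R hw)

theorem coeFn_cutMul (R : ℝ) {w : Config d N → ℝ} (hw : Continuous w) (u : Wave d N) :
    ∀ᵐ ξ, (‖ξ‖ ≤ R → cutMul R hw u ξ = (w ξ : ℂ) * u ξ) ∧ (R < ‖ξ‖ → cutMul R hw u ξ = 0) := by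
  filter_upwards [coeFn_boundedMul (memLp_top_indicator_closedBall R hw) u] with ξ h
  refine ⟨fun hξ => ?_, fun hξ => ?_⟩
  · rw [cutMul, h, Set.indicator_of_mem (by simpa using hξ)]
  · rw [cutMul, h, Set.indicator_of_notMem (by simpa using hξ), Complex.ofReal_zero, zero_mul]

/-- The projection onto the functions vanishing outside of the ball of radius `R`. -/
def ballProj (R : ℝ) : Wave d N →L[ℂ] Wave d N :=
  cutMul R (continuous_const : Continuous fun _ : Config d N => (1 : ℝ))

theorem coeFn_ballProj (R : ℝ) (u : Wave d N) :
    ∀ᵐ ξ, (‖ξ‖ ≤ R → ballProj R u ξ = u ξ) ∧ (R < ‖ξ‖ → ballProj R u ξ = 0) := by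
  filter_upwards [coeFn_cutMul R (continuous_const : Continuous fun _ : Config d N => (1 : ℝ)) u]
    with ξ h
  exact ⟨fun hξ => (h.1 hξ).trans (by simp), h.2⟩

theorem isBandLimited_ballProj (R : ℝ) (u : Wave d N) : IsBandLimited R (ballProj R u) := by
  filter_upwards [coeFn_ballProj R u] with ξ h using h.2

theorem IsBandLimited.ballProj_eq {R : ℝ} {u : Wave d N} (hu : IsBandLimited R u) :
    ballProj R u = u := by
  refine Lp.ext ?_
  filter_upwards [coeFn_ballProj R u, hu] with ξ h1 h2
  rcases le_or_gt ‖ξ‖ R with h | h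
  · exact h1.1 h
  · rw [h1.2 h, h2 h]

theorem continuous_totalSymbol_sub_one :
    Continuous fun ξ : Config d N => totalSymbol ξ - 1 :=
  continuous_totalSymbol.sub continuous_const

/-- The operator `N - ∑_j Δ_{x_j} + v` in the Fourier representation, compressed to the ball of
radius `R`, and the identity on the orthogonal complement. -/
def truncOp {v : Config d N → ℝ} (hv : MemLp v ⊤ volume) (R : ℝ) : Wave d N →L[ℂ] Wave d N :=
  ContinuousLinearMap.id ℂ _ + cutMul R continuous_totalSymbol_sub_one +
    ballProj R ∘L fourierMul hv ∘L ballProj R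

theorem truncOp_apply {v : Config d N → ℝ} (hv : MemLp v ⊤ volume) (R : ℝ) (u : Wave d N) :
    truncOp hv R u = u + cutMul R continuous_totalSymbol_sub_one u +
      ballProj R (fourierMul hv (ballProj R u)) := rfl

theorem coeFn_truncOp {v : Config d N → ℝ} (hv : MemLp v ⊤ volume) (R : ℝ) (u : Wave d N) :
    ∀ᵐ ξ, (‖ξ‖ ≤ R → truncOp hv R u ξ =
        (totalSymbol ξ : ℂ) * u ξ + fourierMul hv (ballProj R u) ξ) ∧
      (R < ‖ξ‖ → truncOp hv R u ξ = u ξ) := by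
  rw [truncOp_apply]
  filter_upwards [Lp.coeFn_add (u + cutMul R continuous_totalSymbol_sub_one u)
    (ballProj R (fourierMul hv (ballProj R u))),
    Lp.coeFn_add u (cutMul R continuous_totalSymbol_sub_one u),
    coeFn_cutMul R continuous_totalSymbol_sub_one u,
    coeFn_ballProj R (fourierMul hv (ballProj R u))] with ξ h1 h2 h3 h4
  rw [h1, Pi.add_apply, h2, Pi.add_apply]
  refine ⟨fun hξ => ?_, fun hξ => ?_⟩
  · rw [h3.1 hξ, h4.1 hξ]
    push_cast
    ring
  · rw [h3.2 hξ, h4.2 hξ, add_zero, add_zero]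

theorem isBandLimited_truncOp_iff {v : Config d N → ℝ} (hv : MemLp v ⊤ volume) (R : ℝ)
    (u : Wave d N) : IsBandLimited R (truncOp hv R u) ↔ IsBandLimited R u := by
  constructor <;> intro h
  · filter_upwards [coeFn_truncOp hv R u, h] with ξ h1 h2 hξ
    rw [← h1.2 hξ, h2 hξ]
  · filter_upwards [coeFn_truncOp hv R u, h] with ξ h1 h2 hξ
    rw [h1.2 hξ, h2 hξ]

/-- For N ≥ 1 the symbol of T is at least 1, and the compressed interaction is nonnegative. Adding
the identity outside of the ball keeps this lower bound on all of L². -/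
theorem norm_sq_le_re_inner_truncOp (hN : 1 ≤ N) {v : Config d N → ℝ} (hv : MemLp v ⊤ volume)
    (hv0 : ∀ᵐ x, 0 ≤ v x) (R : ℝ) (u : Wave d N) :
    ‖u‖ ^ 2 ≤ (inner ℂ u (truncOp hv R u)).re := by
  rw [truncOp_apply, inner_add_right, inner_add_right, Complex.add_re, Complex.add_re]
  have h1 : (inner ℂ u u).re = ‖u‖ ^ 2 := by
    rw [inner_self_eq_norm_sq_to_K]
    norm_cast
  have h2 : 0 ≤ (inner ℂ u (cutMul R continuous_totalSymbol_sub_one u)).re :=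
    re_inner_boundedMul_nonneg _ (ae_of_all _ fun ξ => Set.indicator_nonneg
      (fun ξ _ => sub_nonneg.2 (one_le_totalSymbol hN ξ)) ξ) u
  have h3 : 0 ≤ (inner ℂ u (ballProj R (fourierMul hv (ballProj R u)))).re := by
    rw [ballProj, cutMul, ← inner_boundedMul_left]
    exact re_inner_fourierMul_nonneg hv hv0 _
  linarith

theorem norm_le_norm_truncOp (hN : 1 ≤ N) {v : Config d N → ℝ} (hv : MemLp v ⊤ volume)
    (hv0 : ∀ᵐ x, 0 ≤ v x) (R : ℝ) (u : Wave d N) : ‖u‖ ≤ ‖truncOp hv R u‖ := by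
  have h1 := norm_sq_le_re_inner_truncOp hN hv hv0 R u
  have h2 : (inner ℂ u (truncOp hv R u)).re ≤ ‖u‖ * ‖truncOp hv R u‖ :=
    (Complex.re_le_norm _).trans (norm_inner_le_norm _ _)
  rcases eq_or_lt_of_le (norm_nonneg u) with h | h
  · rw [← h]; exact norm_nonneg _
  · exact le_of_mul_le_mul_left (by nlinarith) h

/-- Coercivity and boundedness, as in the Lax–Milgram theorem. -/
theorem truncOp_surjective (hN : 1 ≤ N) {v : Config d N → ℝ} (hv : MemLp v ⊤ volume)
    (hv0 : ∀ᵐ x, 0 ≤ v x) (R : ℝ) (w : Wave d N) : ∃ u, truncOp hv R u = w := by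
  have h : IsUnit (truncOp hv R) := by
    refine ContinuousLinearMap.isUnit_of_forall_le_norm_inner_map _ (c := 1) one_pos fun u => ?_
    rw [norm_inner_symm]
    simpa using (norm_sq_le_re_inner_truncOp hN hv hv0 R u).trans (Complex.re_le_norm _)
  obtain ⟨A, hA⟩ := h
  refine ⟨(A⁻¹ : (Wave d N →L[ℂ] Wave d N)ˣ).val w, ?_⟩
  rw [← hA]
  exact congrArg (fun T : Wave d N →L[ℂ] Wave d N => T w) A.mul_inv

end ThreeBodyBose

end

noncomputable section

namespace ThreeBodyBose

/-! ### Lower bounds for the powers of the truncated Hamiltonians -/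

variable {d N : ℕ}

/-- The elementary symmetric polynomial of the symbols of `1 - Δ_{x_j}`. -/
def symSymbol (k : ℕ) (ξ : Config d N) : ℝ := symWeight k fun j => sobSymbol j ξ

theorem continuous_symSymbol (k : ℕ) : Continuous (symSymbol k : Config d N → ℝ) :=
  (hasTemperateGrowth_symWeight k).1.continuous

theorem symSymbol_nonneg (k : ℕ) (ξ : Config d N) : 0 ≤ symSymbol k ξ :=
  symWeight_nonneg (fun j => (sobSymbol_pos j ξ).le) k

/-- The commutator errors of the interaction are dominated by the kinetic terms of order `k`. -/
def SmallInteraction {v : Config d N → ℝ} (hv : MemLp v ⊤ volume) (k : ℕ) : Prop :=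
  ∃ δ : ℝ, 0 ≤ δ ∧ 4 * (k + 1) * δ ≤ 1 ∧ ∀ (R : ℝ) (u : Wave d N), IsBandLimited R u →
    -(δ * ∫ ξ, errorWeight k ξ * ‖u ξ‖ ^ 2) ≤
      ∫ ξ, symSymbol (k + 1) ξ * (starRingEnd ℂ (u ξ) * fourierMul hv u ξ).re

/-- The induction step e_k → e_(k+2). The pointwise lower bound `symWeight_mul_normSq_ge` is
integrated, and the cross term with the interaction is absorbed by the two positive terms. -/
theorem SmallInteraction.integral_truncOp_ge {v : Config d N → ℝ} {hv : MemLp v ⊤ volume} {k : ℕ}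
    (h : SmallInteraction hv k) {R : ℝ} {u : Wave d N} (hu : IsBandLimited R u) :
    ((k + 1) * (k + 2) / 2) * ∫ ξ, symSymbol (k + 2) ξ * ‖u ξ‖ ^ 2 ≤
      ∫ ξ, symSymbol k ξ * ‖truncOp hv R u ξ‖ ^ 2 := by
  obtain ⟨δ, hδ0, hδ, h⟩ := h
  have h := h R u hu
  have hcG : Continuous fun ξ : Config d N => symWeightSq (k + 1) fun j => sobSymbol j ξ :=
    (hasTemperateGrowth_symWeightSq (k + 1)).1.continuous
  have i1 := hu.integrable_sq (continuous_symSymbol (k + 2))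
  have i2 := hu.integrable_sq hcG
  have i3 : Integrable fun ξ => symSymbol (k + 1) ξ *
      (starRingEnd ℂ (u ξ) * fourierMul hv u ξ).re := by
    refine (hu.integrable (continuous_symSymbol (k + 1)) (fourierMul hv u)).re.congr
      (ae_of_all _ fun ξ => ?_)
    exact Complex.re_ofReal_mul _ _
  have i4 := ((isBandLimited_truncOp_iff hv R u).2 hu).integrable_sq (continuous_symSymbol k)
  have hpt : ∀ᵐ ξ, ((k + 1) * (k + 2)) * (symSymbol (k + 2) ξ * ‖u ξ‖ ^ 2) +
      (symWeightSq (k + 1) (fun j => sobSymbol j ξ) * ‖u ξ‖ ^ 2) + 2 * (k + 1) *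
        (symSymbol (k + 1) ξ * (starRingEnd ℂ (u ξ) * fourierMul hv u ξ).re) ≤
      symSymbol k ξ * ‖truncOp hv R u ξ‖ ^ 2 := by
    have hAe := coeFn_truncOp hv R u
    rw [hu.ballProj_eq] at hAe
    filter_upwards [hAe, hu] with ξ hA h0
    rcases le_or_gt ‖ξ‖ R with hξ | hξ
    · rw [hA.1 hξ]
      refine le_trans (le_of_eq ?_) (symWeight_mul_normSq_ge (fun j => (sobSymbol_pos j ξ).le) k
        (u ξ) (fourierMul hv u ξ))
      simp only [symSymbol]
      ring
    · rw [hA.2 hξ, h0 hξ]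
      simp
  have i12 : Integrable fun ξ => ((k : ℝ) + 1) * (k + 2) * (symSymbol (k + 2) ξ * ‖u ξ‖ ^ 2) +
      symWeightSq (k + 1) (fun j => sobSymbol j ξ) * ‖u ξ‖ ^ 2 := (i1.const_mul _).add i2
  have hint := integral_mono_ae (((i1.const_mul _).add i2).add (i3.const_mul _)) i4 hpt
  have e1 : ∫ ξ, errorWeight k ξ * ‖u ξ‖ ^ 2 = (∫ ξ, symSymbol (k + 2) ξ * ‖u ξ‖ ^ 2) +
      ∫ ξ, symWeightSq (k + 1) (fun j => sobSymbol j ξ) * ‖u ξ‖ ^ 2 := by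
    rw [← integral_add i1 i2]
    simp only [errorWeight, symSymbol, add_mul]
  simp only [Pi.add_apply] at hint
  rw [integral_add i12 (i3.const_mul _), integral_add (i1.const_mul _) i2,
    integral_const_mul, integral_const_mul] at hint
  rw [e1] at h
  have p1 : 0 ≤ ∫ ξ, symSymbol (k + 2) ξ * ‖u ξ‖ ^ 2 :=
    integral_nonneg fun ξ => mul_nonneg (symSymbol_nonneg _ ξ) (sq_nonneg _)
  have p2 : 0 ≤ ∫ ξ, symWeightSq (k + 1) (fun j => sobSymbol j ξ) * ‖u ξ‖ ^ 2 :=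
    integral_nonneg fun ξ => mul_nonneg (symWeightSq_nonneg (fun j => (sobSymbol_pos j ξ).le) _)
      (sq_nonneg _)
  set a := ∫ ξ, symSymbol (k + 2) ξ * ‖u ξ‖ ^ 2
  set b := ∫ ξ, symWeightSq (k + 1) (fun j => sobSymbol j ξ) * ‖u ξ‖ ^ 2
  -- From 4(k+1)δ ≤ 1: the cross term costs at most half of a + b, where the main term provides
  -- (k+1)(k+2) a + b.
  have h1 : -((a + b) / 2) ≤ 2 * (k + 1) *
      ∫ ξ, symSymbol (k + 1) ξ * (starRingEnd ℂ (u ξ) * fourierMul hv u ξ).re := by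
    have h2 := mul_le_mul_of_nonneg_left h (by positivity : (0 : ℝ) ≤ 2 * (k + 1))
    nlinarith [mul_le_mul_of_nonneg_right hδ (add_nonneg p1 p2)]
  have h3 : 1 * a ≤ (k + 1) * (k + 2) * a := by
    refine mul_le_mul_of_nonneg_right ?_ p1
    have : (0 : ℝ) ≤ k := Nat.cast_nonneg k
    nlinarith
  linarith

/-- The quadratic form of the `k`-th power of a bounded operator. -/
def powForm (A : Wave d N →L[ℂ] Wave d N) : ℕ → Wave d N → ℝ
  | 0, u => ‖u‖ ^ 2
  | 1, u => (inner ℂ u (A u)).re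
  | k + 2, u => powForm A k (A u)

/-- The constants in the lower bounds for the powers of the Hamiltonian. -/
def powConst : ℕ → ℝ
  | 0 => 1
  | 1 => 1
  | k + 2 => powConst k * ((k + 1) * (k + 2) / 2)

theorem powConst_nonneg : ∀ k, 0 ≤ powConst k
  | 0 => zero_le_one
  | 1 => zero_le_one
  | k + 2 => mul_nonneg (powConst_nonneg k) (by positivity)

theorem norm_sq_eq_integral (u : Wave d N) : ‖u‖ ^ 2 = ∫ ξ, ‖u ξ‖ ^ 2 := by
  have h : (inner ℂ u u).re = ‖u‖ ^ 2 := by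
    rw [inner_self_eq_norm_sq_to_K]
    norm_cast
  rw [← h, inner_eq_integral, ← RCLike.re_eq_complex_re, ← integral_re (integrable_inner _ _)]
  refine integral_congr_ae (ae_of_all _ fun ξ => ?_)
  beta_reduce
  rw [RCLike.re_eq_complex_re, ← Complex.normSq_eq_conj_mul_self, Complex.normSq_eq_norm_sq,
    Complex.ofReal_re]

theorem IsBandLimited.re_inner_truncOp {v : Config d N → ℝ} (hv : MemLp v ⊤ volume) {R : ℝ}
    {u : Wave d N} (hu : IsBandLimited R u) :
    (inner ℂ u (truncOp hv R u)).re = (∫ ξ, totalSymbol ξ * ‖u ξ‖ ^ 2) +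
      (inner ℂ u (fourierMul hv u)).re := by
  have i1 := hu.integrable_sq continuous_totalSymbol
  have i2 := (integrable_inner u (fourierMul hv u)).re
  have hAe := coeFn_truncOp hv R u
  rw [hu.ballProj_eq] at hAe
  rw [inner_eq_integral, inner_eq_integral, ← RCLike.re_eq_complex_re,
    ← integral_re (integrable_inner _ _),
    ← integral_re (integrable_inner _ _), ← integral_add i1 i2]
  refine integral_congr_ae ?_
  filter_upwards [hAe, hu] with ξ hA h0
  rcases le_or_gt ‖ξ‖ R with hξ | hξ
  · rw [hA.1 hξ, mul_add, map_add, mul_left_comm, RCLike.re_eq_complex_re,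
      Complex.re_ofReal_mul, ← Complex.normSq_eq_conj_mul_self, Complex.normSq_eq_norm_sq,
      Complex.ofReal_re]
  · rw [hA.2 hξ, h0 hξ]
    simp

/-- Induction in steps of two, applied at `truncOp hv R u`, which stays band-limited. The base case
k = 0 is the norm; k = 1 uses only the positivity of the interaction. -/
theorem powForm_truncOp_ge {v : Config d N → ℝ} {hv : MemLp v ⊤ volume} (hv0 : ∀ᵐ x, 0 ≤ v x)
    (R : ℝ) : ∀ (k : ℕ), (∀ m, m + 2 ≤ k → SmallInteraction hv m) → ∀ u : Wave d N,
      IsBandLimited R u →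
        powConst k * ∫ ξ, symSymbol k ξ * ‖u ξ‖ ^ 2 ≤ powForm (truncOp hv R) k u
  | 0, _, u, hu => by
    simp only [powConst, powForm, symSymbol, symWeight_zero, one_mul]
    rw [norm_sq_eq_integral]
  | 1, _, u, hu => by
    simp only [powConst, powForm, symSymbol, symWeight_one, one_mul]
    rw [hu.re_inner_truncOp hv]
    exact le_add_of_nonneg_right (re_inner_fourierMul_nonneg hv hv0 u)
  | k + 2, h, u, hu => by
    have h1 := powForm_truncOp_ge hv0 R k (fun m hm => h m (by omega)) (truncOp hv R u)
      ((isBandLimited_truncOp_iff hv R u).2 hu)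
    refine le_trans ?_ h1
    rw [powConst, mul_assoc]
    exact mul_le_mul_of_nonneg_left ((h k le_rfl).integral_truncOp_ge hu) (powConst_nonneg k)

end ThreeBodyBose

end

noncomputable section

namespace ThreeBodyBose

/-! ### Removal of the truncation -/

open Filter

variable {d N : ℕ}

theorem integrable_norm_sq (u : Wave d N) : Integrable fun ξ => ‖u ξ‖ ^ 2 := by
  refine (integrable_inner u u).re.congr (ae_of_all _ fun ξ => ?_)
  beta_reduce
  rw [RCLike.re_eq_complex_re, ← Complex.normSq_eq_conj_mul_self, Complex.normSq_eq_norm_sq,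
    Complex.ofReal_re]

theorem tendsto_ballProj (w : Wave d N) :
    Tendsto (fun n : ℕ => ballProj (n : ℝ) w) atTop (nhds w) := by
  rw [tendsto_iff_norm_sub_tendsto_zero]
  have h1 : Tendsto (fun n : ℕ => ∫ ξ, (Metric.closedBall (0 : Config d N) n)ᶜ.indicator
      (fun ξ => ‖w ξ‖ ^ 2) ξ) atTop (nhds (∫ _ : Config d N, 0)) := by
    have hi : Integrable fun ξ => ‖w ξ‖ ^ 2 := integrable_norm_sq w
    refine tendsto_integral_of_dominated_convergence _ (fun n => ?_) hi (fun n => ?_) ?_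
    · exact hi.aestronglyMeasurable.indicator Metric.isClosed_closedBall.measurableSet.compl
    · refine ae_of_all _ fun ξ => (norm_indicator_le_norm_self _ _).trans ?_
      rw [Real.norm_of_nonneg (sq_nonneg _)]
    · refine ae_of_all _ fun ξ => ?_
      obtain ⟨m, hm⟩ := exists_nat_ge ‖ξ‖
      refine tendsto_const_nhds.congr' ?_
      filter_upwards [eventually_ge_atTop m] with n hn
      have : ‖ξ‖ ≤ n := hm.trans (by exact_mod_cast hn)
      rw [Set.indicator_of_notMem]
      simpa using this
  rw [integral_zero] at h1
  have h2 : ∀ n : ℕ, ‖ballProj (n : ℝ) w - w‖ = √(∫ ξ,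
      (Metric.closedBall (0 : Config d N) n)ᶜ.indicator (fun ξ => ‖w ξ‖ ^ 2) ξ) := fun n => by
    rw [← Real.sqrt_sq (norm_nonneg (ballProj (n : ℝ) w - w)), norm_sq_eq_integral]
    congr 1
    refine integral_congr_ae ?_
    filter_upwards [Lp.coeFn_sub (ballProj (n : ℝ) w) w, coeFn_ballProj (n : ℝ) w] with ξ h3 h4
    rw [h3, Pi.sub_apply]
    by_cases h : ‖ξ‖ ≤ n
    · rw [h4.1 h, Set.indicator_of_notMem (by simpa using h)]
      simp
    · rw [h4.2 (not_le.1 h), Set.indicator_of_mem (by simpa using h)]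
      simp
  simp only [h2]
  rw [← Real.sqrt_zero]
  exact (Real.continuous_sqrt.tendsto 0).comp h1

theorem norm_ballProj_le (R : ℝ) (w : Wave d N) : ‖ballProj R w‖ ≤ ‖w‖ := by
  refine Lp.norm_le_norm_of_ae_le ?_
  filter_upwards [coeFn_ballProj R w] with ξ h
  rcases le_or_gt ‖ξ‖ R with hξ | hξ
  · rw [h.1 hξ]
  · rw [h.2 hξ, norm_zero]
    exact norm_nonneg _

theorem tendsto_ballProj_of_tendsto {w : ℕ → Wave d N} {w₀ : Wave d N}
    (h : Tendsto w atTop (nhds w₀)) :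
    Tendsto (fun n : ℕ => ballProj (n : ℝ) (w n)) atTop (nhds w₀) := by
  rw [tendsto_iff_norm_sub_tendsto_zero] at h ⊢
  have h0 := tendsto_iff_norm_sub_tendsto_zero.1 (tendsto_ballProj w₀)
  refine squeeze_zero (fun _ => norm_nonneg _) (fun n => ?_) (by simpa using h.add h0)
  have e : ballProj (n : ℝ) (w n) - w₀ =
      ballProj (n : ℝ) (w n - w₀) + (ballProj (n : ℝ) w₀ - w₀) := by
    rw [map_sub]; abel
  rw [e]
  exact (norm_add_le _ _).trans (add_le_add_left (norm_ballProj_le _ _) _)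

/-- Lower semicontinuity of weighted norms. -/
theorem lintegral_le_of_tendsto {w : Config d N → ℝ} (hw : Continuous w) {u : ℕ → Wave d N}
    {φ : Wave d N} (hu : Tendsto u atTop (nhds φ)) {g : ℕ → ℝ≥0∞} {B : ℝ≥0∞}
    (hg : Tendsto g atTop (nhds B))
    (h : ∀ n, ∫⁻ ξ, ENNReal.ofReal (w ξ) * ‖u n ξ‖ₑ ^ 2 ≤ g n) :
    ∫⁻ ξ, ENNReal.ofReal (w ξ) * ‖φ ξ‖ₑ ^ 2 ≤ B := by
  -- Almost everywhere convergence along a subsequence, then Fatou's lemma.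
  obtain ⟨ns, hns, hae⟩ := (tendstoInMeasure_of_tendsto_Lp hu).exists_seq_tendsto_ae
  have h1 : ∀ᵐ ξ, ENNReal.ofReal (w ξ) * ‖φ ξ‖ₑ ^ 2 =
      liminf (fun i => ENNReal.ofReal (w ξ) * ‖u (ns i) ξ‖ₑ ^ 2) atTop := by
    filter_upwards [hae] with ξ hξ
    refine (Tendsto.liminf_eq ?_).symm
    exact ENNReal.Tendsto.const_mul ((ENNReal.continuous_pow 2).tendsto _ |>.comp
      ((continuous_enorm.tendsto _).comp hξ)) (Or.inr ENNReal.ofReal_ne_top)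
  rw [lintegral_congr_ae h1]
  refine (lintegral_liminf_le' fun i => ?_).trans ?_
  · exact hw.measurable.ennreal_ofReal.aemeasurable.mul
      ((Lp.aestronglyMeasurable _).enorm.pow_const 2)
  · refine (liminf_le_liminf (Eventually.of_forall fun i => h (ns i))).trans (le_of_eq ?_)
    exact (hg.comp hns.tendsto_atTop).liminf_eq

theorem ofReal_integral_mul_sq {w : Config d N → ℝ} (hw0 : ∀ ξ, 0 ≤ w ξ)
    {u : Wave d N} (hi : Integrable fun ξ => w ξ * ‖u ξ‖ ^ 2) :
    ENNReal.ofReal (∫ ξ, w ξ * ‖u ξ‖ ^ 2) = ∫⁻ ξ, ENNReal.ofReal (w ξ) * ‖u ξ‖ₑ ^ 2 := by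
  rw [ofReal_integral_eq_lintegral_ofReal hi
    (ae_of_all _ fun ξ => mul_nonneg (hw0 ξ) (sq_nonneg _))]
  refine lintegral_congr fun ξ => ?_
  rw [ENNReal.ofReal_mul (hw0 ξ), ENNReal.ofReal_pow (norm_nonneg _), ofReal_norm]

theorem totalSymbol_eq (ξ : Config d N) : totalSymbol ξ = N + ∑ j, lapSymbol j ξ := by
  simp [totalSymbol, sobSymbol, Finset.sum_add_distrib]

theorem enorm_sq_eq_lintegral (u : Wave d N) : ‖u‖ₑ ^ 2 = ∫⁻ ξ, ‖u ξ‖ₑ ^ 2 := by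
  rw [Lp.enorm_def, eLpNorm_two_sq]

theorem enorm_fourier (ψ : Wave d N) : ‖(𝓕 ψ : Wave d N)‖ₑ = ‖ψ‖ₑ := by
  rw [← ofReal_norm, ← ofReal_norm, Lp.norm_fourier_eq]

variable {β : ℝ} {V : Pos d × Pos d → ℝ}

/-- The operator `H_N + N` in the Fourier representation. -/
theorem fourier_shiftedHamiltonian (hv : MemLp (interaction N β V) ⊤ volume) {ψ : Wave d N}
    (h : ψ ∈ (shiftedHamiltonian N β V).domain) :
    ∃ χ : Wave d N, (∀ᵐ ξ, χ ξ = (totalSymbol ξ : ℂ) * (𝓕 ψ : Wave d N) ξ) ∧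
      (𝓕 (shiftedHamiltonian N β V ⟨ψ, h⟩) : Wave d N) = χ + fourierMul hv (𝓕 ψ) := by
  obtain ⟨h1, h2⟩ : ψ ∈ (kinetic d N).domain ∧ ψ ∈ (mulOp (interaction N β V)).domain :=
    ⟨h.1, h.2⟩
  have h1' : MemLp (fun ξ => ((∑ j, lapSymbol j ξ : ℝ) : ℂ) * (𝓕 ψ : Wave d N) ξ) 2 volume := h1
  have e0 : shiftedHamiltonian N β V ⟨ψ, h⟩ = (N : ℂ) • ψ +
      ((𝓕⁻ (h1'.toLp _ : Wave d N) : Wave d N) + MemLp.toLp _ (mulDomain_memLp _ ⟨ψ, h2⟩)) := rfl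
  have e1 : MemLp.toLp _ (mulDomain_memLp (interaction N β V) ⟨ψ, h2⟩) = boundedMul hv ψ := by
    refine Lp.ext ?_
    filter_upwards [MemLp.coeFn_toLp (mulDomain_memLp (interaction N β V) ⟨ψ, h2⟩),
      coeFn_boundedMul hv ψ] with x h3 h4
    rw [h3, h4]
  refine ⟨(N : ℂ) • (𝓕 ψ : Wave d N) + h1'.toLp _, ?_, ?_⟩
  · filter_upwards [Lp.coeFn_add ((N : ℂ) • (𝓕 ψ : Wave d N)) (h1'.toLp _),
      Lp.coeFn_smul (N : ℂ) (𝓕 ψ : Wave d N), h1'.coeFn_toLp] with ξ h3 h4 h5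
    rw [h3, Pi.add_apply, h4, h5, Pi.smul_apply, smul_eq_mul, totalSymbol_eq]
    push_cast
    ring
  · rw [e0, e1, FourierAdd.fourier_add, FourierAdd.fourier_add, FourierSMul.fourier_smul,
      fourier_fourierInv_eq, fourierMul_apply, fourierInv_fourier_eq, add_assoc]

/-- The ball projection P commutes with multiplication by T, so the truncated operator at P φ equals
P (T φ + W P φ), and W is bounded. -/
theorem tendsto_truncOp_ballProj (hv : MemLp (interaction N β V) ⊤ volume) {ψ : Wave d N}
    (h : ψ ∈ (shiftedHamiltonian N β V).domain) :
    Tendsto (fun n : ℕ => truncOp hv n (ballProj (n : ℝ) (𝓕 ψ : Wave d N))) atTop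
      (nhds (𝓕 (shiftedHamiltonian N β V ⟨ψ, h⟩) : Wave d N)) := by
  obtain ⟨χ, hχ, e⟩ := fourier_shiftedHamiltonian hv h
  set φ : Wave d N := 𝓕 ψ
  have h1 : ∀ n : ℕ, truncOp hv n (ballProj (n : ℝ) φ) =
      ballProj (n : ℝ) (χ + fourierMul hv (ballProj (n : ℝ) φ)) := fun n => by
    refine Lp.ext ?_
    have h2 := coeFn_truncOp hv n (ballProj (n : ℝ) φ)
    rw [(isBandLimited_ballProj (n : ℝ) φ).ballProj_eq] at h2
    filter_upwards [h2, coeFn_ballProj (n : ℝ) φ, hχ,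
      coeFn_ballProj (n : ℝ) (χ + fourierMul hv (ballProj (n : ℝ) φ)),
      Lp.coeFn_add χ (fourierMul hv (ballProj (n : ℝ) φ))] with ξ h3 h4 h5 h6 h7
    rcases le_or_gt ‖ξ‖ n with hξ | hξ
    · rw [h3.1 hξ, h6.1 hξ, h7, Pi.add_apply, h5, h4.1 hξ]
    · rw [h3.2 hξ, h6.2 hξ, h4.2 hξ]
  simp only [h1]
  rw [e]
  exact tendsto_ballProj_of_tendsto (tendsto_const_nhds.add
    (((fourierMul hv).continuous.tendsto φ).comp (tendsto_ballProj φ)))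

/-- The summand N ‖ψ‖² is absorbed into the kinetic symbol, and Plancherel turns the potential
energy into the form of `fourierMul`. -/
theorem energyForm_eq (hv : MemLp (interaction N β V) ⊤ volume)
    (hv0 : ∀ᵐ x : Config d N, 0 ≤ interaction N β V x) (ψ : Wave d N) :
    energyForm N β V ψ = (∫⁻ ξ, ENNReal.ofReal (totalSymbol ξ) * ‖(𝓕 ψ : Wave d N) ξ‖ₑ ^ 2) +
      ENNReal.ofReal (inner ℂ (𝓕 ψ : Wave d N) (fourierMul hv (𝓕 ψ))).re := by
  have hlap : Continuous fun ξ : Config d N => ∑ j, lapSymbol j ξ := by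
    refine (continuous_totalSymbol.sub (continuous_const (y := (N : ℝ)))).congr fun ξ => ?_
    rw [Pi.sub_apply, totalSymbol_eq, add_sub_cancel_left]
  have hm : AEMeasurable fun ξ => ‖(𝓕 ψ : Wave d N) ξ‖ₑ ^ 2 :=
    (Lp.aestronglyMeasurable _).enorm.pow_const 2
  have e1 : ∫⁻ ξ, ENNReal.ofReal (totalSymbol ξ) * ‖(𝓕 ψ : Wave d N) ξ‖ₑ ^ 2 =
      (∫⁻ ξ, ENNReal.ofReal (∑ j, lapSymbol j ξ) * ‖(𝓕 ψ : Wave d N) ξ‖ₑ ^ 2) + N * ‖ψ‖ₑ ^ 2 := by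
    rw [← enorm_fourier ψ, enorm_sq_eq_lintegral, ← lintegral_const_mul'' _ hm,
      ← lintegral_add_right' _ (hm.const_mul _)]
    refine lintegral_congr fun ξ => ?_
    rw [totalSymbol_eq, ENNReal.ofReal_add (Nat.cast_nonneg N)
      (Finset.sum_nonneg fun j _ => lapSymbol_nonneg j ξ), ENNReal.ofReal_natCast]
    ring
  have e2 : ENNReal.ofReal (inner ℂ (𝓕 ψ : Wave d N) (fourierMul hv (𝓕 ψ))).re =
      ∫⁻ x, ENNReal.ofReal (interaction N β V x) * ‖ψ x‖ₑ ^ 2 := by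
    rw [fourierMul_apply, fourierInv_fourier_eq, Lp.inner_fourier_eq, re_inner_boundedMul]
    have hi : Integrable fun x => interaction N β V x * ‖ψ x‖ ^ 2 := by
      refine (integrable_inner ψ (boundedMul hv ψ)).re.congr ?_
      filter_upwards [coeFn_boundedMul hv ψ] with x h1
      rw [h1, RCLike.re_eq_complex_re, mul_left_comm, Complex.re_ofReal_mul,
        ← Complex.normSq_eq_conj_mul_self, Complex.normSq_eq_norm_sq, Complex.ofReal_re]
    rw [ofReal_integral_eq_lintegral_ofReal hi
      (hv0.mono fun ξ h => mul_nonneg h (sq_nonneg _))]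
    refine lintegral_congr_ae (hv0.mono fun x h => ?_)
    beta_reduce
    rw [ENNReal.ofReal_mul h, ENNReal.ofReal_pow (norm_nonneg _), ofReal_norm]
  rw [e1, e2, energyForm]
  ring

/-- Approximation of the forms of the powers of `H_N + N` by those of the truncated operators. -/
theorem exists_tendsto_powForm (hN : 1 ≤ N) (hv : MemLp (interaction N β V) ⊤ volume)
    (hv0 : ∀ᵐ x : Config d N, 0 ≤ interaction N β V x) : ∀ (k : ℕ) (ψ : Wave d N),
      energyPowForm N β V k ψ ≠ ⊤ → ∃ (u : ℕ → Wave d N) (g : ℕ → ℝ≥0∞),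
        (∀ n : ℕ, IsBandLimited n (u n)) ∧ Tendsto u atTop (nhds (𝓕 ψ)) ∧
        (∀ n : ℕ, ENNReal.ofReal (powForm (truncOp hv n) k (u n)) ≤ g n) ∧
        Tendsto g atTop (nhds (energyPowForm N β V k ψ))
  | 0, ψ, _ => by
    refine ⟨fun n => ballProj (n : ℝ) (𝓕 ψ : Wave d N), fun _ => ‖ψ‖ₑ ^ 2,
      fun n => isBandLimited_ballProj _ _, tendsto_ballProj _, fun n => ?_, ?_⟩
    · rw [powForm, ENNReal.ofReal_pow (norm_nonneg _), ofReal_norm, ← enorm_fourier ψ]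
      refine pow_le_pow_left' ?_ 2
      rw [← ofReal_norm, ← ofReal_norm]
      exact ENNReal.ofReal_le_ofReal (norm_ballProj_le _ _)
    · rw [energyPowForm]
      exact tendsto_const_nhds
  | 1, ψ, _ => by
    set φ : Wave d N := 𝓕 ψ
    refine ⟨fun n => ballProj (n : ℝ) φ,
      fun n => (∫⁻ ξ, ENNReal.ofReal (totalSymbol ξ) * ‖φ ξ‖ₑ ^ 2) + ENNReal.ofReal
        (inner ℂ (ballProj (n : ℝ) φ) (fourierMul hv (ballProj (n : ℝ) φ))).re,
      fun n => isBandLimited_ballProj _ _, tendsto_ballProj _, fun n => ?_, ?_⟩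
    · have hb := isBandLimited_ballProj (n : ℝ) φ
      have ht0 : ∀ ξ : Config d N, 0 ≤ totalSymbol ξ := fun ξ =>
        zero_le_one.trans (one_le_totalSymbol hN ξ)
      rw [powForm, hb.re_inner_truncOp hv, ENNReal.ofReal_add
        (integral_nonneg fun ξ => mul_nonneg (ht0 ξ) (sq_nonneg _))
        (re_inner_fourierMul_nonneg hv hv0 _),
        ofReal_integral_mul_sq ht0 (hb.integrable_sq continuous_totalSymbol)]
      refine add_le_add_left (lintegral_mono_ae ?_) _
      filter_upwards [coeFn_ballProj (n : ℝ) φ] with ξ h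
      rcases le_or_gt ‖ξ‖ n with hξ | hξ
      · rw [h.1 hξ]
      · rw [h.2 hξ]
        simp
    · rw [energyPowForm, energyForm_eq hv hv0]
      refine tendsto_const_nhds.add ((ENNReal.continuous_ofReal.tendsto _).comp
        ((Complex.continuous_re.tendsto _).comp ?_))
      exact (tendsto_ballProj φ).inner
        (((fourierMul hv).continuous.tendsto φ).comp (tendsto_ballProj φ))
  | k + 2, ψ, hψ => by
    by_cases h : ψ ∈ (shiftedHamiltonian N β V).domain
    · rw [energyPowForm, dif_pos h] at hψ ⊢
      obtain ⟨u', g, hb, hu', hg, hgt⟩ := exists_tendsto_powForm hN hv hv0 k _ hψ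
      -- The approximants are preimages of those of (H_N + N) ψ. The form of order k+2 at u is then
      -- exactly the form of order k at u', so no iterated domain condition has to be transferred.
      choose u hu using fun n : ℕ => truncOp_surjective hN hv hv0 n (u' n)
      refine ⟨u, g, fun n => ?_, ?_, fun n => ?_, hgt⟩
      · rw [← isBandLimited_truncOp_iff hv, hu]
        exact hb n
      · have h1 := hu'.sub (tendsto_truncOp_ballProj hv h)
        rw [sub_self] at h1
        -- Both `u n` and the projection of 𝓕 ψ have images under the truncated operator with the
        -- same limit, and its inverse has norm at most 1 uniformly in n.
        have h2 : Tendsto (fun n : ℕ => u n - ballProj (n : ℝ) (𝓕 ψ : Wave d N)) atTop (nhds 0) := by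
          refine squeeze_zero_norm (fun n => ?_) (tendsto_zero_iff_norm_tendsto_zero.1 h1)
          refine (norm_le_norm_truncOp hN hv hv0 n _).trans (le_of_eq ?_)
          rw [map_sub, hu]
        simpa using h2.add (tendsto_ballProj (𝓕 ψ : Wave d N))
      · rw [powForm, hu]
        exact hg n
    · rw [energyPowForm, dif_neg h] at hψ
      exact absurd rfl hψ

/-- The lower bound for the powers of `H_N + N`. -/
theorem powConst_mul_lintegral_le (hN : 1 ≤ N) (hv : MemLp (interaction N β V) ⊤ volume)
    (hv0 : ∀ᵐ x : Config d N, 0 ≤ interaction N β V x) {k : ℕ}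
    (h : ∀ m, m + 2 ≤ k → SmallInteraction hv m) (ψ : Wave d N) :
    ∫⁻ ξ, ENNReal.ofReal (powConst k * symSymbol k ξ) * ‖(𝓕 ψ : Wave d N) ξ‖ₑ ^ 2 ≤
      energyPowForm N β V k ψ := by
  by_cases hψ : energyPowForm N β V k ψ = ⊤
  · rw [hψ]
    exact le_top
  obtain ⟨u, g, hb, hu, hg, hgt⟩ := exists_tendsto_powForm hN hv hv0 k ψ hψ
  have hc : Continuous fun ξ : Config d N => powConst k * symSymbol k ξ :=
    continuous_const.mul (continuous_symSymbol k)
  refine lintegral_le_of_tendsto hc hu hgt fun n => ?_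
  rw [← ofReal_integral_mul_sq (fun ξ => mul_nonneg (powConst_nonneg k) (symSymbol_nonneg k ξ))
    ((hb n).integrable_sq hc)]
  refine (ENNReal.ofReal_le_ofReal ?_).trans (hg n)
  simp only [mul_assoc, integral_const_mul]
  exact powForm_truncOp_ge hv0 n k h _ (hb n)

end ThreeBodyBose

end

noncomputable section

namespace ThreeBodyBose

/-! ### Permutations of the particles -/

open SchwartzMap Filter

variable {d N : ℕ}

/-- Composition with a linear isometry on `L²`. -/
def compIsometry (A : Config d N ≃ₗᵢ[ℝ] Config d N) (ψ : Wave d N) : Wave d N :=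
  Lp.compMeasurePreserving A A.measurePreserving ψ

/-- Both sides are continuous in ψ, and for Schwartz functions this is the invariance of the Fourier
integral under isometries. -/
theorem fourier_compIsometry (A : Config d N ≃ₗᵢ[ℝ] Config d N) (ψ : Wave d N) :
    (𝓕 (compIsometry A ψ) : Wave d N) = compIsometry A (𝓕 ψ) := by
  have hc : Continuous (compIsometry A) :=
    (Lp.isometry_compMeasurePreserving A.measurePreserving).continuous
  refine DenseRange.induction_on (denseRange_toLpCLM (F := ℂ) (E := Config d N)
      (μ := volume) (p := 2) ENNReal.ofNat_ne_top) ψ ?_ fun f => ?_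
  · exact isClosed_eq ((Lp.fourierTransformₗᵢ (Config d N) ℂ).continuous.comp hc)
      (hc.comp (Lp.fourierTransformₗᵢ (Config d N) ℂ).continuous)
  · change (𝓕 (compIsometry A (f.toLp 2 volume)) : Wave d N) = compIsometry A (𝓕 (f.toLp 2 volume))
    set g := compCLMOfContinuousLinearEquiv ℂ A.toContinuousLinearEquiv f with hg
    have h1 : ∀ f : 𝓢(Config d N, ℂ), compIsometry A (f.toLp 2 volume) =ᵐ[volume] fun x => f (A x) :=
      fun f => by
        refine (Lp.coeFn_compMeasurePreserving _ A.measurePreserving).trans ?_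
        exact A.measurePreserving.quasiMeasurePreserving.ae_eq_comp (f.coeFn_toLp 2 volume)
    have h2 : compIsometry A (f.toLp 2 volume) = g.toLp 2 volume := Lp.ext (by
      filter_upwards [h1 f, g.coeFn_toLp 2 volume] with x h3 h4
      rw [h3, h4]
      rfl)
    rw [h2, toLp_fourier_eq, toLp_fourier_eq]
    refine Lp.ext ?_
    filter_upwards [h1 (𝓕 f), (𝓕 g).coeFn_toLp 2 volume] with x h3 h4
    rw [h3, h4, fourier_coe, fourier_coe]
    exact Real.fourier_comp_linearIsometry A f x

/-- The permutation of the particles as a linear isometry. -/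
def permuteIsometry (σ : Equiv.Perm (Fin N)) : Config d N ≃ₗᵢ[ℝ] Config d N :=
  LinearIsometryEquiv.piLpCongrLeft 2 ℝ ℝ (σ.prodCongr (Equiv.refl (Fin d))).symm

theorem permuteIsometry_apply (σ : Equiv.Perm (Fin N)) (x : Config d N) :
    permuteIsometry σ x = permute σ x := by
  ext i
  rfl

theorem IsSymmetric.fourier {ψ : Wave d N} (h : IsSymmetric ψ) :
    IsSymmetric (𝓕 ψ : Wave d N) := by
  intro σ
  have h1 : ∀ φ : Wave d N, compIsometry (permuteIsometry σ) φ =ᵐ[volume]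
      fun x => φ (permute σ x) := fun φ => by
    refine (Lp.coeFn_compMeasurePreserving _ (permuteIsometry σ).measurePreserving).trans
      (ae_of_all _ fun x => ?_)
    rw [Function.comp_apply, permuteIsometry_apply]
  have h2 : compIsometry (permuteIsometry σ) ψ = ψ := Lp.ext ((h1 ψ).trans (h σ))
  have h3 := fourier_compIsometry (permuteIsometry σ) ψ
  rw [h2] at h3
  filter_upwards [h1 (𝓕 ψ)] with ξ h4
  rw [← h4, ← h3]

/-- A permutation carrying J to J' is a volume-preserving change of variables that leaves |φ|
unchanged. -/
theorem IsSymmetric.lintegral_prod_sobSymbol {φ : Wave d N} (h : IsSymmetric φ)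
    {J J' : Finset (Fin N)} (hJ : J.card = J'.card) :
    ∫⁻ ξ, ENNReal.ofReal (∏ j ∈ J, sobSymbol j ξ) * ‖φ ξ‖ₑ ^ 2 =
      ∫⁻ ξ, ENNReal.ofReal (∏ j ∈ J', sobSymbol j ξ) * ‖φ ξ‖ₑ ^ 2 := by
  obtain ⟨σ, hσ⟩ : ∃ σ : Equiv.Perm (Fin N), J.map σ.toEmbedding = J' := by
    obtain ⟨e⟩ : Nonempty (J ≃ J') := ⟨Finset.equivOfCardEq hJ⟩
    refine ⟨e.extendSubtype, ?_⟩
    refine Finset.eq_of_subset_of_card_le (fun x hx => ?_) (by rw [Finset.card_map, hJ])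
    obtain ⟨j, hj, rfl⟩ := Finset.mem_map.1 hx
    exact e.extendSubtype_mem j hj
  have hm : MeasurePreserving (permute σ : Config d N → Config d N) volume volume := by
    have := (permuteIsometry (d := d) σ).measurePreserving
    rwa [funext (permuteIsometry_apply (d := d) σ)] at this
  have he : MeasurableEmbedding (permute σ : Config d N → Config d N) := by
    have := (permuteIsometry (d := d) σ).toHomeomorph.measurableEmbedding
    rwa [show ((permuteIsometry (d := d) σ).toHomeomorph : Config d N → Config d N) = permute σ from
      funext (permuteIsometry_apply (d := d) σ)] at this
  rw [← hm.lintegral_comp_emb he]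
  refine lintegral_congr_ae ?_
  filter_upwards [h σ] with ξ hξ
  rw [hξ, ← hσ, Finset.prod_map]
  rfl

/-- All binom(N, k) summands of e_k have the same form, that of the first k particles. -/
theorem IsSymmetric.lintegral_symSymbol {φ : Wave d N} (h : IsSymmetric φ) {k : ℕ} (hk : k ≤ N) :
    ∫⁻ ξ, ENNReal.ofReal (symSymbol k ξ) * ‖φ ξ‖ₑ ^ 2 = N.choose k *
      ∫⁻ ξ, ENNReal.ofReal (∏ j : Fin N with j.val < k, sobSymbol j ξ) * ‖φ ξ‖ₑ ^ 2 := by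
  have hcard : (Finset.univ.filter fun j : Fin N => j.val < k).card = k := by
    rw [Fin.card_filter_val_lt, min_eq_right hk]
  have hm : ∀ J : Finset (Fin N), AEMeasurable
      fun ξ => ENNReal.ofReal (∏ j ∈ J, sobSymbol j ξ) * ‖φ ξ‖ₑ ^ 2 := fun J =>
    ((hasTemperateGrowth_prod_sobSymbol J).1.continuous.measurable.ennreal_ofReal.aemeasurable).mul
      ((Lp.aestronglyMeasurable φ).enorm.pow_const 2)
  have e : ∀ ξ, ENNReal.ofReal (symSymbol k ξ) * ‖φ ξ‖ₑ ^ 2 =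
      ∑ J ∈ Finset.powersetCard k Finset.univ,
        ENNReal.ofReal (∏ j ∈ J, sobSymbol j ξ) * ‖φ ξ‖ₑ ^ 2 := fun ξ => by
    rw [symSymbol, symWeight, ENNReal.ofReal_sum_of_nonneg
      fun J _ => Finset.prod_nonneg fun j _ => (sobSymbol_pos j ξ).le, Finset.sum_mul]
  simp only [e]
  rw [lintegral_finsetSum' _ fun J _ => hm J,
    Finset.sum_congr rfl fun J hJ => h.lintegral_prod_sobSymbol
      ((Finset.mem_powersetCard.1 hJ).2.trans hcard.symm),
    Finset.sum_const, Finset.card_powersetCard, Finset.card_univ, Fintype.card_fin, nsmul_eq_mul]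

/-! ### Constants -/

/-- In fact `powConst k` is k!/2^⌊k/2⌋, as each step of two loses one factor 2. -/
theorem factorial_le_two_pow_mul_powConst : ∀ k : ℕ, (k.factorial : ℝ) ≤ 2 ^ k * powConst k
  | 0 => by simp [powConst]
  | 1 => by simp [powConst]
  | k + 2 => by
    have h := factorial_le_two_pow_mul_powConst k
    have hp : (0 : ℝ) ≤ ((k : ℝ) + 1) * (k + 2) := by positivity
    have h0 := powConst_nonneg k
    have h1 := mul_le_mul_of_nonneg_left h hp
    have h2 : 0 ≤ ((k : ℝ) + 1) * (k + 2) * (2 ^ k * powConst k) := by positivity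
    rw [powConst, Nat.factorial_succ, Nat.factorial_succ]
    push_cast
    calc _ = ((k : ℝ) + 1) * (k + 2) * k.factorial := by ring
      _ ≤ ((k : ℝ) + 1) * (k + 2) * (2 ^ k * powConst k) := h1
      _ ≤ _ := by rw [pow_add]; linarith

/-- k! binom(N, k) ≥ (N+1-k)^k ≥ (N/2)^k for N ≥ 2k. One factor 1/2 per particle comes from here and
one from `powConst`. -/
theorem pow_mul_pow_le_powConst_mul_choose {k N : ℕ} (h : 2 * k ≤ N) :
    (1 / 4 : ℝ) ^ k * (N : ℝ) ^ k ≤ powConst k * N.choose k := by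
  have h1 : ((N + 1 - k : ℕ) : ℝ) ^ k ≤ k.factorial * N.choose k := by
    have := N.pow_sub_le_descFactorial k
    rw [Nat.descFactorial_eq_factorial_mul_choose] at this
    exact_mod_cast this
  have h2 : (N : ℝ) / 2 ≤ ((N + 1 - k : ℕ) : ℝ) := by
    rw [Nat.cast_sub (by omega)]
    have : (2 : ℝ) * k ≤ N := by exact_mod_cast h
    push_cast
    linarith
  have h3 : ((N : ℝ) / 2) ^ k ≤ 2 ^ k * powConst k * N.choose k :=
    (pow_le_pow_left₀ (by positivity) h2 k).trans (h1.trans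
      (mul_le_mul_of_nonneg_right (factorial_le_two_pow_mul_powConst k) (Nat.cast_nonneg _)))
  have h4 : (1 / 4 : ℝ) ^ k * (N : ℝ) ^ k = ((N : ℝ) / 2) ^ k / 2 ^ k := by
    rw [← mul_pow, ← div_pow]
    congr 1
    ring
  rw [h4, div_le_iff₀ (by positivity)]
  linarith

/-! ### The main theorem -/

theorem ae_interaction_nonneg (hN : 1 ≤ N) (β : ℝ) {V : Pos d × Pos d → ℝ}
    (hV : ∀ᵐ z, 0 ≤ V z) : ∀ᵐ x : Config d N, 0 ≤ interaction N β V x := by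
  have hη : (N : ℝ) ^ β ≠ 0 := (Real.rpow_pos_of_pos (by exact_mod_cast hN) β).ne'
  have h' : ∀ t ∈ triples N, ∀ᵐ x : Config d N,
      0 ≤ V (tripleMap ((N : ℝ) ^ β) t.1 t.2.1 t.2.2 x) := fun t ht => by
    obtain ⟨h1, h2, h3⟩ := ne_of_mem_triples ht
    exact (quasiMeasurePreserving_tripleMap (d := d) hη h1 h2 h3).ae hV
  filter_upwards [(eventually_all_finset (triples N)).2 h'] with x hx
  rw [interaction_eq_sum_triples]
  exact mul_nonneg (by positivity)
    (Finset.sum_nonneg fun t ht => mul_nonneg (by positivity) (hx t ht))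

theorem smallInteraction_of_schwartz {v : Config d N → ℝ} (hv : MemLp v ⊤ volume) {k : ℕ} {δ : ℝ}
    (hδ0 : 0 ≤ δ) (hδ : 4 * (k + 1) * δ ≤ 1)
    (h : ∀ f : 𝓢(Config d N, ℂ), -(δ * weightSq (errorWeight k) f) ≤
      (inner ℂ ((mulSchwartz (fun ξ => symWeight (k + 1) fun j => sobSymbol j ξ)
        (𝓕 f)).toLp 2 volume : Wave d N) (fourierMul hv ((𝓕 f).toLp 2 volume))).re) :
    SmallInteraction hv k := by
  refine ⟨δ, hδ0, hδ, fun R u hu => ?_⟩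
  have h1 := hu.re_integral_ge (T := fourierMul hv) (W := fun ξ => δ * errorWeight k ξ)
    (hasTemperateGrowth_symWeight (k + 1))
    ((Function.HasTemperateGrowth.const δ).mul (hasTemperateGrowth_errorWeight k)) fun f => by
      have h2 := h (𝓕⁻ f)
      rw [weightSq, fourier_fourierInv_eq] at h2
      simpa only [mul_assoc, integral_const_mul] using h2
  simp only [mul_assoc, integral_const_mul] at h1
  exact h1

/-- The error constant is of order N^(2dβ) N^(2β) N^(-1), from the height of the potential, two of
its derivatives and the sum over triples. Its exponent is negative, so it becomes small for large N.
-/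
theorem MemSobolevW.exists_smallInteraction (hd : d = 1 ∨ d = 2) {p : ℝ≥0∞}
    (hp : 2 * (d : ℝ≥0∞) ≤ p) {β : ℝ} (hβ : 0 ≤ β) (hβ' : (2 * d + 2) * β < 1)
    {V : Pos d × Pos d → ℝ} (hV0 : ∀ᵐ z, 0 ≤ V z) (hV : MemSobolevW p 2 V) (k : ℕ) :
    ∃ N₀ : ℕ, 1 ≤ N₀ ∧ ∀ N : ℕ, N₀ ≤ N → ∃ hv : MemLp (interaction N β V : Config d N → ℝ) ⊤ volume,
      SmallInteraction hv k := by
  obtain ⟨C, hC0, hC⟩ := hV.exists_re_inner_fourierMul_schwartz_ge hd hp hβ hV0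
  have hlim : Tendsto (fun N : ℕ => 4 * ((k : ℝ) + 1) * (C * (k + 2) ^ 2 *
      (N : ℝ) ^ (-(1 - (2 * d + 2) * β)))) atTop (nhds (4 * ((k : ℝ) + 1) * (C * (k + 2) ^ 2 * 0))) :=
    (((tendsto_rpow_neg_atTop (by linarith)).comp tendsto_natCast_atTop_atTop).const_mul
      _).const_mul _
  rw [mul_zero, mul_zero] at hlim
  obtain ⟨N₁, hN₁⟩ := eventually_atTop.1 (hlim.eventually_le_const one_pos)
  refine ⟨max N₁ 1, le_max_right _ _, fun N hN => ?_⟩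
  have hN1 : 1 ≤ N := (le_max_right _ _).trans hN
  have hNpos : (0 : ℝ) < N := by exact_mod_cast hN1
  obtain ⟨hv, h⟩ := hC N hN1
  refine ⟨hv, smallInteraction_of_schwartz hv (by positivity) ?_ (h k)⟩
  refine le_trans (le_of_eq ?_) (hN₁ N ((le_max_left _ _).trans hN))
  congr 2
  rw [← Real.rpow_natCast ((N : ℝ) ^ β), ← Real.rpow_mul hNpos.le, ← Real.rpow_add hNpos,
    ← Real.rpow_sub_one hNpos.ne']
  congr 1
  push_cast
  ring

end ThreeBodyBose

end

theorem proposition2p1 (d : ℕ) (hd : d = 1 ∨ d = 2) (p : ENNReal) (hp : 2 * (d : ENNReal) ≤ p)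
    (β : ℝ) (hβ0 : 0 < β) (hβ1 : β < 1 / (4 * ((d : ℝ) + 1)))
    (V : ThreeBodyBose.Pos d × ThreeBodyBose.Pos d → ℝ)
    (hVnonneg : ∀ᵐ z, 0 ≤ V z)
    (hVsymm : ∀ᵐ z, V z = V z.swap)
    (hVsob : ThreeBodyBose.MemSobolevW p 2 V) :
    ∃ C : ℝ, 0 < C ∧ ∀ k : ℕ, ∃ N₀ : ℕ, k ≤ N₀ ∧ ∀ N : ℕ, N₀ ≤ N →
      ∀ ψ : ThreeBodyBose.Wave d N, ThreeBodyBose.IsSymmetric ψ →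
        ENNReal.ofReal (C ^ k * (N : ℝ) ^ k) * ThreeBodyBose.sobolevForm k ψ ≤
          ThreeBodyBose.energyPowForm N β V k ψ := by
  -- The assumed bound gives even (2d+2)β < 1/2.
  have hβ' : (2 * (d : ℝ) + 2) * β < 1 := by
    rw [lt_div_iff₀ (by positivity)] at hβ1
    nlinarith
  choose N₁ hN₁ hsmall using
    fun m => hVsob.exists_smallInteraction hd hp hβ0.le hβ' hVnonneg m
  -- The threshold exceeds all N₁ m with m ≤ k, including m = 0, which forces N ≥ 1 even for k = 0;
  -- the summand 2k is for the binomial coefficient.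
  refine ⟨1 / 4, by norm_num, fun k => ⟨(∑ m ∈ Finset.range (k + 1), N₁ m) + 2 * k, by omega,
    fun N hN ψ hψ => ?_⟩⟩
  have hle : ∀ m, m ≤ k → N₁ m ≤ N := fun m hm => by
    have h1 : N₁ m ≤ ∑ i ∈ Finset.range (k + 1), N₁ i :=
      Finset.single_le_sum (f := N₁) (fun _ _ => Nat.zero_le _)
        (Finset.mem_range.2 (show m < k + 1 by omega))
    omega
  have hN1 : 1 ≤ N := (hN₁ 0).trans (hle 0 (Nat.zero_le k))
  obtain ⟨hv, -⟩ := hsmall 0 N (hle 0 (Nat.zero_le k))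
  have h := ThreeBodyBose.powConst_mul_lintegral_le hN1 hv
    (ThreeBodyBose.ae_interaction_nonneg hN1 β hVnonneg) (k := k)
    (fun m hm => (hsmall m N (hle m (by omega))).2) ψ
  refine le_trans ?_ h
  simp only [ENNReal.ofReal_mul (ThreeBodyBose.powConst_nonneg k), mul_assoc]
  rw [MeasureTheory.lintegral_const_mul' _ _ ENNReal.ofReal_ne_top,
    hψ.fourier.lintegral_symSymbol (by omega), ← mul_assoc, ← ENNReal.ofReal_natCast,
    ← ENNReal.ofReal_mul (ThreeBodyBose.powConst_nonneg k)]
  exact mul_le_mul' (ENNReal.ofReal_le_ofReal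
    (ThreeBodyBose.pow_mul_pow_le_powConst_mul_choose (by omega))) le_rfl
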